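/- Let $q,m,d\ge 1$, let $\mathbb F$ be a finite field with a primitive $2^m$-th root of unity $w$, let $g\in\mathbb F[y_1,\dots,y_q]$ have total degree at most $d$, and let $D\ge 2^m-1$ bound the degree of all polynomial oracles. Write $p\,\%\,p'$ for the remainder of $p$ modulo $p'$, and $p[i]$ for the coefficient of $x^i$ in $p$. Let $p_{\mathrm{ev}},p_{\mathrm{od}}$ be the polynomials with $p(x)=p_{\mathrm{ev}}(x^2)+x\,p_{\mathrm{od}}(x^2)$. Let $g_0,\dots,g_d$ be the $2q$-variate polynomials with $g(a_1+tb_1,\dots,a_q+tb_q)=\sum_{j=0}^d t^j g_j(a_1,b_1,\dots,a_q,b_q)$, and put $g_{d+1}=0$. For $\deg p\le 2^m-1$ let $\mathsf{mlin}[p]=\sum_{i_1,\dots,i_m\in\{0,1\}}p[i_1+2i_2+\dots+2^{m-1}i_m]\,x_1^{i_1}\cdots x_m^{i_m}$. The reduction has as its instance oracles to polynomials $f_1,\dots,f_q$ of degree at most $2^m-1$ and to a polynomial $h$ of degree at most $D$. It runs the following step for $n=m,m-1,\dots,1$ on the current claim $g(f_1,\dots,f_q)\,\%\,(x^{2^n}-1)=h$,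 with $N=2^{n-1}$. (1) The prover sends, for $0\le j\le d$, oracles to $$h'_j=g_j(f_{1,\mathrm{ev}},f_{1,\mathrm{od}},\dots,f_{q,\mathrm{ev}},f_{q,\mathrm{od}})\,\%\,(x^N-1),\qquad h_j=\bigl(x^{\lfloor j/2\rfloor}g_j(f_{1,\mathrm{ev}},f_{1,\mathrm{od}},\dots,f_{q,\mathrm{ev}},f_{q,\mathrm{od}})\bigr)\,\%\,(x^N-1),\qquad c_j=x^{N-1}h_j(x^{-1}),$$ and, as field elements, the coefficients of $q_j=\sum_{0\le\ell<\lfloor j/2\rfloor\%N}h_j[\ell]\,x^\ell$. (2) At a random non-zero point $x$ the verifier checks, by oracle queries, $c_j(x)=x^{N-1}h_j(x^{-1})$ and $x^{\lfloor j/2\rfloor\%N}h'_j(x)=h_j(x)+q_j(x)(x^N-1)$ for all $0\le j\le d$, and $h(x)=\sum_{j=0}^{\lfloor d/2\rfloor}\bigl(h_{2j}(x^2)+x\,h_{2j+1}(x^2)\bigr)$ with $h_{d+1}=0$. (3) The verifier sends a uniformly random $r\in\mathbb F$. The new claim is $g(f_{1,\mathrm{ev}}+rf_{1,\mathrm{od}},\dots,f_{q,\mathrm{ev}}+rf_{q,\mathrm{od}})\,\%\,(x^N-1)=h'$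 with $h'=\sum_{j=0}^d r^jh'_j$; queries to $h'$ are made through the $h'_j$. After $m$ steps with challenges $r_1,\dots,r_m$ the verifier outputs $(r_1,\dots,r_m,s)$, where $s$ is the value at $1$ of the last $h'$ (which is constant in an honest run). The query points are either (a) sampled independently in every step and disclosed to the prover after its message of that step, or (b) one single point $x$, used in all steps and not disclosed before the last prover message. Then this is a reduction from $g(f_1,\dots,f_q)\,\%\,(x^{2^m}-1)=h$ to $g(\mathsf{mlin}[f_1](r_1,\dots,r_m),\dots,\mathsf{mlin}[f_q](r_1,\dots,r_m))=s$, with the following properties, where all $O$-constants are absolute. - Perfect completeness: if the initial claim is true, the honest prover's oracles have degree at most $D$, the verifier accepts, and the final claim is true, for all choices of query points and challenges. - Soundness error $O(dmD/|\mathbb F|)$, both for (a) and for (b): if the initial claim is false then, for every (computationally unbounded, possibly randomized) prover whose oracles have degree at most $D$, the probability that the verifier accepts and the final claim is true is at most this. - Prover running time $O\bigl(\binom{d+2q}{2q}\,d\,2^m\bigr)$ in field operations, starting from $w$, the coefficients of $g$ and the values of the $f_i$ at the powers of $w$, every oracle being represented by its values on the $N$-element group of powers of $w^{2^m/N}$.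 - Verifier running time $O(d^2m)$ in field operations, not counting oracle queries: for (b) with every operation counted, and for (a) with an exponentiation by a fixed exponent counted as one operation. - $m$ rounds, $O(d^2m)$ field elements and $O(dm)$ oracles sent by the prover, and $O(dm)$ oracle queries made by the verifier. -/

import Mathlib

open Polynomial

universe u

namespace DGM

/-! ### Polynomial preliminaries -/

section Poly

variable {F : Type u} [Field F]

/-- Even part: the polynomial whose `n`-th coefficient is `p[2n]`. -/
noncomputable def evenPart (p : F[X]) : F[X] := contract 2 p

/-- Odd part: the polynomial whose `n`-th coefficient is `p[2n+1]`. -/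
noncomputable def oddPart (p : F[X]) : F[X] := contract 2 p.divX

/-- `f_ev + r f_od`. -/
noncomputable def foldBy (r : F) (p : F[X]) : F[X] := evenPart p + C r * oddPart p

/-- Folding successively by `r 0, r 1, …, r (k-1)`, starting with `r 0`. -/
noncomputable def foldMany : (k : ℕ) → (Fin k → F) → F[X] → F[X]
  | 0, _, p => p
  | k + 1, r, p => foldBy (r (Fin.last k)) (foldMany k (fun i => r i.castSucc) p)

/-- Inverse Kronecker substitution: the multilinear polynomial in `m` variables with the same
coefficients as `p`, the first variable belonging to the least significant bit. -/
noncomputable def mlin (m : ℕ) (p : F[X]) : MvPolynomial (Fin m) F :=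
  ∑ b : Fin m → Fin 2,
    MvPolynomial.C (p.coeff (∑ i : Fin m, 2 ^ (i : ℕ) * (b i : ℕ))) *
      ∏ i : Fin m, MvPolynomial.X i ^ (b i : ℕ)

/-- The component `g_j` in `g(a + t b) = ∑_j t^j g_j(a, b)`, a polynomial in the `2q` variables
`a_1, …, a_q` (left) and `b_1, …, b_q` (right). -/
noncomputable def lineCoeff {q : ℕ} (g : MvPolynomial (Fin q) F) (j : ℕ) :
    MvPolynomial (Fin q ⊕ Fin q) F :=
  (MvPolynomial.aeval
    (fun i => (C (MvPolynomial.X (Sum.inl i)) + X * C (MvPolynomial.X (Sum.inr i)) :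
      (MvPolynomial (Fin q ⊕ Fin q) F)[X])) g).coeff j

/-- `g_j(f_{1,ev}, f_{1,od}, …, f_{q,ev}, f_{q,od})`. -/
noncomputable def component {q : ℕ} (g : MvPolynomial (Fin q) F) (j : ℕ) (f : Fin q → F[X]) :
    F[X] :=
  MvPolynomial.aeval (Sum.elim (fun i => evenPart (f i)) (fun i => oddPart (f i))) (lineCoeff g j)

/-- The initial relation `g(f_1, …, f_q) % (x^(2^m) - 1) = h`. -/
def DomainIdentity {q : ℕ} (g : MvPolynomial (Fin q) F) (m : ℕ) (f : Fin q → F[X]) (h : F[X]) :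
    Prop :=
  MvPolynomial.aeval f g % (X ^ 2 ^ m - 1) = h

/-- The final relation `g(mlin[f_1](r), …, mlin[f_q](r)) = s`. -/
def MlinClaim {q : ℕ} (g : MvPolynomial (Fin q) F) (m : ℕ) (f : Fin q → F[X]) (r : Fin m → F)
    (s : F) : Prop :=
  MvPolynomial.eval (fun i => MvPolynomial.eval r (mlin m (f i))) g = s

end Poly

/-! ### Reductions with polynomial oracles -/

/-- The shape of the communication of a reduction: number of rounds, labels of the polynomial
oracles of the input instance, and, in every round, labels of the oracles and of the field elements
which the prover sends; finally labels of all the verifier's oracle queries. In every round the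
verifier answers the prover's message with one uniformly random field element. -/
structure Format where
  rounds : ℕ
  Input : Type
  Oracle : Fin rounds → Type
  Elem : Fin rounds → Type
  Query : Type
  [fintypeOracle : ∀ k, Fintype (Oracle k)]
  [fintypeElem : ∀ k, Fintype (Elem k)]
  [fintypeQuery : Fintype Query]

attribute [instance] Format.fintypeOracle Format.fintypeElem Format.fintypeQuery

/-- Number of oracles sent by the prover. -/
def Format.numOracles (Φ : Format) : ℕ := ∑ k, Fintype.card (Φ.Oracle k)

/-- Number of field elements sent by the prover. -/
def Format.numElems (Φ : Format) : ℕ := ∑ k, Fintype.card (Φ.Elem k)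

/-- Number of oracle queries made by the verifier. -/
def Format.numQueries (Φ : Format) : ℕ := Fintype.card Φ.Query

/-- The prover's message in round `k`. -/
structure Message (F : Type u) [Field F] (Φ : Format) (k : Fin Φ.rounds) where
  oracle : Φ.Oracle k → F[X]
  elem : Φ.Elem k → F

/-- All prover messages of an execution. -/
abbrev Transcript (F : Type u) [Field F] (Φ : Format) := (k : Fin Φ.rounds) → Message F Φ k

/-- A prover strategy: the message of round `k` as a function of the values (in `S`) which the
verifier has disclosed in the rounds before `k`. -/
abbrev Strategy (F : Type u) [Field F] (Φ : Format) (S : Type u) :=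
  (k : Fin Φ.rounds) → (Fin (k : ℕ) → S) → Message F Φ k

/-- The restriction of a sequence to the rounds before `k`. -/
def before {n : ℕ} {S : Type u} (v : Fin n → S) (k : Fin n) : Fin (k : ℕ) → S :=
  fun i => v (Fin.castLE k.isLt.le i)

/-- The messages sent by a strategy if the verifier discloses `v`. -/
def Strategy.play {F : Type u} [Field F] {Φ : Format} {S : Type u} (P : Strategy F Φ S)
    (v : Fin Φ.rounds → S) : Transcript F Φ :=
  fun k => P k (before v k)

/-- All oracles of a transcript have degree at most `D`. -/
def Transcript.DegreeLE {F : Type u} [Field F] {Φ : Format} (T : Transcript F Φ) (D : ℕ) : Prop :=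
  ∀ k o, ((T k).oracle o).natDegree ≤ D

/-- A verifier: for every query the oracle it goes to and the point (a function of the
query randomness `x`), and the verdict and the output value as functions of the query randomness
`x`, the challenges `r`, the field elements received and the query answers only. -/
structure Verifier (F : Type u) [Field F] (Φ : Format) where
  target : Φ.Query → Φ.Input ⊕ (Σ k, Φ.Oracle k)
  point : (Fin Φ.rounds → F) → Φ.Query → F
  accept : (Fin Φ.rounds → F) → (Fin Φ.rounds → F) → (∀ k, Φ.Elem k → F) → (Φ.Query → F) → Prop
  output : (Fin Φ.rounds → F) → (Fin Φ.rounds → F) → (∀ k, Φ.Elem k → F) → (Φ.Query → F) → F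

section Run

variable {F : Type u} [Field F] {Φ : Format}

/-- The answers to the queries. -/
noncomputable def Verifier.answers (V : Verifier F Φ) (inp : Φ.Input → F[X]) (T : Transcript F Φ)
    (x : Fin Φ.rounds → F) : Φ.Query → F :=
  fun Q => (Sum.elim inp (fun o => (T o.1).oracle o.2) (V.target Q)).eval (V.point x Q)

/-- The verifier accepts. -/
def Verifier.Accepts (V : Verifier F Φ) (inp : Φ.Input → F[X]) (T : Transcript F Φ)
    (x r : Fin Φ.rounds → F) : Prop :=
  V.accept x r (fun k => (T k).elem) (V.answers inp T x)

/-- The value output by the verifier. -/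
noncomputable def Verifier.result (V : Verifier F Φ) (inp : Φ.Input → F[X]) (T : Transcript F Φ)
    (x r : Fin Φ.rounds → F) : F :=
  V.output x r (fun k => (T k).elem) (V.answers inp T x)

/-- Probability of an event under the uniform distribution on a finite type. -/
noncomputable def prob {Ω : Type*} [Finite Ω] (E : Set Ω) : ℝ := (E.ncard : ℝ) / (Nat.card Ω : ℝ)

/-- `V` has soundness error at most `ε` towards the relation `L` for the input oracles `inp` when
a fresh non-zero query point is sampled in every round, independently of everything else, and
disclosed to the prover after its message of that round, along with the challenge: for every prover
with random coins in any finite `Ω` whose oracles have degree at most `D`, the probability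
that the verifier accepts and that the instance which it outputs satisfies `L` is at most `ε`. -/
def Verifier.SoundFresh [Finite F] (V : Verifier F Φ) (D : ℕ) (inp : Φ.Input → F[X])
    (L : (Fin Φ.rounds → F) → F → Prop) (ε : ℝ) : Prop :=
  ∀ (Ω : Type) [Finite Ω] [Nonempty Ω] (P : Ω → Strategy F Φ (Fˣ × F)),
    (∀ ω v, ((P ω).play v).DegreeLE D) →
    prob {c : Ω × (Fin Φ.rounds → Fˣ × F) |
      V.Accepts inp ((P c.1).play c.2) (fun k => ((c.2 k).1 : F)) (fun k => (c.2 k).2) ∧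
      L (fun k => (c.2 k).2)
        (V.result inp ((P c.1).play c.2) (fun k => ((c.2 k).1 : F)) (fun k => (c.2 k).2))} ≤ ε

/-- The same when a single random non-zero point is sampled for all rounds; it is not disclosed
during the interaction, that is, the queries are made after the last round. -/
def Verifier.SoundShared [Finite F] (V : Verifier F Φ) (D : ℕ) (inp : Φ.Input → F[X])
    (L : (Fin Φ.rounds → F) → F → Prop) (ε : ℝ) : Prop :=
  ∀ (Ω : Type) [Finite Ω] [Nonempty Ω] (P : Ω → Strategy F Φ F),
    (∀ ω r, ((P ω).play r).DegreeLE D) →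
    prob {c : Ω × Fˣ × (Fin Φ.rounds → F) |
      V.Accepts inp ((P c.1).play c.2.2) (fun _ => (c.2.1 : F)) c.2.2 ∧
      L c.2.2 (V.result inp ((P c.1).play c.2.2) (fun _ => (c.2.1 : F)) c.2.2)} ≤ ε

end Run

/-! ### The protocol: `m` runs of the reduction step -/

/-- In round `k` (counted from 0) the domain of size `2^(m-k)` is halved to this size. -/
def half (m k : ℕ) : ℕ := 2 ^ (m - 1 - k)

/-- The oracles of one round: `h'_j` (reduced), `h_j` (shifted), `c_j` (reversed). -/
inductive OracleKind
  | reduced | shifted | reversed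
  deriving DecidableEq

instance : Fintype OracleKind :=
  Fintype.ofSurjective (fun i : Fin 3 => ![OracleKind.reduced, .shifted, .reversed] i) (by
    intro x
    cases x
    exacts [⟨0, rfl⟩, ⟨1, rfl⟩, ⟨2, rfl⟩])

/-- The queries of one round with query point `x`: `c_j(x)`, `h_j(x⁻¹)`, `h_j(x²)`, `h_j(x)`,
`h'_j(x)`, and `h'_j` at the query point of the next round (or at 1 after the last round). -/
inductive QueryKind
  | reversedAt | shiftedInv | shiftedSq | shiftedAt | reducedAt | reducedNext
  deriving DecidableEq

instance : Fintype QueryKind :=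
  Fintype.ofSurjective
    (fun i : Fin 6 => ![QueryKind.reversedAt, .shiftedInv, .shiftedSq, .shiftedAt, .reducedAt,
      .reducedNext] i) (by
    intro x
    cases x
    exacts [⟨0, rfl⟩, ⟨1, rfl⟩, ⟨2, rfl⟩, ⟨3, rfl⟩, ⟨4, rfl⟩, ⟨5, rfl⟩])

/-- The format of the protocol. The input oracles are `f_1, …, f_q` and `h` (label `none`). In
round `k`, the element `⟨j, l⟩` is the coefficient of `x^l` in `q_j`. The query `none` is the
query of `h` at the point of the first round. -/
def dgmFormat (q m d : ℕ) : Format where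
  rounds := m
  Input := Option (Fin q)
  Oracle := fun _ => OracleKind × Fin (d + 1)
  Elem := fun k => Σ j : Fin (d + 1), Fin (((j : ℕ) / 2) % half m k)
  Query := Option (Fin m × Fin (d + 1) × QueryKind)

/-- The query point of round `n`, and 1 after the last round. -/
def pointAt {F : Type u} [Field F] {m : ℕ} (x : Fin m → F) (n : ℕ) : F :=
  if hn : n < m then x ⟨n, hn⟩ else 1

/-- The value at `pointAt x n` of the polynomial `h` of the claim before round `n`: the initial `h`
if `n = 0`, and otherwise `∑_j r^j h'_j` with the oracles and the challenge of the round before. -/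
def claimValue {F : Type u} [Field F] {m d : ℕ} (r : Fin m → F)
    (ans : Option (Fin m × Fin (d + 1) × QueryKind) → F) : ℕ → F
  | 0 => ans none
  | k + 1 => if hk : k < m then
      ∑ j : Fin (d + 1), r ⟨k, hk⟩ ^ (j : ℕ) * ans (some (⟨k, hk⟩, j, .reducedNext)) else 0

/-- The verifier. In the second check, `h_{2j}(x²) + x h_{2j+1}(x²)` is summed over all indices up
to `d`. The output `s` is the value at 1 of the polynomial `h'` of the last round. -/
noncomputable def dgmVerifier (F : Type u) [Field F] (q m d : ℕ) : Verifier F (dgmFormat q m d) where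
  target := fun Q => match Q with
    | none => Sum.inl none
    | some (k, j, .reversedAt) => Sum.inr ⟨k, (.reversed, j)⟩
    | some (k, j, .shiftedInv) => Sum.inr ⟨k, (.shifted, j)⟩
    | some (k, j, .shiftedSq) => Sum.inr ⟨k, (.shifted, j)⟩
    | some (k, j, .shiftedAt) => Sum.inr ⟨k, (.shifted, j)⟩
    | some (k, j, .reducedAt) => Sum.inr ⟨k, (.reduced, j)⟩
    | some (k, j, .reducedNext) => Sum.inr ⟨k, (.reduced, j)⟩
  point := fun x Q => match Q with
    | none => pointAt (m := m) x 0
    | some (k, _, .reversedAt) => x k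
    | some (k, _, .shiftedInv) => (x k)⁻¹
    | some (k, _, .shiftedSq) => x k ^ 2
    | some (k, _, .shiftedAt) => x k
    | some (k, _, .reducedAt) => x k
    | some (k, _, .reducedNext) => pointAt (m := m) x ((k : ℕ) + 1)
  accept := fun x r e ans => ∀ k : Fin m,
    (∀ j : Fin (d + 1),
      ans (some (k, j, .reversedAt)) = x k ^ (half m k - 1) * ans (some (k, j, .shiftedInv))) ∧
    claimValue (m := m) (d := d) r ans k =
      ∑ j : Fin (d + 1), x k ^ ((j : ℕ) % 2) * ans (some (k, j, .shiftedSq)) ∧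
    (∀ j : Fin (d + 1),
      x k ^ (((j : ℕ) / 2) % half m k) * ans (some (k, j, .reducedAt)) =
        ans (some (k, j, .shiftedAt)) +
          (∑ l : Fin (((j : ℕ) / 2) % half m k), e k ⟨j, l⟩ * x k ^ (l : ℕ)) *
            (x k ^ half m k - 1))
  output := fun _ r _ ans => claimValue (m := m) (d := d) r ans m

/-- The input oracles `f_1, …, f_q`, `h`. -/
def inputOracles {F : Type u} [Field F] {q : ℕ} (m d : ℕ) (f : Fin q → F[X]) (h : F[X]) :
    (dgmFormat q m d).Input → F[X] :=
  fun o => Option.elim (α := Fin q) o h f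

/-- The honest prover. -/
noncomputable def honest {F : Type u} [Field F] {q : ℕ} (m d : ℕ) (g : MvPolynomial (Fin q) F)
    (f : Fin q → F[X]) : Strategy F (dgmFormat q m d) F :=
  fun k r =>
    let N := half m k
    let fk : Fin q → F[X] := fun i => foldMany k r (f i)
    let h' : ℕ → F[X] := fun j => component g j fk % (X ^ N - 1)
    let h : ℕ → F[X] := fun j => (X ^ (j / 2) * component g j fk) % (X ^ N - 1)
    { oracle := fun o => match o with
        | (.reduced, j) => h' j
        | (.shifted, j) => h j
        | (.reversed, j) => reflect (N - 1) (h j)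
      elem := fun e => (h e.1).coeff (e.2 : ℕ) }

/-! ### Running time: straight-line programs over a field -/

/-- Instructions over a read-only input with labels `ι` and a working memory with addresses in `ℕ`.
Operands are input labels or addresses, results are written to an address. Neither the instructions
nor any constants in them depend on the field. -/
inductive Instr (ι : Type)
  | one (dst : ℕ)
  | add (dst : ℕ) (a b : ι ⊕ ℕ)
  | sub (dst : ℕ) (a b : ι ⊕ ℕ)
  | mul (dst : ℕ) (a b : ι ⊕ ℕ)
  | inv (dst : ℕ) (a : ι ⊕ ℕ)
  | pow (dst : ℕ) (a : ι ⊕ ℕ) (e : ℕ)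

/-- The cost of an instruction, if raising to the power `e` costs `pc e`. -/
def Instr.cost {ι : Type} (pc : ℕ → ℕ) : Instr ι → ℕ
  | .pow _ _ e => pc e
  | _ => 1

/-- The cost of exponentiation by repeated squaring. -/
def binaryCost (e : ℕ) : ℕ := 2 * Nat.size e + 1

/-- Exponentiation as a single operation. -/
def unitCost (_ : ℕ) : ℕ := 1

/-- Running time of a straight-line program. -/
def time {ι : Type} (pc : ℕ → ℕ) (p : List (Instr ι)) : ℕ := (p.map (Instr.cost pc)).sum

section Exec

variable {F : Type u} [Field F]

/-- The value of an operand. -/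
def readOperand {ι : Type} (inp : ι → F) (mem : ℕ → F) : ι ⊕ ℕ → F := Sum.elim inp mem

/-- The memory after one instruction. -/
def Instr.exec {ι : Type} (inp : ι → F) (mem : ℕ → F) : Instr ι → (ℕ → F)
  | .one dst => Function.update mem dst 1
  | .add dst a b => Function.update mem dst (readOperand inp mem a + readOperand inp mem b)
  | .sub dst a b => Function.update mem dst (readOperand inp mem a - readOperand inp mem b)
  | .mul dst a b => Function.update mem dst (readOperand inp mem a * readOperand inp mem b)
  | .inv dst a => Function.update mem dst (readOperand inp mem a)⁻¹
  | .pow dst a e => Function.update mem dst (readOperand inp mem a ^ e)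

/-- The memory after a program. -/
def exec {ι : Type} (inp : ι → F) (p : List (Instr ι)) (mem : ℕ → F) : ℕ → F :=
  p.foldl (fun mem i => i.exec inp mem) mem

end Exec

/-- The prover's input: the root of unity `w`, the coefficients of `g`, and the values of
`f_1, …, f_q` at `w^0, …, w^(2^m-1)`. -/
inductive ProverInput (q m : ℕ)
  | root
  | coeff (s : Fin q →₀ ℕ)
  | value (i : Fin q) (t : Fin (2 ^ m))

/-- A program for the prover. The code of round `k` may read the challenges of the rounds before
`k`; the memory is kept between rounds. After the code of round `k` the values of each oracle of
that round at the points of the halved domain, which represent the oracle, and the field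
elements of that round are found at the given places. -/
structure ProverProgram (q m d : ℕ) where
  code : (k : Fin m) → List (Instr (ProverInput q m ⊕ Fin (k : ℕ)))
  oracleOut : (k : Fin m) → (dgmFormat q m d).Oracle k → Fin (half m k) →
    (ProverInput q m ⊕ Fin (k : ℕ)) ⊕ ℕ
  elemOut : (k : Fin m) → (dgmFormat q m d).Elem k → (ProverInput q m ⊕ Fin (k : ℕ)) ⊕ ℕ

/-- Total running time over all rounds. -/
def ProverProgram.time {q m d : ℕ} (P : ProverProgram q m d) : ℕ :=
  ∑ k, DGM.time binaryCost (P.code k)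

section Correct

variable {F : Type u} [Field F]

/-- The values of the prover's input. -/
noncomputable def proverInput {q : ℕ} (m : ℕ) (w : F) (g : MvPolynomial (Fin q) F)
    (f : Fin q → F[X]) : ProverInput q m → F
  | .root => w
  | .coeff s => g.coeff s
  | .value i t => (f i).eval (w ^ (t : ℕ))

/-- The prover's memory before round `n`. -/
def ProverProgram.memory {q m d : ℕ} (P : ProverProgram q m d) (inp : ProverInput q m → F)
    (r : Fin m → F) : ℕ → (ℕ → F)
  | 0 => 0
  | n + 1 => if hn : n < m then
      exec (Sum.elim inp (before r ⟨n, hn⟩)) (P.code ⟨n, hn⟩) (P.memory inp r n)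
    else P.memory inp r n

/-- On input `w`, `g`, `f` and challenges `r` the program computes the honest prover's messages,
every oracle of round `k` being given by its values at the powers of `w^(2^(k+1))`. -/
def ProverProgram.Computes {q m d : ℕ} (P : ProverProgram q m d) (w : F)
    (g : MvPolynomial (Fin q) F) (f : Fin q → F[X]) (r : Fin m → F) : Prop :=
  ∀ k : Fin m,
    let inp := Sum.elim (proverInput m w g f) (before r k)
    let mem := P.memory (proverInput m w g f) r ((k : ℕ) + 1)
    let msg := (honest m d g f).play r k
    (∀ o i, readOperand inp mem (P.oracleOut k o i) =
      (msg.oracle o).eval ((w ^ 2 ^ ((k : ℕ) + 1)) ^ (i : ℕ))) ∧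
    (∀ e, readOperand inp mem (P.elemOut k e) = msg.elem e)

end Correct

/-- A program for a verifier with randomness labelled by `κ`: `prep` computes the query points from
the randomness, `main` works on the randomness, the field elements received and the query answers,
continuing with the memory of `prep`; the verifier accepts if all values in `checks` are zero, each
test counting as one operation. -/
structure VerifierProgram (κ : Type) (Φ : Format) where
  prep : List (Instr κ)
  pointOut : Φ.Query → κ ⊕ ℕ
  main : List (Instr (κ ⊕ (Σ k, Φ.Elem k) ⊕ Φ.Query))
  checks : List ((κ ⊕ (Σ k, Φ.Elem k) ⊕ Φ.Query) ⊕ ℕ)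
  out : (κ ⊕ (Σ k, Φ.Elem k) ⊕ Φ.Query) ⊕ ℕ

/-- Running time of the verifier; oracle queries are counted separately. -/
def VerifierProgram.time {κ : Type} {Φ : Format} (pc : ℕ → ℕ) (A : VerifierProgram κ Φ) : ℕ :=
  DGM.time pc A.prep + DGM.time pc A.main + A.checks.length

/-- With randomness `coins`, the program does what the verifier `V` does with query randomness `x`
and challenges `r`. -/
def VerifierProgram.Implements {F : Type u} [Field F] {κ : Type} {Φ : Format}
    (A : VerifierProgram κ Φ) (V : Verifier F Φ) (coins : κ → F) (x r : Fin Φ.rounds → F) : Prop :=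
  let mem₀ : ℕ → F := exec coins A.prep 0
  (∀ Q, readOperand coins mem₀ (A.pointOut Q) = V.point x Q) ∧
  ∀ (e : ∀ k, Φ.Elem k → F) (ans : Φ.Query → F),
    let inp : κ ⊕ (Σ k, Φ.Elem k) ⊕ Φ.Query → F :=
      Sum.elim coins (Sum.elim (fun a => e a.1 a.2) ans)
    let mem := exec inp A.main mem₀
    ((∀ a ∈ A.checks, readOperand inp mem a = 0) ↔ V.accept x r e ans) ∧
    readOperand inp mem A.out = V.output x r e ans

end DGM

open DGM

/-! One round rests on the identity `g(f)(x) = ∑_j x^j g_j(f_ev, f_od)(x²)`, obtained from `f(x) =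
f_ev(x²) + x f_od(x²)`. Writing `x^j = x^(j%2) (x²)^(j/2)` and reducing modulo `x^(2N) - 1`, which
is `x^N - 1` at `x²`, expresses the remainder of `g(f)` by the shifted remainders `h_j`
(`sum_expand_component`, `aeval_mod_eq_of_shifted`). The `h_j` are determined by the `h'_j`, and the
combination of the `h'_j` with weights `r^j` is the remainder of `g(f_ev + r f_od)`
(`sum_component_fold`). After `m` folds every `f_i` is the constant `mlin[f_i](r)`
(`foldMany_eq_C_mlin`). This gives completeness.

For soundness, the checks of a round are polynomial identities tested at a random nonzero point, and
a false one has at most `3D` roots (`ncard_passes_le`). If they all hold, the reversed oracles force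
`deg h_j < N`; since `q_j` is short by its format, also `deg h'_j < N` and `h_j ≡ x^(j/2) h'_j`
modulo `x^N - 1`. A false claim therefore makes some `h'_j` wrong, and at most `d` challenges turn
it into a true one (`ncard_fold_le`). If a false initial claim ends in a true final one, one of
these accidents happens in some round (`exists_bad_round`), and a union bound over the rounds
suffices. It needs only that the point and the challenge of a round can be resampled without
affecting the messages up to that round (`prob_bad_le`), which holds for fresh points and for a
single undisclosed one alike.

Running times are obtained from a calculus of straight-line programs, `Comp`, whose values are
families over all fields and inputs at once, so that one program serves them all. The prover works
with values on a group of roots of unity: reduction modulo `x^N - 1` is invisible there, splitting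
into even and odd parts is an FFT butterfly, and all `g_j` at a point come together from a
multivariate Horner scheme over polynomials in `t` (`comp_horner`). The costs of the rounds are
proportional to `2^(m-1), 2^(m-2), …` and sum to `O(2^m)`. -/

namespace DGM

/-! ### Even and odd parts, folding, and the expansion of `g` along a line -/

section Algebra

variable {F : Type u} [Field F]

theorem coeff_evenPart (p : F[X]) (n : ℕ) : (evenPart p).coeff n = p.coeff (2 * n) := by
  rw [evenPart, coeff_contract two_ne_zero, mul_comm]

theorem coeff_oddPart (p : F[X]) (n : ℕ) : (oddPart p).coeff n = p.coeff (2 * n + 1) := by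
  rw [oddPart, coeff_contract two_ne_zero, coeff_divX, mul_comm]

theorem coeff_foldBy (r : F) (p : F[X]) (n : ℕ) :
    (foldBy r p).coeff n = p.coeff (2 * n) + r * p.coeff (2 * n + 1) := by
  rw [foldBy, coeff_add, coeff_C_mul, coeff_evenPart, coeff_oddPart]

theorem expand_even_add_odd (p : F[X]) :
    expand F 2 (evenPart p) + X * expand F 2 (oddPart p) = p := by
  ext n
  rw [coeff_add]
  rcases Nat.even_or_odd' n with ⟨k, rfl | rfl⟩
  · rw [coeff_expand_mul' two_pos, coeff_evenPart]
    rcases k with _ | k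
    · simp
    · rw [show 2 * (k + 1) = 2 * k + 1 + 1 by ring, coeff_X_mul, coeff_expand two_pos]
      simp
  · rw [coeff_X_mul, coeff_expand_mul' two_pos, coeff_oddPart, coeff_expand two_pos,
      if_neg (by omega), zero_add]

theorem eval_even_add_odd (p : F[X]) (y : F) :
    (evenPart p).eval (y ^ 2) + y * (oddPart p).eval (y ^ 2) = p.eval y := by
  conv_rhs => rw [← expand_even_add_odd p]
  simp [expand_eval]

theorem degree_foldBy_lt {p : F[X]} {N : ℕ} (r : F) (hp : p.degree < (2 * N : ℕ)) :
    (foldBy r p).degree < N := by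
  rw [degree_lt_iff_coeff_zero] at hp ⊢
  intro n hn
  rw [coeff_foldBy, hp _ (by omega), hp _ (by omega)]
  simp

/-- The line `a + t b` through `g`, as a polynomial in `t`. -/
theorem component_eq {q : ℕ} (g : MvPolynomial (Fin q) F) (j : ℕ) (f : Fin q → F[X]) :
    component g j f = (MvPolynomial.aeval
      (fun i => (C (evenPart (f i)) + X * C (oddPart (f i)) : F[X][X])) g).coeff j := by
  set φ : MvPolynomial (Fin q ⊕ Fin q) F →ₐ[F] F[X] :=
    MvPolynomial.aeval (Sum.elim (fun i => evenPart (f i)) (fun i => oddPart (f i)))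
  change φ (lineCoeff g j) = _
  rw [lineCoeff]
  have : (MvPolynomial.aeval
      (fun i => (C (evenPart (f i)) + X * C (oddPart (f i)) : F[X][X])) g) =
      Polynomial.mapAlgHom φ (MvPolynomial.aeval
        (fun i => (C (MvPolynomial.X (Sum.inl i)) + X * C (MvPolynomial.X (Sum.inr i)) :
      (MvPolynomial (Fin q ⊕ Fin q) F)[X])) g) := by
    rw [← AlgHom.comp_apply, MvPolynomial.comp_aeval]
    congr 2
    funext i
    simp [φ]
  rw [this, Polynomial.coe_mapAlgHom, coeff_map]
  rfl

/-- Each variable is replaced by a polynomial of degree at most one in `t`, so a monomial of degree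
`e` yields degree at most `e`. Hence the components with index up to `d` are all there are. -/
theorem natDegree_aeval_line_le {σ : Type*} {S : Type*} [CommRing S] [Algebra F S]
    (g : MvPolynomial σ F) (a b : σ → S) :
    (MvPolynomial.aeval (fun i => (C (a i) + X * C (b i) : S[X])) g).natDegree ≤
      g.totalDegree := by
  rw [MvPolynomial.aeval_def, MvPolynomial.eval₂_eq]
  refine natDegree_sum_le_of_forall_le _ _ fun s hs => ?_
  refine (natDegree_mul_le).trans ?_
  rw [IsScalarTower.algebraMap_apply F S S[X], ← Polynomial.C_eq_algebraMap, natDegree_C, zero_add]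
  refine (natDegree_prod_le _ _).trans ?_
  refine le_trans (Finset.sum_le_sum (g := fun i => s i) fun i _ => ?_)
    (MvPolynomial.le_totalDegree hs)
  refine natDegree_pow_le.trans ?_
  have : (C (a i) + X * C (b i) : S[X]).natDegree ≤ 1 := by compute_degree
  nlinarith

theorem sum_component_mul_pow {q d : ℕ} {g : MvPolynomial (Fin q) F} (hg : g.totalDegree ≤ d)
    (f : Fin q → F[X]) (t : F[X]) :
    ∑ j : Fin (d + 1), component g j f * t ^ (j : ℕ) =
      MvPolynomial.aeval (fun i => evenPart (f i) + t * oddPart (f i)) g := by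
  have h := (natDegree_aeval_line_le g (fun i => evenPart (f i)) (fun i => oddPart (f i))).trans hg
  simp_rw [component_eq]
  rw [Fin.sum_univ_eq_sum_range
    (fun j => (MvPolynomial.aeval
      (fun i => (C (evenPart (f i)) + X * C (oddPart (f i)) : F[X][X])) g).coeff j * t ^ j) (d + 1),
    ← eval_eq_sum_range' (by omega), ← Polynomial.coe_aeval_eq_eval,
    ← AlgHom.restrictScalars_apply F (aeval t), ← AlgHom.comp_apply, MvPolynomial.comp_aeval]
  congr 2
  funext i
  simp
  ring

/-- The specialization `t = r` of the line. It is the reason for weighting `h'_j` by `r^j`: one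
challenge folds the arguments of `g` and batches the component claims simultaneously. -/
theorem sum_component_fold {q d : ℕ} {g : MvPolynomial (Fin q) F} (hg : g.totalDegree ≤ d)
    (f : Fin q → F[X]) (r : F) :
    ∑ j : Fin (d + 1), C (r ^ (j : ℕ)) * component g j f =
      MvPolynomial.aeval (fun i => foldBy r (f i)) g := by
  have := sum_component_mul_pow hg f (C r)
  simp only [foldBy]
  rw [← this]
  refine Finset.sum_congr rfl fun j _ => ?_
  rw [C_pow, mul_comm]

/-- The homomorphism `ψ`, which puts `t = X` and replaces `X` by `X²` in the coefficients, maps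
`f_ev + t f_od` to `f`. Of the resulting factor `X^j`, the even part `X^(2⌊j/2⌋)` moves inside the
expansion; this is the origin of the shift by `⌊j/2⌋` in `h_j`. -/
theorem sum_expand_component {q d : ℕ} {g : MvPolynomial (Fin q) F} (hg : g.totalDegree ≤ d)
    (f : Fin q → F[X]) :
    ∑ j : Fin (d + 1), X ^ ((j : ℕ) % 2) * expand F 2 (X ^ ((j : ℕ) / 2) * component g j f) =
      MvPolynomial.aeval f g := by
  let f' : Fin q → F[X][X] := fun i => C (evenPart (f i)) + X * C (oddPart (f i))
  have h := (natDegree_aeval_line_le g (fun i => evenPart (f i)) (fun i => oddPart (f i))).trans hg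
  let ψ : F[X][X] →ₐ[F] F[X] :=
    { eval₂RingHom (expand F 2 : F[X] →+* F[X]) X with
      commutes' := fun c => by simp [Polynomial.algebraMap_apply] }
  have hψ : ∀ P, ψ P = P.eval₂ (expand F 2 : F[X] →+* F[X]) X := fun _ => rfl
  have key : ψ (MvPolynomial.aeval f' g) = MvPolynomial.aeval f g := by
    rw [← AlgHom.comp_apply, MvPolynomial.comp_aeval]
    congr 2
    funext i
    conv_rhs => rw [← expand_even_add_odd (f i)]
    simp [hψ, f']
    exact mul_comm _ _
  rw [← key]
  have h2 : ψ (MvPolynomial.aeval f' g) =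
      ∑ j ∈ Finset.range (d + 1), expand F 2 ((MvPolynomial.aeval f' g).coeff j) * X ^ j := by
    rw [hψ, Polynomial.eval₂_eq_sum_range' _ (n := d + 1) (Nat.lt_succ_of_le h)]
    rfl
  rw [h2, ← Fin.sum_univ_eq_sum_range (fun j =>
    expand F 2 ((MvPolynomial.aeval f' g).coeff j) * X ^ j)]
  refine Finset.sum_congr rfl fun j _ => ?_
  rw [component_eq, map_mul, map_pow, expand_X, ← mul_assoc, ← pow_mul, ← pow_add, mul_comm]
  congr 2
  omega

/-- Each fold consumes the lowest remaining bit of the exponent. In the original exponent this is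
bit `k` at the fold with challenge `r k`, so the induction splits off the last entry of the bit
vector `b`. -/
theorem coeff_foldMany (k : ℕ) (r : Fin k → F) (p : F[X]) (n : ℕ) :
    (foldMany k r p).coeff n =
      ∑ b : Fin k → Fin 2, p.coeff (∑ i : Fin k, 2 ^ (i : ℕ) * (b i : ℕ) + 2 ^ k * n) *
        ∏ i : Fin k, r i ^ (b i : ℕ) := by
  induction k generalizing n with
  | zero => simp [foldMany]
  | succ k ih =>
    rw [foldMany, coeff_foldBy, ih, ih, ← (Fin.snocEquiv fun _ => Fin 2).sum_comp,
      Fintype.sum_prod_type, Fin.sum_univ_two, Finset.mul_sum]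
    congr 1
    · refine Finset.sum_congr rfl fun b _ => ?_
      simp [Fin.sum_univ_castSucc, Fin.prod_univ_castSucc, pow_succ, mul_assoc]
    · refine Finset.sum_congr rfl fun b _ => ?_
      simp only [Fin.snocEquiv, Equiv.coe_fn_mk, Fin.sum_univ_castSucc, Fin.prod_univ_castSucc,
        Fin.snoc_castSucc, Fin.snoc_last, Fin.val_castSucc, Fin.val_last, Fin.val_one, pow_one,
        mul_one]
      rw [show ∑ i : Fin k, 2 ^ (i : ℕ) * (b i : ℕ) + 2 ^ k * (2 * n + 1) =
        ∑ i : Fin k, 2 ^ (i : ℕ) * (b i : ℕ) + 2 ^ k + 2 ^ (k + 1) * n by ring]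
      ring

theorem degree_foldMany_lt {n : ℕ} (k : ℕ) (r : Fin k → F) {p : F[X]}
    (hp : p.degree < (2 ^ (n + k) : ℕ)) : (foldMany k r p).degree < (2 ^ n : ℕ) := by
  induction k generalizing n with
  | zero => simpa [foldMany] using hp
  | succ k ih =>
    rw [foldMany]
    refine degree_foldBy_lt _ ?_
    rw [show 2 * 2 ^ n = 2 ^ (n + 1) by ring]
    exact ih _ (by rwa [show n + 1 + k = n + (k + 1) by ring])

theorem degree_lt_of_natDegree_le {p : F[X]} {N : ℕ} (hN : 0 < N) (hp : p.natDegree ≤ N - 1) :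
    p.degree < N :=
  lt_of_le_of_lt degree_le_natDegree (by exact_mod_cast (by omega))

/-- Every fold halves the degree bound, so after `m` folds only the coefficient at `0` is left, and
`coeff_foldMany` at `n = 0` is the evaluation of the multilinear polynomial. -/
theorem foldMany_eq_C_mlin {m : ℕ} (r : Fin m → F) {p : F[X]}
    (hp : p.degree < (2 ^ m : ℕ)) :
    foldMany m r p = C (MvPolynomial.eval r (mlin m p)) := by
  have h0 : (foldMany m r p).degree < (2 ^ 0 : ℕ) :=
    degree_foldMany_lt m r (by rwa [zero_add])
  rw [eq_C_of_degree_le_zero (p := foldMany m r p)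
    (by rw [← Nat.WithBot.lt_one_iff_le_zero]; simpa using h0)]
  congr 1
  rw [coeff_foldMany, mlin]
  simp

/-! ### Remainders modulo `X ^ N - 1` -/

theorem monic_X_pow_sub_one {N : ℕ} (hN : 0 < N) : (X ^ N - 1 : F[X]).Monic := by
  simpa using monic_X_pow_sub_C (1 : F) hN.ne'

theorem degree_X_pow_sub_one {N : ℕ} (hN : 0 < N) : (X ^ N - 1 : F[X]).degree = N := by
  simpa using degree_X_pow_sub_C hN (1 : F)

theorem mod_eq_iff {N : ℕ} (hN : 0 < N) {p s : F[X]} :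
    p % (X ^ N - 1) = s ↔ s.degree < N ∧ (X ^ N - 1) ∣ p - s := by
  constructor
  · rintro rfl
    refine ⟨?_, ?_⟩
    · rw [← degree_X_pow_sub_one (F := F) hN]
      exact degree_mod_lt _ (monic_X_pow_sub_one hN).ne_zero
    · exact ⟨p / (X ^ N - 1), by rw [EuclideanDomain.mod_eq_sub_mul_div]; ring⟩
  · rintro ⟨hs, hd⟩
    rw [mod_eq_of_dvd_sub hd, mod_eq_self_iff (monic_X_pow_sub_one hN).ne_zero,
      degree_X_pow_sub_one hN]
    exact hs

theorem dvd_sub_mod_X {N : ℕ} (hN : 0 < N) (p : F[X]) :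
    (X ^ N - 1) ∣ p - p % (X ^ N - 1) := ((mod_eq_iff hN).1 rfl).2

theorem degree_mod_X_lt {N : ℕ} (hN : 0 < N) (p : F[X]) :
    (p % (X ^ N - 1)).degree < (N : WithBot ℕ) :=
  ((mod_eq_iff hN).1 rfl).1

theorem C_mul_mod (c : F) (p q : F[X]) : (C c * p) % q = C c * (p % q) := by
  simp [← smul_eq_C_mul, Polynomial.mod_def, smul_modByMonic]

theorem sum_mod {ι : Type*} (s : Finset ι) (p : ι → F[X]) (q : F[X]) :
    (∑ i ∈ s, p i) % q = ∑ i ∈ s, p i % q := by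
  classical
  induction s using Finset.induction_on with
  | empty => simp
  | insert a s ha ih => rw [Finset.sum_insert ha, Finset.sum_insert ha, Polynomial.add_mod, ih]

theorem eval_mod_X {N : ℕ} (hN : 0 < N) (p : F[X]) {y : F} (hy : y ^ N = 1) :
    (p % (X ^ N - 1)).eval y = p.eval y := by
  obtain ⟨s, hs⟩ := dvd_sub_mod_X hN p
  have := congrArg (eval y) hs
  simp only [eval_sub, eval_mul, eval_pow, eval_X, eval_one, hy, sub_self, zero_mul] at this
  exact (sub_eq_zero.1 this).symm

theorem eval_reflect (p : F[X]) {y : F} (hy : y ≠ 0) {n : ℕ} (hp : p.natDegree ≤ n) :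
    (reflect n p).eval y = y ^ n * p.eval y⁻¹ := by
  have := invertibleOfNonzero (inv_ne_zero hy)
  have h := eval₂_reflect_mul_pow (RingHom.id F) y⁻¹ n p hp
  rw [invOf_eq_inv, inv_inv, ← eval, ← eval, inv_pow] at h
  rw [← h]
  field_simp

/-- If `S_j ≡ X^⌊j/2⌋ g_j(f_ev, f_od)` for all `j`, then `∑_j X^(j%2) S_j(X²)` is the remainder
of `g(f)`. -/
theorem aeval_mod_eq_of_shifted {q d N : ℕ} (hN : 0 < N) {g : MvPolynomial (Fin q) F}
    (hg : g.totalDegree ≤ d) (f : Fin q → F[X]) (S : Fin (d + 1) → F[X])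
    (hS : ∀ j : Fin (d + 1), (X ^ ((j : ℕ) / 2) * component g (j : ℕ) f) % (X ^ N - 1) = S j) :
    MvPolynomial.aeval f g % (X ^ (2 * N) - 1) =
      ∑ j : Fin (d + 1), X ^ ((j : ℕ) % 2) * expand F 2 (S j) := by
  rw [mod_eq_iff (by omega)]
  constructor
  · rw [degree_lt_iff_coeff_zero]
    intro n hn
    rw [finsetSum_coeff]
    refine Finset.sum_eq_zero fun j _ => ?_
    have hd := (degree_lt_iff_coeff_zero _ _).1 ((mod_eq_iff hN).1 (hS j)).1
    rw [coeff_X_pow_mul', coeff_expand two_pos]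
    split_ifs with h1 h2
    · exact hd _ (by omega)
    · rfl
    · rfl
  · rw [← sum_expand_component hg f, ← Finset.sum_sub_distrib]
    refine Finset.dvd_sum fun j _ => ?_
    rw [← mul_sub, ← map_sub]
    refine Dvd.dvd.mul_left ?_ _
    have := map_dvd (expand F 2) ((mod_eq_iff hN).1 (hS j)).2
    simpa [← pow_mul] using this

theorem dvd_X_pow_sub_X_pow_mod (N b : ℕ) : (X ^ N - 1 : F[X]) ∣ X ^ b - X ^ (b % N) := by
  have : (X : F[X]) ^ b - X ^ (b % N) = X ^ (b % N) * ((X ^ N) ^ (b / N) - 1 ^ (b / N)) := by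
    rw [mul_sub, one_pow, mul_one, ← pow_mul, ← pow_add, Nat.mod_add_div]
  rw [this]
  exact (sub_dvd_pow_sub_pow _ _ _).mul_left _

/-- The quotient in `X^a S = (X^b p % (X^N - 1)) + Q (X^N - 1)` for `S = p % (X^N - 1)` and
`a = b % N`: its coefficients are the lowest `a` ones of the shifted remainder. -/
theorem shift_identity {N : ℕ} (hN : 0 < N) (p : F[X]) (b : ℕ) :
    X ^ (b % N) * (p % (X ^ N - 1)) = (X ^ b * p) % (X ^ N - 1) +
      (∑ l : Fin (b % N), C (((X ^ b * p) % (X ^ N - 1)).coeff l) * X ^ (l : ℕ)) *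
        (X ^ N - 1) := by
  set a := b % N with ha
  have haN : a < N := Nat.mod_lt _ hN
  set S := p % (X ^ N - 1) with hS
  have hSd := (degree_lt_iff_coeff_zero _ _).1 (degree_mod_X_lt hN p)
  rw [← hS] at hSd
  -- the top `a` coefficients of `S`
  set Q : F[X] := ∑ l : Fin a, C (S.coeff (N - a + l)) * X ^ (l : ℕ) with hQ
  have hQc : ∀ n, Q.coeff n = if n < a then S.coeff (N - a + n) else 0 := by
    intro n
    rw [hQ, finsetSum_coeff]
    simp only [coeff_C_mul, coeff_X_pow]
    split_ifs with h
    · rw [Finset.sum_eq_single ⟨n, h⟩]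
      · simp
      · intro l _ hl
        rw [if_neg, mul_zero]
        intro h2
        exact hl (Fin.ext h2.symm)
      · simp
    · refine Finset.sum_eq_zero fun l _ => ?_
      rw [if_neg (by omega), mul_zero]
  -- The coefficients of `X^a S` at `N, …, N + a - 1` are those of `Q`. Subtracting `Q (X^N - 1)`
  -- removes them there and puts them back at `0, …, a - 1`: a cyclic shift.
  have hmod : (X ^ b * p) % (X ^ N - 1) = X ^ a * S - Q * (X ^ N - 1) := by
    rw [mod_eq_iff hN]
    constructor
    · rw [degree_lt_iff_coeff_zero]
      intro n hn
      rw [mul_sub, mul_one, coeff_sub, coeff_sub, coeff_X_pow_mul', coeff_mul_X_pow', hQc, hQc,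
        if_pos (by omega), if_pos hn, if_neg (by omega : ¬ n < a)]
      split_ifs with h
      · rw [show N - a + (n - N) = n - a by omega]; ring
      · rw [hSd _ (by omega)]; ring
    · have h1 : (X ^ N - 1 : F[X]) ∣ X ^ b - X ^ a := dvd_X_pow_sub_X_pow_mod N b
      have h2 := dvd_sub_mod_X hN p
      rw [← hS] at h2
      have : X ^ b * p - (X ^ a * S - Q * (X ^ N - 1)) =
          (X ^ b - X ^ a) * p + X ^ a * (p - S) + Q * (X ^ N - 1) := by ring
      rw [this]
      exact dvd_add (dvd_add (h1.mul_right _) (h2.mul_left _)) (Dvd.intro_left _ rfl)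
  -- `X^a S` has no terms below `X^a`, so the lowest `a` coefficients of the shifted remainder are
  -- only the wrapped ones, that is, `Q`.
  have hcoef : ∀ l : Fin a, ((X ^ b * p) % (X ^ N - 1)).coeff l = S.coeff (N - a + l) := by
    intro l
    have := l.2
    rw [hmod, mul_sub, mul_one, coeff_sub, coeff_sub, coeff_X_pow_mul', coeff_mul_X_pow', hQc,
      if_neg (by omega), if_neg (by omega), hQc, if_pos l.2]
    ring
  simp_rw [hcoef]
  rw [← hQ, hmod]
  ring

end Algebra

/-! ### Executions in terms of polynomials -/

section Rounds

variable {F : Type u} [Field F] {q m d : ℕ}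

/-- Folding by the first `k` of the challenges `r`. -/
noncomputable def prefixFold (r : Fin m → F) (k : ℕ) (p : F[X]) : F[X] :=
  foldMany k (fun i : Fin k => if h : (i : ℕ) < m then r ⟨i, h⟩ else 0) p

theorem prefixFold_zero (r : Fin m → F) (p : F[X]) : prefixFold r 0 p = p := rfl

theorem prefixFold_succ (r : Fin m → F) {k : ℕ} (hk : k < m) (p : F[X]) :
    prefixFold r (k + 1) p = foldBy (r ⟨k, hk⟩) (prefixFold r k p) := by
  simp [prefixFold, foldMany, hk]

/-- The honest prover of round `k` knows a challenge vector of length `k`, a type that changes with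
the round. `prefixFold` takes the full vector and a natural number instead, which permits recursion
on `k`; its default `0` is not reached for `k ≤ m`. -/
theorem foldMany_before (r : Fin m → F) (k : Fin m) (p : F[X]) :
    foldMany k (before r k) p = prefixFold r k p := by
  rw [prefixFold]
  congr 1
  funext i
  rw [dif_pos (i.2.trans k.2)]
  rfl

theorem prefixFold_full (r : Fin m → F) (p : F[X]) : prefixFold r m p = foldMany m r p := by
  simp [prefixFold]

theorem prefixFold_congr (r r' : Fin m → F) {k : ℕ} (h : ∀ i : Fin m, (i : ℕ) < k → r i = r' i)
    (p : F[X]) : prefixFold r k p = prefixFold r' k p := by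
  rw [prefixFold, prefixFold]
  congr 1
  funext i
  split_ifs with hi
  · exact h _ i.2
  · rfl

theorem half_pos (m k : ℕ) : 0 < half m k := pow_pos two_pos _

theorem two_mul_half {m k : ℕ} (hk : k < m) : 2 * half m k = 2 ^ (m - k) := by
  rw [half, ← pow_succ']
  congr 1
  omega

theorem half_le (m k : ℕ) (hm : 1 ≤ m) : half m k ≤ 2 ^ m - 1 := by
  have h1 : half m k ≤ 2 ^ (m - 1) := Nat.pow_le_pow_right two_pos (Nat.sub_le _ _)
  have h2 : 2 ^ m = 2 * 2 ^ (m - 1) := by rw [← pow_succ']; congr 1; omega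
  have h3 : 0 < 2 ^ (m - 1) := pow_pos two_pos _
  omega

/-- The prover's message in one round, in terms of polynomials: the oracles `h'_j`, `h_j`, `c_j`
and the polynomials `q_j`. -/
structure RoundMsg (F : Type u) [Field F] (d : ℕ) where
  reduced : Fin (d + 1) → F[X]
  shifted : Fin (d + 1) → F[X]
  reversed : Fin (d + 1) → F[X]
  quot : Fin (d + 1) → F[X]

/-- The verifier's checks of one round at the point `y`, for the claim with right-hand side `H`. -/
def RoundMsg.Passes (M : RoundMsg F d) (N : ℕ) (H : F[X]) (y : F) : Prop :=
  (∀ j, (M.reversed j).eval y = y ^ (N - 1) * (M.shifted j).eval y⁻¹) ∧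
  H.eval y = ∑ j : Fin (d + 1), y ^ ((j : ℕ) % 2) * (M.shifted j).eval (y ^ 2) ∧
  ∀ j : Fin (d + 1), y ^ (((j : ℕ) / 2) % N) * (M.reduced j).eval y =
    (M.shifted j).eval y + (M.quot j).eval y * (y ^ N - 1)

/-- The messages of a transcript in terms of polynomials. -/
noncomputable def roundMsgs (T : Transcript F (dgmFormat q m d)) (k : Fin m) : RoundMsg F d where
  reduced j := (T k).oracle (OracleKind.reduced, j)
  shifted j := (T k).oracle (OracleKind.shifted, j)
  reversed j := (T k).oracle (OracleKind.reversed, j)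
  quot j := ∑ l : Fin (((j : ℕ) / 2) % half m k), C ((T k).elem ⟨j, l⟩) * X ^ (l : ℕ)

/-- The right-hand side of the claim before round `k`. -/
noncomputable def claimPoly (T : Fin m → RoundMsg F d) (r : Fin m → F) (h : F[X]) :
    ℕ → F[X]
  | 0 => h
  | k + 1 => if hk : k < m then
      ∑ j : Fin (d + 1), C (r ⟨k, hk⟩ ^ (j : ℕ)) * (T ⟨k, hk⟩).reduced j
    else 0

/-- A query to `h'` is simulated by queries to the `h'_j`, at the point of the round that will use
the value. -/
theorem claimValue_eq (f : Fin q → F[X]) (h : F[X]) (T : Transcript F (dgmFormat q m d))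
    (x r : Fin m → F) {k : ℕ} (hk : k ≤ m) :
    claimValue (m := m) (d := d) r ((dgmVerifier F q m d).answers (inputOracles m d f h) T x) k =
      (claimPoly (roundMsgs T) r h k).eval (pointAt x k) := by
  cases k with
  | zero => rfl
  | succ k =>
    have hk' : k < m := hk
    simp only [claimValue, claimPoly, dif_pos hk', eval_finsetSum, eval_mul, eval_C]
    rfl

theorem accepts_iff (f : Fin q → F[X]) (h : F[X]) (T : Transcript F (dgmFormat q m d))
    (x r : Fin m → F) :
    (dgmVerifier F q m d).Accepts (inputOracles m d f h) T x r ↔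
      ∀ k : Fin m, (roundMsgs T k).Passes (half m k) (claimPoly (roundMsgs T) r h k) (x k) := by
  refine forall_congr' fun k => ?_
  have hk : pointAt x (k : ℕ) = x k := by simp [pointAt]
  refine and_congr Iff.rfl (and_congr ?_ ?_)
  · rw [claimValue_eq f h T x r k.2.le, hk]
    rfl
  · refine forall_congr' fun j => ?_
    simp only [roundMsgs, eval_finsetSum, eval_mul, eval_C, eval_pow, eval_X]
    rfl

theorem result_eq (f : Fin q → F[X]) (h : F[X]) (T : Transcript F (dgmFormat q m d))
    (x r : Fin m → F) :
    (dgmVerifier F q m d).result (inputOracles m d f h) T x r =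
      (claimPoly (roundMsgs T) r h m).eval 1 := by
  have := claimValue_eq f h T x r (le_refl m)
  rw [show pointAt x m = (1 : F) by simp [pointAt]] at this
  exact this

/-! ### Completeness -/

variable (g : MvPolynomial (Fin q) F) (f : Fin q → F[X]) (h : F[X])

/-- The honest prover's messages. -/
noncomputable def honestMsgs (d : ℕ) (r : Fin m → F) (k : Fin m) : RoundMsg F d :=
  let fk : Fin q → F[X] := fun i => prefixFold r k (f i)
  let S : Fin (d + 1) → F[X] := fun j =>
    (X ^ ((j : ℕ) / 2) * component g j fk) % (X ^ half m k - 1)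
  { reduced := fun j => component g j fk % (X ^ half m k - 1)
    shifted := S
    reversed := fun j => reflect (half m k - 1) (S j)
    quot := fun j => ∑ l : Fin (((j : ℕ) / 2) % half m k), C ((S j).coeff l) * X ^ (l : ℕ) }

theorem roundMsgs_honest (r : Fin m → F) :
    roundMsgs ((honest m d g f).play r) = honestMsgs g f d r := by
  funext k
  simp_rw [honestMsgs, ← foldMany_before]
  rfl

theorem natDegree_le_of_degree_lt {p : F[X]} {N : ℕ} (hN : 0 < N)
    (hp : p.degree < (N : WithBot ℕ)) : p.natDegree ≤ N - 1 := by
  rcases eq_or_ne p 0 with rfl | h0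
  · simp
  · have := (natDegree_lt_iff_degree_lt h0).2 hp
    omega

theorem honest_degreeLE (r : Fin m → F) (hm : 1 ≤ m) {D : ℕ} (hD : 2 ^ m - 1 ≤ D) :
    ((honest m d g f).play r).DegreeLE D := by
  intro (k : Fin m) o
  have hN := half_pos m k
  have hle := half_le m k hm
  obtain ⟨o, j⟩ : OracleKind × Fin (d + 1) := o
  have h1 : ∀ p : F[X], (p % (X ^ half m k - 1)).natDegree ≤ half m k - 1 :=
    fun p => natDegree_le_of_degree_lt hN (degree_mod_X_lt hN p)
  have h2 : ∀ p : F[X], (p % (X ^ half m k - 1)).natDegree ≤ D :=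
    fun p => (h1 p).trans (by omega)
  cases o with
  | reduced => exact h2 _
  | shifted => exact h2 _
  | reversed => exact natDegree_reflect_le.trans (max_le (by omega) (h2 _))

/-- Taking remainders is linear over `F`, so the combination of the honest `h'_j` is the remainder
of the combination of the components, which `sum_component_fold` identifies. -/
theorem honest_claimPoly (hg : g.totalDegree ≤ d) (hc : DomainIdentity g m f h) (r : Fin m → F)
    {k : ℕ} (hk : k ≤ m) :
    claimPoly (honestMsgs g f d r) r h k =
      MvPolynomial.aeval (fun i => prefixFold r k (f i)) g % (X ^ 2 ^ (m - k) - 1) := by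
  cases k with
  | zero => exact hc.symm
  | succ k =>
    have hk' : k < m := hk
    rw [claimPoly, dif_pos hk']
    simp_rw [prefixFold_succ r hk', ← sum_component_fold hg, sum_mod, C_mul_mod]
    refine Finset.sum_congr rfl fun j _ => ?_
    rw [honestMsgs, half]
    simp only
    rw [show m - 1 - k = m - (k + 1) by omega]

theorem honest_passes (hg : g.totalDegree ≤ d) (hc : DomainIdentity g m f h)
    (r : Fin m → F) (k : Fin m) {y : F} (hy : y ≠ 0) :
    (honestMsgs g f d r k).Passes (half m k) (claimPoly (honestMsgs g f d r) r h k) y := by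
  have hN := half_pos m k
  refine ⟨fun j => ?_, ?_, fun j => ?_⟩
  · exact eval_reflect _ hy (natDegree_le_of_degree_lt hN (degree_mod_X_lt hN _))
  · rw [honest_claimPoly g f h hg hc r k.2.le, ← two_mul_half k.2,
      aeval_mod_eq_of_shifted hN hg _ _ (fun j => rfl)]
    simp [eval_finsetSum, expand_eval, honestMsgs]
  · have := congrArg (eval y) (shift_identity hN
      (component g j (fun i => prefixFold r k (f i))) ((j : ℕ) / 2))
    simp only [eval_mul, eval_pow, eval_X, eval_add, eval_sub, eval_one] at this
    exact this

theorem aeval_C_const (a : Fin q → F) :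
    MvPolynomial.aeval (fun i => (C (a i) : F[X])) g = C (MvPolynomial.eval a g) := by
  have : (C (MvPolynomial.eval a g) : F[X]) =
      (Polynomial.CAlgHom (R := F) (A := F)) (MvPolynomial.aeval a g) := by
    rw [MvPolynomial.aeval_eq_eval]; rfl
  rw [this, ← AlgHom.comp_apply, MvPolynomial.comp_aeval]
  rfl

/-- After the last round the modulus is `X - 1` and `g` is applied to constants, so the reduction
changes nothing. -/
theorem aeval_prefixFold_full (hf : ∀ i, (f i).degree < (2 ^ m : ℕ)) (r : Fin m → F) :
    MvPolynomial.aeval (fun i => prefixFold r m (f i)) g % (X ^ 2 ^ (m - m) - 1) =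
      C (MvPolynomial.eval (fun i => MvPolynomial.eval r (mlin m (f i))) g) := by
  simp_rw [prefixFold_full, foldMany_eq_C_mlin r (hf _), aeval_C_const]
  rw [Nat.sub_self, pow_zero, mod_eq_iff one_pos]
  refine ⟨?_, by simp⟩
  exact lt_of_le_of_lt degree_C_le (by norm_num)

theorem honest_complete (hm : 1 ≤ m) {D : ℕ} (hD : 2 ^ m - 1 ≤ D) (hg : g.totalDegree ≤ d)
    (hf : ∀ i, (f i).degree < (2 ^ m : ℕ)) (hc : DomainIdentity g m f h) (x : Fin m → Fˣ)
    (r : Fin m → F) :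
    ((honest m d g f).play r).DegreeLE D ∧
    (dgmVerifier F q m d).Accepts (inputOracles m d f h) ((honest m d g f).play r)
      (fun k => (x k : F)) r ∧
    MlinClaim g m f r ((dgmVerifier F q m d).result (inputOracles m d f h)
      ((honest m d g f).play r) (fun k => (x k : F)) r) := by
  refine ⟨honest_degreeLE g f r hm hD, ?_, ?_⟩
  · refine (accepts_iff ..).2 fun k => ?_
    rw [roundMsgs_honest]
    exact honest_passes g f h hg hc r k (x k).ne_zero
  · refine Eq.trans ?_ (result_eq ..).symm
    rw [roundMsgs_honest, honest_claimPoly g f h hg hc r le_rfl, aeval_prefixFold_full g f hf,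
      eval_C]

end Rounds

/-! ### Counting -/

section Counting

/-- If `set a y` changes the component `get a` of `a` to `y`, and if at most `c` values of this
component lead into `E`, whatever the rest, then `E` has density at most `c / |Y|`. -/
theorem ncard_mul_card_le {A Y : Type*} [Finite A] [Finite Y] (get : A → Y) (set : A → Y → A)
    (get_set : ∀ a y, get (set a y) = y) (set_set : ∀ a y z, set (set a y) z = set a z)
    (set_get : ∀ a, set a (get a) = a) (E : Set A) (c : ℕ)
    (hc : ∀ a, {y | set a y ∈ E}.ncard ≤ c) :
    E.ncard * Nat.card Y ≤ c * Nat.card A := by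
  classical
  have := Fintype.ofFinite A
  -- A pair is sent to the changed element together with the old value of the component; changing
  -- back recovers the pair. So `|E| |Y|` is the total size of the fibres bounded by `hc`, and `A`
  -- need not be presented as a product.
  let e : E × Y ≃ Σ a : A, {y | set a y ∈ E} :=
    { toFun := fun p => ⟨set p.1 p.2, ⟨get p.1, by
        simp only [Set.mem_ofPred_eq, set_set, set_get]; exact p.1.2⟩⟩
      invFun := fun s => (⟨set s.1 s.2, s.2.2⟩, get s.1)
      left_inv := fun p => by simp [set_set, get_set, set_get]
      right_inv := fun s => by
        obtain ⟨a, y, hy⟩ := s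
        have h1 : set (set a y) (get a) = a := by rw [set_set, set_get]
        refine Sigma.ext h1 ?_
        simp only [get_set]
        congr! 1
        rw [h1] }
  have h1 := Nat.card_congr e
  rw [Nat.card_prod, Nat.card_sigma] at h1
  rw [← Nat.card_coe_set_eq, h1, Nat.card_eq_fintype_card]
  calc ∑ a, Nat.card {y | set a y ∈ E} ≤ ∑ _a : A, c :=
        Finset.sum_le_sum fun a _ => by rw [Nat.card_coe_set_eq]; exact hc a
    _ = c * Fintype.card A := by simp [mul_comm]

theorem ncard_units_root_le {F : Type u} [Field F] {p : F[X]} (hp : p ≠ 0) :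
    {y : Fˣ | p.eval (y : F) = 0}.ncard ≤ p.natDegree := by
  classical
  refine le_trans ?_ ((Multiset.toFinset_card_le _).trans (card_roots' p))
  rw [← Set.ncard_coe_finset]
  refine Set.ncard_le_ncard_of_injOn (fun y => (y : F)) ?_ (fun a _ b _ h => Units.ext h)
    (Finset.finite_toSet _)
  intro y hy
  simpa [hp] using hy

theorem ncard_root_le {F : Type u} [Field F] {p : F[X]} (hp : p ≠ 0) :
    {y : F | p.eval y = 0}.ncard ≤ p.natDegree := by
  classical
  refine le_trans ?_ ((Multiset.toFinset_card_le _).trans (card_roots' p))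
  rw [← Set.ncard_coe_finset]
  refine Set.ncard_le_ncard ?_ (Finset.finite_toSet _)
  intro y hy
  simpa [hp] using hy

end Counting

/-! ### One round -/

section Round

variable {F : Type u} [Field F] {q d : ℕ}

/-- The polynomial identities which the verifier's checks of one round test. -/
def RoundMsg.Ident (M : RoundMsg F d) (N D : ℕ) (H : F[X]) : Prop :=
  (∀ j, X ^ D * M.reversed j = X ^ (N - 1) * reflect D (M.shifted j)) ∧
  H = ∑ j : Fin (d + 1), X ^ ((j : ℕ) % 2) * expand F 2 (M.shifted j) ∧
  ∀ j : Fin (d + 1), X ^ (((j : ℕ) / 2) % N) * M.reduced j =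
    M.shifted j + M.quot j * (X ^ N - 1)

/-- The degree bounds which the format and the oracle model impose on a message. -/
structure RoundMsg.Bounded (M : RoundMsg F d) (N D : ℕ) : Prop where
  reduced : ∀ j, (M.reduced j).natDegree ≤ D
  shifted : ∀ j, (M.shifted j).natDegree ≤ D
  reversed : ∀ j, (M.reversed j).natDegree ≤ D
  quot : ∀ j : Fin (d + 1), (M.quot j).degree < (((j : ℕ) / 2 % N : ℕ) : WithBot ℕ)

/-- A check that passes at `y` makes `y` a root of the corresponding identity. The degrees are at
most `2D` for the first and third identity, and at most `2D + 1` for the second because of `X *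
h_j(X²)`; the bound `3D` covers this since `D ≥ 1`. -/
theorem ncard_passes_le [Finite F] {M : RoundMsg F d} {N D : ℕ} (hN : 0 < N) (hND : N ≤ D)
    (hM : M.Bounded N D) {H : F[X]} (hH : H.natDegree ≤ D) (hI : ¬ M.Ident N D H) :
    {y : Fˣ | M.Passes N H y}.ncard ≤ 3 * D := by
  have key : ∀ p : F[X], p ≠ 0 → p.natDegree ≤ 3 * D →
      (∀ y : Fˣ, M.Passes N H y → p.eval (y : F) = 0) →
      {y : Fˣ | M.Passes N H y}.ncard ≤ 3 * D := fun p hp hd hy =>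
    (Set.ncard_le_ncard (fun y h => hy y h) (Set.toFinite _)).trans
      ((ncard_units_root_le hp).trans hd)
  simp only [RoundMsg.Ident, not_and_or, not_forall] at hI
  rcases hI with ⟨j, hj⟩ | hj | ⟨j, hj⟩
  · refine key _ (sub_ne_zero.2 hj) ?_ ?_
    · refine (natDegree_sub_le _ _).trans (max_le ?_ ?_)
      · refine natDegree_mul_le.trans ?_
        have := hM.reversed j
        rw [natDegree_X_pow]
        omega
      · refine natDegree_mul_le.trans ?_
        have h1 : (reflect D (M.shifted j)).natDegree ≤ max D (M.shifted j).natDegree :=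
          natDegree_reflect_le
        have := hM.shifted j
        rw [natDegree_X_pow]
        omega
    · intro y hy
      simp only [eval_sub, eval_mul, eval_pow, eval_X]
      rw [hy.1 j, eval_reflect _ y.ne_zero (hM.shifted j)]
      ring
  · refine key _ (sub_ne_zero.2 hj) ?_ ?_
    · refine (natDegree_sub_le _ _).trans (max_le (by omega) ?_)
      refine natDegree_sum_le_of_forall_le _ _ fun j _ => ?_
      refine natDegree_mul_le.trans ?_
      have := hM.shifted j
      rw [natDegree_X_pow, natDegree_expand]
      omega
    · intro y hy
      simp only [eval_sub, eval_finsetSum, eval_mul, eval_pow, eval_X, expand_eval]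
      rw [hy.2.1, sub_self]
  · refine key _ (sub_ne_zero.2 hj) ?_ ?_
    · have ha : (j : ℕ) / 2 % N < N := Nat.mod_lt _ hN
      refine (natDegree_sub_le _ _).trans (max_le ?_ ?_)
      · refine natDegree_mul_le.trans ?_
        have := hM.reduced j
        rw [natDegree_X_pow]
        omega
      · refine (natDegree_add_le _ _).trans (max_le ((hM.shifted j).trans (by omega)) ?_)
        refine natDegree_mul_le.trans ?_
        have h1 : (M.quot j).natDegree ≤ N := by
          refine natDegree_le_of_degree_le ((hM.quot j).le.trans ?_)
          exact_mod_cast ha.le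
        have h2 : (X ^ N - 1 : F[X]).natDegree = N := by
          simpa using natDegree_X_pow_sub_C (r := (1 : F))
        omega
    · intro y hy
      simp only [eval_sub, eval_add, eval_mul, eval_pow, eval_X, eval_one]
      rw [hy.2.2, sub_self]

/-- The purpose of `c_j`: if `x^(N-1) h_j(1/x)` is a polynomial, then `h_j` has degree below `N`.
With denominators cleared by `X^D`, a coefficient of `h_j` at `n ≥ N` would appear on the right at
an exponent below `D`, where the left side vanishes. -/
theorem degree_shifted_lt {M : RoundMsg F d} {N D : ℕ} {H : F[X]} (hN : 0 < N)
    (hM : M.Bounded N D) (hI : M.Ident N D H) (j : Fin (d + 1)) :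
    (M.shifted j).degree < (N : WithBot ℕ) := by
  rw [degree_lt_iff_coeff_zero]
  intro n hn
  by_cases hnD : n ≤ D
  · have h1 := congrArg (fun p => coeff p (N - 1 + D - n)) (hI.1 j)
    simp only [coeff_X_pow_mul'] at h1
    rw [if_neg (by omega), if_pos (by omega), coeff_reflect,
      revAt_le (by omega), show D - (N - 1 + D - n - (N - 1)) = n by omega] at h1
    exact h1.symm
  · exact coeff_eq_zero_of_natDegree_lt (lt_of_le_of_lt (hM.shifted j) (by omega))

/-- No reversed oracle is needed for `h'_j`: with `a = ⌊j/2⌋ % N`, the quotient `q_j` has only `a`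
coefficients by its format, so the right side of the third identity has degree below `N + a`. -/
theorem degree_reduced_lt {M : RoundMsg F d} {N D : ℕ} {H : F[X]} (hN : 0 < N)
    (hM : M.Bounded N D) (hI : M.Ident N D H) (j : Fin (d + 1)) :
    (M.reduced j).degree < (N : WithBot ℕ) := by
  have hs := (degree_lt_iff_coeff_zero _ _).1 (degree_shifted_lt hN hM hI j)
  have hq := (degree_lt_iff_coeff_zero _ _).1 (hM.quot j)
  rw [degree_lt_iff_coeff_zero]
  intro n hn
  have h1 := congrArg (fun p => coeff p (n + (j : ℕ) / 2 % N)) (hI.2.2 j)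
  simp only [coeff_X_pow_mul, mul_sub, mul_one, coeff_add, coeff_sub, coeff_mul_X_pow'] at h1
  rw [h1, hs _ (by omega), if_pos (by omega), hq _ (by omega), hq _ (by omega)]
  simp

/-- Modulo `X^N - 1` the third identity reads `h_j ≡ X^(⌊j/2⌋ % N) h'_j`, and exponents matter only
modulo `N`. Correct `h'_j` therefore imply correct `h_j`, the degree bound excluding other
representatives. -/
theorem aeval_mod_eq_of_ident {M : RoundMsg F d} {N D : ℕ} {H : F[X]} (hN : 0 < N)
    (hM : M.Bounded N D) (hI : M.Ident N D H) {g : MvPolynomial (Fin q) F}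
    (hg : g.totalDegree ≤ d) (f : Fin q → F[X])
    (hred : ∀ j : Fin (d + 1), M.reduced j = component g j f % (X ^ N - 1)) :
    MvPolynomial.aeval f g % (X ^ (2 * N) - 1) = H := by
  rw [hI.2.1]
  refine aeval_mod_eq_of_shifted hN hg f _ fun j => ?_
  refine (mod_eq_iff hN).2 ⟨degree_shifted_lt hN hM hI j, ?_⟩
  have h1 := (dvd_X_pow_sub_X_pow_mod (F := F) N ((j : ℕ) / 2)).mul_right (component g j f)
  have h2 := (dvd_sub_mod_X hN (component g j f)).mul_left (X ^ ((j : ℕ) / 2 % N))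
  have h3 := dvd_mul_left (X ^ N - 1) (M.quot j)
  rw [← hred] at h2
  convert dvd_add (dvd_add h1 h2) h3 using 1
  have := hI.2.2 j
  linear_combination this

/-- By the contrapositive of `aeval_mod_eq_of_ident` some `h'_j` is wrong, say in its coefficient at
`n`. The new claim, read at `n`, is a nonzero polynomial equation for `r` of degree at most `d`. -/
theorem ncard_fold_le [Finite F] {M : RoundMsg F d} {N D : ℕ} {H : F[X]} (hN : 0 < N)
    (hM : M.Bounded N D) (hI : M.Ident N D H) {g : MvPolynomial (Fin q) F}
    (hg : g.totalDegree ≤ d) (f : Fin q → F[X])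
    (hfalse : MvPolynomial.aeval f g % (X ^ (2 * N) - 1) ≠ H) :
    {r : F | MvPolynomial.aeval (fun i => foldBy r (f i)) g % (X ^ N - 1) =
      ∑ j : Fin (d + 1), C (r ^ (j : ℕ)) * M.reduced j}.ncard ≤ d := by
  obtain ⟨j, hj⟩ : ∃ j : Fin (d + 1), M.reduced j ≠ component g j f % (X ^ N - 1) := by
    by_contra! hcon
    exact hfalse (aeval_mod_eq_of_ident hN hM hI hg f hcon)
  obtain ⟨n, hn⟩ : ∃ n, (M.reduced j - component g j f % (X ^ N - 1)).coeff n ≠ 0 := by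
    by_contra! hcon
    exact hj (sub_eq_zero.1 (ext fun n => by simpa using hcon n))
  -- The variable of `p` stands for the challenge: its coefficients are the errors of the `h'_i` at
  -- the fixed exponent `n`.
  let p : F[X] := ∑ i : Fin (d + 1),
    C ((M.reduced i - component g i f % (X ^ N - 1)).coeff n) * X ^ (i : ℕ)
  have hp : p ≠ 0 := by
    intro h0
    have := congrArg (fun p => coeff p j) h0
    simp only [p, finsetSum_coeff, coeff_C_mul, coeff_X_pow, coeff_zero] at this
    rw [Finset.sum_eq_single j (fun i _ hi => by
      rw [if_neg (fun h => hi (Fin.ext h.symm)), mul_zero]) (by simp)] at this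
    rw [if_pos rfl, mul_one] at this
    exact hn this
  have hpd : p.natDegree ≤ d := natDegree_sum_le_of_forall_le _ _ fun i _ =>
    (natDegree_C_mul_X_pow_le _ _).trans (by omega)
  refine le_trans (Set.ncard_le_ncard (fun r hr => ?_) (Set.toFinite _))
    ((ncard_root_le hp).trans hpd)
  simp only [Set.mem_ofPred_eq] at hr ⊢
  rw [← sum_component_fold hg, sum_mod] at hr
  have := congrArg (fun p => coeff p n) hr
  simp only [C_mul_mod, finsetSum_coeff, coeff_C_mul] at this
  simp only [p, eval_finsetSum, eval_mul, eval_C, eval_pow, eval_X, coeff_sub, sub_mul,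
    Finset.sum_sub_distrib]
  rw [sub_eq_zero]
  simp_rw [mul_comm _ (_ ^ _)]
  exact this.symm

end Round

/-! ### All rounds -/

section Sound

variable {F : Type u} [Field F] {q m d : ℕ}

theorem natDegree_claimPoly_le {T : Fin m → RoundMsg F d} {D : ℕ}
    (hT : ∀ k, (T k).Bounded (half m k) D) (r : Fin m → F) {h : F[X]} (hh : h.natDegree ≤ D)
    (k : ℕ) : (claimPoly T r h k).natDegree ≤ D := by
  cases k with
  | zero => exact hh
  | succ k =>
    rw [claimPoly]
    split_ifs with hk
    · exact natDegree_sum_le_of_forall_le _ _ fun j _ =>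
        (natDegree_C_mul_le _ _).trans ((hT _).reduced j)
    · simp

theorem claimPoly_congr {T T' : Fin m → RoundMsg F d} {r r' : Fin m → F} (h : F[X]) {k : ℕ}
    (hT : ∀ i : Fin m, (i : ℕ) < k → T i = T' i) (hr : ∀ i : Fin m, (i : ℕ) < k → r i = r' i) :
    claimPoly T r h k = claimPoly T' r' h k := by
  cases k with
  | zero => rfl
  | succ k =>
    rw [claimPoly, claimPoly]
    split_ifs with hk
    · rw [hT ⟨k, hk⟩ (Nat.lt_succ_self k), hr ⟨k, hk⟩ (Nat.lt_succ_self k)]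
    · rfl

/-- The claim before round `k` is true. -/
def ClaimTrue (g : MvPolynomial (Fin q) F) (f : Fin q → F[X]) (T : Fin m → RoundMsg F d)
    (r : Fin m → F) (h : F[X]) (k : ℕ) : Prop :=
  MvPolynomial.aeval (fun i => prefixFold r k (f i)) g % (X ^ 2 ^ (m - k) - 1) =
    claimPoly T r h k

variable {g : MvPolynomial (Fin q) F} {f : Fin q → F[X]} {h : F[X]} {D : ℕ}

/-- If a false claim passes, then in some round the checks do not reveal a wrong polynomial
identity, or the challenge turns a false claim into a true one. -/
theorem exists_bad_round (hm : 1 ≤ m) {T : Fin m → RoundMsg F d}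
    (hT : ∀ k, (T k).Bounded (half m k) D) {r : Fin m → F}
    (hf : ∀ i, (f i).degree < (2 ^ m : ℕ)) (hfalse : ¬ DomainIdentity g m f h)
    (hfinal : MlinClaim g m f r ((claimPoly T r h m).eval 1)) :
    ∃ k : Fin m, ¬ (T k).Ident (half m k) D (claimPoly T r h k) ∨
      ((T k).Ident (half m k) D (claimPoly T r h k) ∧ ¬ ClaimTrue g f T r h k ∧
        ClaimTrue g f T r h (k + 1)) := by
  by_contra! hcon
  have hI : ∀ k : Fin m, (T k).Ident (half m k) D (claimPoly T r h k) := fun k => (hcon k).1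
  have hall : ∀ k, k ≤ m → ¬ ClaimTrue g f T r h k := by
    intro k
    induction k with
    | zero => exact fun _ => hfalse
    | succ k ih => exact fun hk => (hcon ⟨k, hk⟩).2 (hI _) (ih (Nat.le_of_succ_le hk))
  apply hall m le_rfl
  rw [ClaimTrue, aeval_prefixFold_full g f hf]
  obtain ⟨n, rfl⟩ : ∃ n, m = n + 1 := ⟨m - 1, by omega⟩
  -- The output `s` records only the value at `1`. In the last round `N = 1`, so the identities
  -- force the `h'_j` to be constant, and equality at `1` becomes equality of polynomials.
  have hdeg : (claimPoly T r h (n + 1)).degree < ((1 : ℕ) : WithBot ℕ) := by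
    rw [claimPoly, dif_pos (Nat.lt_succ_self n)]
    refine lt_of_le_of_lt (degree_sum_le _ _)
      ((Finset.sup_lt_iff (by simp [bot_lt_iff_ne_bot])).2 fun j _ => ?_)
    have h1 := degree_reduced_lt (half_pos _ _) (hT _) (hI ⟨n, Nat.lt_succ_self n⟩) j
    have h2 : half (n + 1) n = 1 := by simp [half]
    simp only [h2] at h1
    rw [← smul_eq_C_mul]
    exact lt_of_le_of_lt (degree_smul_le _ _) h1
  have hC := eq_C_of_degree_le_zero (p := claimPoly T r h (n + 1))
    (by rw [← Nat.WithBot.lt_one_iff_le_zero]; simpa using hdeg)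
  rw [MlinClaim] at hfinal
  rw [hfinal]
  rw [hC]
  simp

theorem ncard_claimTrue_le [Finite F] {T : Fin m → RoundMsg F d}
    (hT : ∀ k, (T k).Bounded (half m k) D) (hg : g.totalDegree ≤ d) (r : Fin m → F) (k : Fin m)
    (hI : (T k).Ident (half m k) D (claimPoly T r h k)) (hfalse : ¬ ClaimTrue g f T r h k) :
    {s : F | MvPolynomial.aeval (fun i => foldBy s (prefixFold r k (f i))) g %
      (X ^ half m k - 1) = ∑ j : Fin (d + 1), C (s ^ (j : ℕ)) * (T k).reduced j}.ncard ≤ d := by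
  refine ncard_fold_le (half_pos m k) (hT k) hI hg _ ?_
  rwa [two_mul_half k.2]

theorem claimTrue_succ_iff {T : Fin m → RoundMsg F d} (r : Fin m → F) (k : Fin m) :
    ClaimTrue g f T r h (k + 1) ↔
      MvPolynomial.aeval (fun i => foldBy (r k) (prefixFold r k (f i))) g %
        (X ^ half m k - 1) = ∑ j : Fin (d + 1), C (r k ^ (j : ℕ)) * (T k).reduced j := by
  rw [ClaimTrue, claimPoly, dif_pos k.2, half, Nat.sub_add_eq, Nat.sub_right_comm]
  simp_rw [prefixFold_succ r k.2]

/-- Soundness over an abstract finite space `A` of outcomes, on which the query point and the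
challenge of round `k` can be resampled without changing what the prover has sent before. -/
theorem prob_bad_le [Finite F] {A : Type*} [Finite A] [Nonempty A] (hm : 1 ≤ m) (hd : 1 ≤ d)
    (hD : 2 ^ m - 1 ≤ D) (hg : g.totalDegree ≤ d) (hf : ∀ i, (f i).degree < (2 ^ m : ℕ))
    (hh : h.natDegree ≤ D) (hfalse : ¬ DomainIdentity g m f h)
    (T : A → Fin m → RoundMsg F d) (hT : ∀ a k, (T a k).Bounded (half m k) D)
    (x : A → Fin m → Fˣ) (r : A → Fin m → F)
    (setX : Fin m → A → Fˣ → A) (setR : Fin m → A → F → A)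
    (getX_set : ∀ k a y, x (setX k a y) k = y)
    (setX_set : ∀ k a y z, setX k (setX k a y) z = setX k a z)
    (setX_get : ∀ k a, setX k a (x a k) = a)
    (getR_set : ∀ k a y, r (setR k a y) k = y)
    (setR_set : ∀ k a y z, setR k (setR k a y) z = setR k a z)
    (setR_get : ∀ k a, setR k a (r a k) = a)
    (T_setX : ∀ k a y, ∀ i ≤ k, T (setX k a y) i = T a i)
    (T_setR : ∀ k a y, ∀ i ≤ k, T (setR k a y) i = T a i)
    (r_setX : ∀ k a y, ∀ i < k, r (setX k a y) i = r a i)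
    (r_setR : ∀ k a y, ∀ i < k, r (setR k a y) i = r a i) :
    prob {a | (∀ k, (T a k).Passes (half m k) (claimPoly (T a) (r a) h k) (x a k)) ∧
      MlinClaim g m f (r a) ((claimPoly (T a) (r a) h m).eval 1)} ≤
      7 * (d * m * D) / Nat.card F := by
  set E : Set A := {a | (∀ k, (T a k).Passes (half m k) (claimPoly (T a) (r a) h k) (x a k)) ∧
      MlinClaim g m f (r a) ((claimPoly (T a) (r a) h m).eval 1)} with hE
  let E₁ : Fin m → Set A := fun k => {a | ¬ (T a k).Ident (half m k) D (claimPoly (T a) (r a) h k) ∧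
    (T a k).Passes (half m k) (claimPoly (T a) (r a) h k) (x a k)}
  let E₂ : Fin m → Set A := fun k => {a | (T a k).Ident (half m k) D (claimPoly (T a) (r a) h k) ∧
    ¬ ClaimTrue g f (T a) (r a) h k ∧ ClaimTrue g f (T a) (r a) h (k + 1)}
  have hsub : E ⊆ ⋃ k, (E₁ k ∪ E₂ k) := by
    rintro a ⟨ha, hfin⟩
    obtain ⟨k, hk⟩ := exists_bad_round hm (hT a) hf hfalse hfin
    refine Set.mem_iUnion.2 ⟨k, ?_⟩
    rcases hk with hk | hk
    · exact Or.inl ⟨hk, ha k⟩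
    · exact Or.inr hk
  have hcard : E.ncard ≤ ∑ k, ((E₁ k).ncard + (E₂ k).ncard) := by
    refine (Set.ncard_le_ncard hsub (Set.toFinite _)).trans ?_
    refine (Set.ncard_iUnion_le_of_fintype _).trans ?_
    exact Finset.sum_le_sum fun k _ => Set.ncard_union_le _ _
  -- Resampling the point of round `k` leaves the messages up to that round and the earlier
  -- challenges alone. Hence the identities under test stay fixed while the point varies.
  have h₁ : ∀ k, (E₁ k).ncard * Nat.card Fˣ ≤ 3 * D * Nat.card A := by
    intro k
    refine ncard_mul_card_le (fun a => x a k) (setX k) (getX_set k) (setX_set k) (setX_get k) _ _ ?_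
    intro a
    have hcl : ∀ y, claimPoly (T (setX k a y)) (r (setX k a y)) h k =
        claimPoly (T a) (r a) h k := fun y =>
      claimPoly_congr h (fun i hi => T_setX k a y i (le_of_lt hi)) (fun i hi => r_setX k a y i hi)
    simp only [E₁, Set.mem_ofPred_eq, hcl, T_setX k a _ k le_rfl, getX_set]
    by_cases hI : (T a k).Ident (half m k) D (claimPoly (T a) (r a) h k)
    · simp [hI]
    · simp only [hI, not_false_eq_true, true_and]
      exact ncard_passes_le (half_pos m k) ((half_le m k hm).trans hD) (hT a k)
        (natDegree_claimPoly_le (hT a) _ hh k) hI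
  -- Likewise the challenge of round `k` does not enter the messages or the claim of that round,
  -- only the next claim.
  have h₂ : ∀ k, (E₂ k).ncard * Nat.card F ≤ d * Nat.card A := by
    intro k
    refine ncard_mul_card_le (fun a => r a k) (setR k) (getR_set k) (setR_set k) (setR_get k) _ _ ?_
    intro a
    have hcl : ∀ y, claimPoly (T (setR k a y)) (r (setR k a y)) h k =
        claimPoly (T a) (r a) h k := fun y =>
      claimPoly_congr h (fun i hi => T_setR k a y i (le_of_lt hi)) (fun i hi => r_setR k a y i hi)
    have hpf : ∀ y p, prefixFold (r (setR k a y)) k p = prefixFold (r a) k p := fun y p =>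
      prefixFold_congr _ _ (fun i hi => r_setR k a y i hi) p
    have hmem : ∀ s, setR k a s ∈ E₂ k →
        (T a k).Ident (half m k) D (claimPoly (T a) (r a) h k) ∧ ¬ ClaimTrue g f (T a) (r a) h k ∧
        MvPolynomial.aeval (fun i => foldBy s (prefixFold (r a) k (f i))) g %
          (X ^ half m k - 1) = ∑ j : Fin (d + 1), C (s ^ (j : ℕ)) * (T a k).reduced j := by
      rintro s ⟨h1, h2, h3⟩
      rw [hcl, T_setR k a _ k le_rfl] at h1
      rw [ClaimTrue, hcl] at h2
      rw [claimTrue_succ_iff, getR_set, T_setR k a _ k le_rfl] at h3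
      simp_rw [hpf] at h2 h3
      exact ⟨h1, h2, h3⟩
    by_cases hI : (T a k).Ident (half m k) D (claimPoly (T a) (r a) h k) ∧
        ¬ ClaimTrue g f (T a) (r a) h k
    · exact (Set.ncard_le_ncard (fun s hs => (hmem s hs).2.2) (Set.toFinite _)).trans
        (ncard_claimTrue_le (hT a) hg (r a) k hI.1 hI.2)
    · refine (Set.ncard_le_ncard (t := ∅) ?_ (Set.toFinite _)).trans (by simp)
      exact fun s hs => hI ⟨(hmem s hs).1, (hmem s hs).2.1⟩
  have hA : 0 < Nat.card A := Nat.card_pos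
  have hF : 2 ≤ Nat.card F := Finite.one_lt_card
  -- Points come from `Fˣ`, whose size is `|F| - 1 ≥ |F| / 2`. Thus a round contributes at most `(6D
  -- + d) / |F|`, which is at most `7dD / |F|`.
  have hU : Nat.card F ≤ 2 * Nat.card Fˣ := by
    rw [Nat.card_units]
    omega
  have hDpos : 1 ≤ D := by
    have := half_le m 0 hm
    have := half_pos m 0
    omega
  have hk : ∀ k, ((E₁ k).ncard + (E₂ k).ncard) * Nat.card F ≤ 7 * (d * D) * Nat.card A := by
    intro k
    have h1 : (E₁ k).ncard * Nat.card F ≤ 6 * D * Nat.card A :=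
      calc (E₁ k).ncard * Nat.card F ≤ (E₁ k).ncard * (2 * Nat.card Fˣ) :=
            Nat.mul_le_mul_left _ hU
        _ = 2 * ((E₁ k).ncard * Nat.card Fˣ) := by ring
        _ ≤ 2 * (3 * D * Nat.card A) := Nat.mul_le_mul_left _ (h₁ k)
        _ = _ := by ring
    have h2 : 6 * D + d ≤ 7 * (d * D) := by nlinarith
    calc ((E₁ k).ncard + (E₂ k).ncard) * Nat.card F
        = (E₁ k).ncard * Nat.card F + (E₂ k).ncard * Nat.card F := by ring
      _ ≤ 6 * D * Nat.card A + d * Nat.card A := Nat.add_le_add h1 (h₂ k)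
      _ = (6 * D + d) * Nat.card A := by ring
      _ ≤ _ := Nat.mul_le_mul_right _ h2
  have htotal : E.ncard * Nat.card F ≤ 7 * (d * m * D) * Nat.card A :=
    calc E.ncard * Nat.card F ≤ (∑ k, ((E₁ k).ncard + (E₂ k).ncard)) * Nat.card F :=
          Nat.mul_le_mul_right _ hcard
      _ = ∑ k, ((E₁ k).ncard + (E₂ k).ncard) * Nat.card F := Finset.sum_mul _ _ _
      _ ≤ ∑ _k : Fin m, 7 * (d * D) * Nat.card A := Finset.sum_le_sum fun k _ => hk k
      _ = _ := by simp; ring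
  rw [prob, div_le_div_iff₀ (by exact_mod_cast hA) (by exact_mod_cast (by omega : 0 < Nat.card F))]
  exact_mod_cast htotal

theorem roundMsgs_bounded {T : Transcript F (dgmFormat q m d)} (hT : T.DegreeLE D) (k : Fin m) :
    (roundMsgs T k).Bounded (half m k) D := by
  refine ⟨fun j => hT k _, fun j => hT k _, fun j => hT k _, fun j => ?_⟩
  rw [degree_lt_iff_coeff_zero]
  intro n hn
  simp only [roundMsgs, finsetSum_coeff, coeff_C_mul, coeff_X_pow]
  refine Finset.sum_eq_zero fun l _ => ?_
  rw [if_neg (by omega), mul_zero]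

/-- Causality: a message depends only on what was disclosed earlier. This supplies the invariance
under resampling. -/
theorem roundMsgs_play_congr {S : Type u} (P : Strategy F (dgmFormat q m d) S) {v v' : Fin m → S}
    {k : Fin m} (hv : ∀ i < k, v i = v' i) :
    roundMsgs (P.play v) k = roundMsgs (P.play v') k := by
  have : before v k = before v' k := funext fun i => hv _ i.2
  have h2 : P.play v k = P.play v' k := by
    change P k (before v k) = P k (before v' k)
    rw [this]
  simp only [roundMsgs]
  rw [h2]

theorem soundFresh [Finite F] (hm : 1 ≤ m) (hd : 1 ≤ d) (hD : 2 ^ m - 1 ≤ D)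
    (hg : g.totalDegree ≤ d) (hf : ∀ i, (f i).degree < (2 ^ m : ℕ)) (hh : h.natDegree ≤ D)
    (hfalse : ¬ DomainIdentity g m f h) :
    (dgmVerifier F q m d).SoundFresh D (inputOracles m d f h) (MlinClaim g m f)
      (7 * (d * m * D) / Nat.card F) := by
  intro Ω _ _ P hP
  have key := prob_bad_le (A := Ω × (Fin m → Fˣ × F)) hm hd hD hg hf hh hfalse
    (fun c => roundMsgs ((P c.1).play c.2)) (fun c k => roundMsgs_bounded (hP _ _) k)
    (fun c k => (c.2 k).1) (fun c k => (c.2 k).2)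
    (fun k c y => (c.1, Function.update c.2 k (y, (c.2 k).2)))
    (fun k c y => (c.1, Function.update c.2 k ((c.2 k).1, y)))
    (by simp) (by simp) (by simp) (by simp) (by simp) (by simp)
    (fun k c y i hi => roundMsgs_play_congr _ fun l hl =>
      Function.update_of_ne (ne_of_lt (lt_of_lt_of_le hl hi)) _ _)
    (fun k c y i hi => roundMsgs_play_congr _ fun l hl =>
      Function.update_of_ne (ne_of_lt (lt_of_lt_of_le hl hi)) _ _)
    (fun k c y i hi => by simp [Function.update_of_ne (ne_of_lt hi)])
    (fun k c y i hi => by simp [Function.update_of_ne (ne_of_lt hi)])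
  refine le_of_eq_of_le ?_ key
  congr 1
  ext c
  exact and_congr (accepts_iff f h _ _ _)
    (Eq.to_iff (congrArg (MlinClaim g m f fun k => (c.2 k).2) (result_eq f h _ _ _)))

/-- Here resampling the point of one round changes it in all rounds. This is harmless, since no
message depends on the point and the union bound treats each round separately. -/
theorem soundShared [Finite F] (hm : 1 ≤ m) (hd : 1 ≤ d) (hD : 2 ^ m - 1 ≤ D)
    (hg : g.totalDegree ≤ d) (hf : ∀ i, (f i).degree < (2 ^ m : ℕ)) (hh : h.natDegree ≤ D)
    (hfalse : ¬ DomainIdentity g m f h) :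
    (dgmVerifier F q m d).SoundShared D (inputOracles m d f h) (MlinClaim g m f)
      (7 * (d * m * D) / Nat.card F) := by
  intro Ω _ _ P hP
  have key := prob_bad_le (A := Ω × Fˣ × (Fin m → F)) hm hd hD hg hf hh hfalse
    (fun c => roundMsgs ((P c.1).play c.2.2)) (fun c k => roundMsgs_bounded (hP _ _) k)
    (fun c _ => c.2.1) (fun c => c.2.2)
    (fun _ c y => (c.1, y, c.2.2))
    (fun k c y => (c.1, c.2.1, Function.update c.2.2 k y))
    (by simp) (by simp) (by simp) (by simp) (by simp) (by simp)
    (fun k c y i hi => rfl)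
    (fun k c y i hi => roundMsgs_play_congr _ fun l hl =>
      Function.update_of_ne (ne_of_lt (lt_of_lt_of_le hl hi)) _ _)
    (fun k c y i hi => rfl)
    (fun k c y i hi => by simp [Function.update_of_ne (ne_of_lt hi)])
  refine le_of_eq_of_le ?_ key
  congr 1
  ext c
  exact and_congr (accepts_iff f h _ _ _)
    (Eq.to_iff (congrArg (MlinClaim g m f c.2.2) (result_eq f h _ _ _)))

end Sound

/-! ### Uniform straight-line computability

Values are families `v : ∀ e, K e` of field elements over a class `E` of environments. A program is
chosen before the environment. -/

section Comp

variable {E : Type*} {K : E → Type u} {ι : Type}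

/-- In the memory `mem`, of which the addresses below `n` are in use, some operand has value `v`. -/
def Avail (inp : ∀ e, ι → K e) (mem : ∀ e, ℕ → K e) (n : ℕ) (v : ∀ e, K e) : Prop :=
  ∃ o : ι ⊕ ℕ, (∀ a, o = Sum.inr a → a < n) ∧ ∀ e, readOperand (inp e) (mem e) o = v e

theorem Avail.mono {inp : ∀ e, ι → K e} {mem mem' : ∀ e, ℕ → K e} {n n' : ℕ} {v : ∀ e, K e}
    (h : Avail inp mem n v) (hn : n ≤ n') (hm : ∀ e, ∀ a < n, mem' e a = mem e a) :
    Avail inp mem' n' v := by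
  obtain ⟨o, ho, hv⟩ := h
  refine ⟨o, fun a ha => (ho a ha).trans_le hn, fun e => ?_⟩
  rw [← hv e]
  cases o with
  | inl i => rfl
  | inr a => exact hm e a (ho a rfl)

theorem Avail.input (inp : ∀ e, ι → K e) (mem : ∀ e, ℕ → K e) (n : ℕ) (i : ι) :
    Avail inp mem n (fun e => inp e i) :=
  ⟨Sum.inl i, by simp, fun _ => rfl⟩

/-- Availability after a change of the input type. -/
theorem Avail.changeInput {ι' : Type} {inp : ∀ e, ι → K e} {inp' : ∀ e, ι' → K e}
    {mem : ∀ e, ℕ → K e} {n : ℕ} {v : ∀ e, K e} (φ : ι → ι')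
    (hφ : ∀ e i, inp' e (φ i) = inp e i) (h : Avail inp mem n v) : Avail inp' mem n v := by
  obtain ⟨o, ho, hv⟩ := h
  cases o with
  | inl i => exact ⟨Sum.inl (φ i), by simp, fun e => (hφ e i).trans (hv e)⟩
  | inr a => exact ⟨Sum.inr a, by simpa using ho, hv⟩

variable [∀ e, Field (K e)]

/-- From the values in `S`, wherever they are stored, those in `T` can be computed by a program of
running time at most `c` which writes to fresh addresses only. -/
def Comp (pc : ℕ → ℕ) (inp : ∀ e, ι → K e) (c : ℕ) (S T : Set (∀ e, K e)) : Prop :=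
  ∀ (mem : ∀ e, ℕ → K e) (n : ℕ), (∀ v ∈ S, Avail inp mem n v) →
    ∃ (p : List (Instr ι)) (n' : ℕ), n ≤ n' ∧ time pc p ≤ c ∧
      (∀ e, ∀ a < n, exec (inp e) p (mem e) a = mem e a) ∧
      ∀ v ∈ T, Avail inp (fun e => exec (inp e) p (mem e)) n' v

theorem exec_append {F : Type u} [Field F] (inp : ι → F) (p p' : List (Instr ι)) (mem : ℕ → F) :
    exec inp (p ++ p') mem = exec inp p' (exec inp p mem) := List.foldl_append ..

theorem time_append (pc : ℕ → ℕ) (p p' : List (Instr ι)) :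
    time pc (p ++ p') = time pc p + time pc p' := by
  simp [time]

variable {pc : ℕ → ℕ} {inp : ∀ e, ι → K e} {c c₁ c₂ : ℕ} {S S' T T' U : Set (∀ e, K e)}

theorem Comp.mono (h : Comp pc inp c₁ S T) (hc : c₁ ≤ c₂) (hS : S ⊆ S') (hT : T' ⊆ T) :
    Comp pc inp c₂ S' T' := by
  intro mem n hmem
  obtain ⟨p, n', hn, hp, ha, hv⟩ := h mem n fun v hv => hmem v (hS hv)
  exact ⟨p, n', hn, hp.trans hc, ha, fun v h => hv v (hT h)⟩

theorem Comp.of_subset (h : T ⊆ S) : Comp pc inp 0 S T := fun _ n hmem =>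
  ⟨[], n, le_rfl, le_rfl, fun _ _ _ => rfl, fun v hv => hmem v (h hv)⟩

/-- Composition works because programs write only to fresh addresses: the second one overwrites
neither its sources nor the results of the first. -/
theorem Comp.then (h₁ : Comp pc inp c₁ S T) (h₂ : Comp pc inp c₂ (S ∪ T) U) :
    Comp pc inp (c₁ + c₂) S (T ∪ U) := by
  intro mem n hmem
  obtain ⟨p, n', hn, hp, ha, hv⟩ := h₁ mem n hmem
  obtain ⟨p', n'', hn', hp', ha', hv'⟩ := h₂ _ n' (by
    rintro v (h | h)
    · exact (hmem v h).mono hn ha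
    · exact hv v h)
  refine ⟨p ++ p', n'', hn.trans hn', by rw [time_append]; omega, fun e a h => ?_, ?_⟩
  · rw [exec_append, ha' e a (h.trans_le hn), ha e a h]
  · simp_rw [exec_append]
    rintro v (h | h)
    · exact (hv v h).mono hn' ha'
    · exact hv' v h

theorem Comp.biUnion {α : Type*} (s : Finset α) (c : α → ℕ) (T : α → Set (∀ e, K e))
    (h : ∀ i ∈ s, Comp pc inp (c i) S (T i)) :
    Comp pc inp (∑ i ∈ s, c i) S (⋃ i ∈ s, T i) := by
  classical
  induction s using Finset.induction_on with
  | empty => exact (Comp.of_subset (Set.empty_subset _)).mono (by simp) le_rfl (by simp)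
  | insert a s ha ih =>
    rw [Finset.sum_insert ha]
    refine ((h a (Finset.mem_insert_self a s)).then ((ih fun i hi =>
      h i (Finset.mem_insert_of_mem hi)).mono le_rfl Set.subset_union_left le_rfl)).mono
      le_rfl le_rfl ?_
    rw [Finset.set_biUnion_insert]

theorem Comp.iUnion {α : Type*} [Fintype α] {c b : ℕ} {T : α → Set (∀ e, K e)}
    (h : ∀ i, Comp pc inp c S (T i)) (hb : Fintype.card α * c ≤ b) :
    Comp pc inp b S (⋃ i, T i) :=
  (Comp.biUnion Finset.univ (fun _ => c) T fun i _ => h i).mono (by simpa using hb) le_rfl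
    (by simp)

/-- The values of finitely many computable families of values. -/
theorem Comp.range {α : Type*} [Fintype α] {c b : ℕ} {v : α → ∀ e, K e}
    (h : ∀ i, Comp pc inp c S {v i}) (hb : Fintype.card α * c ≤ b) :
    Comp pc inp b S (Set.range v) :=
  (Comp.iUnion h hb).mono le_rfl le_rfl (by rintro _ ⟨i, rfl⟩; simp)

/-- The operands depend on where the memory holds the values, so the actual instruction `g` is known
only once `mem` is given; `f` is a template that fixes the cost. -/
theorem Comp.instr (f : ℕ → Instr ι) (v : ∀ e, K e) (hc : ∀ n, (f n).cost pc ≤ c)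
    (h : ∀ mem n, (∀ v ∈ S, Avail inp mem n v) →
      ∃ g : ℕ → Instr ι, (∀ n, (g n).cost pc = (f n).cost pc) ∧
        ∀ e, (g n).exec (inp e) (mem e) = Function.update (mem e) n (v e)) :
    Comp pc inp c S {v} := by
  intro mem n hmem
  obtain ⟨g, hg, hx⟩ := h mem n hmem
  refine ⟨[g n], n + 1, Nat.le_succ n, by simpa [time, hg] using hc n, fun e a ha => ?_, ?_⟩
  · simp only [exec, List.foldl_cons, List.foldl_nil, hx]
    exact Function.update_of_ne ha.ne _ _
  · rintro w rfl
    refine ⟨Sum.inr n, by simp, fun e => ?_⟩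
    simp only [exec, List.foldl_cons, List.foldl_nil, hx, readOperand, Sum.elim_inr,
      Function.update_self]

theorem Comp.one : Comp pc inp 1 S {1} :=
  Comp.instr (fun n => .one n) 1 (fun _ => le_rfl) fun _ _ _ =>
    ⟨fun n => .one n, fun _ => rfl, fun _ => rfl⟩

theorem Comp.add {v w : ∀ e, K e} (hv : v ∈ S) (hw : w ∈ S) : Comp pc inp 1 S {v + w} := by
  refine Comp.instr (fun n => .add n (.inr 0) (.inr 0)) _ (fun _ => le_rfl) fun mem n hmem => ?_
  obtain ⟨o, -, ho⟩ := hmem v hv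
  obtain ⟨o', -, ho'⟩ := hmem w hw
  exact ⟨fun n => .add n o o', fun _ => rfl, fun e => by simp [Instr.exec, ho, ho']⟩

theorem Comp.sub {v w : ∀ e, K e} (hv : v ∈ S) (hw : w ∈ S) : Comp pc inp 1 S {v - w} := by
  refine Comp.instr (fun n => .sub n (.inr 0) (.inr 0)) _ (fun _ => le_rfl) fun mem n hmem => ?_
  obtain ⟨o, -, ho⟩ := hmem v hv
  obtain ⟨o', -, ho'⟩ := hmem w hw
  exact ⟨fun n => .sub n o o', fun _ => rfl, fun e => by simp [Instr.exec, ho, ho']⟩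

theorem Comp.mul {v w : ∀ e, K e} (hv : v ∈ S) (hw : w ∈ S) : Comp pc inp 1 S {v * w} := by
  refine Comp.instr (fun n => .mul n (.inr 0) (.inr 0)) _ (fun _ => le_rfl) fun mem n hmem => ?_
  obtain ⟨o, -, ho⟩ := hmem v hv
  obtain ⟨o', -, ho'⟩ := hmem w hw
  exact ⟨fun n => .mul n o o', fun _ => rfl, fun e => by simp [Instr.exec, ho, ho']⟩

theorem Comp.inv {v : ∀ e, K e} (hv : v ∈ S) : Comp pc inp 1 S {v⁻¹} := by
  refine Comp.instr (fun n => .inv n (.inr 0)) _ (fun _ => le_rfl) fun mem n hmem => ?_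
  obtain ⟨o, -, ho⟩ := hmem v hv
  exact ⟨fun n => .inv n o, fun _ => rfl, fun e => by simp [Instr.exec, ho]⟩

theorem Comp.pow {v : ∀ e, K e} (hv : v ∈ S) (k : ℕ) : Comp pc inp (pc k) S {v ^ k} := by
  refine Comp.instr (fun n => .pow n (.inr 0) k) _ (fun _ => le_rfl) fun mem n hmem => ?_
  obtain ⟨o, -, ho⟩ := hmem v hv
  exact ⟨fun n => .pow n o k, fun _ => rfl, fun e => by simp [Instr.exec, ho]⟩

/-- Two values one after the other, and what can be computed from both. -/
theorem Comp.bind {v : ∀ e, K e} (h₁ : Comp pc inp c₁ S {v})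
    (h₂ : Comp pc inp c₂ (insert v S) T) (hc : c₁ + c₂ ≤ c) : Comp pc inp c S T :=
  (h₁.then (h₂.mono le_rfl (by rw [Set.union_singleton]) le_rfl)).mono hc le_rfl
    Set.subset_union_right

theorem Comp.zero : Comp pc inp 2 S {0} := by
  refine Comp.bind (c₂ := 1) Comp.one ?_ le_rfl
  rw [← sub_self (1 : ∀ e, K e)]
  exact Comp.sub (by simp) (by simp)

theorem Comp.sum {α : Type*} (s : Finset α) (v : α → ∀ e, K e)
    (h : ∀ i ∈ s, Comp pc inp c S {v i}) :
    Comp pc inp (s.card * (c + 1) + 2) S {∑ i ∈ s, v i} := by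
  classical
  induction s using Finset.induction_on with
  | empty => exact Comp.zero.mono (by simp) le_rfl (by simp)
  | insert a s ha ih =>
    rw [Finset.sum_insert ha, Finset.card_insert_of_notMem ha]
    refine Comp.bind (h a (Finset.mem_insert_self a s)) (Comp.bind ((ih fun i hi =>
      h i (Finset.mem_insert_of_mem hi)).mono le_rfl (Set.subset_insert _ _) le_rfl)
      (Comp.add (by simp) (by simp)) le_rfl) ?_
    ring_nf
    omega

theorem Comp.dot {α : Type*} [Fintype α] {v w : α → ∀ e, K e} {b : ℕ} (hv : ∀ i, v i ∈ S)
    (hw : ∀ i, w i ∈ S) (hb : Fintype.card α * 2 + 2 ≤ b) :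
    Comp pc inp b S {∑ i, v i * w i} :=
  (Comp.sum Finset.univ _ fun i _ => Comp.mul (hv i) (hw i)).mono hb le_rfl le_rfl

theorem Comp.powers {v : ∀ e, K e} (hv : v ∈ S) (n : ℕ) :
    Comp pc inp n S (Set.range fun i : Fin n => v ^ (i : ℕ)) := by
  induction n with
  | zero => exact (Comp.of_subset (Set.empty_subset _)).mono le_rfl le_rfl (by simp)
  | succ n ih =>
    have h : Comp pc inp 1 (S ∪ Set.range fun i : Fin n => v ^ (i : ℕ)) {v ^ n} := by
      cases n with
      | zero => simpa using Comp.one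
      | succ n =>
        rw [pow_succ]
        exact Comp.mul (Or.inr ⟨Fin.last n, rfl⟩) (Or.inl hv)
    refine (ih.then h).mono le_rfl le_rfl ?_
    rintro _ ⟨i, rfl⟩
    induction i using Fin.lastCases with
    | last => exact Or.inr rfl
    | cast i => exact Or.inl ⟨i, rfl⟩

/-- The domain sizes of all rounds are powers of two, so with a shared point a single chain of
squarings yields `x^N` for every round. -/
theorem Comp.squares {v : ∀ e, K e} (hv : v ∈ S) (n : ℕ) :
    Comp pc inp n S (Set.range fun i : Fin (n + 1) => v ^ 2 ^ (i : ℕ)) := by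
  induction n with
  | zero =>
    refine Comp.of_subset ?_
    rintro _ ⟨i, rfl⟩
    simpa using hv
  | succ n ih =>
    refine (ih.then (U := {v ^ 2 ^ (n + 1)}) ?_).mono le_rfl le_rfl ?_
    · rw [pow_succ, pow_mul, sq]
      exact Comp.mul (Or.inr ⟨Fin.last n, rfl⟩) (Or.inr ⟨Fin.last n, rfl⟩)
    · rintro _ ⟨i, rfl⟩
      induction i using Fin.lastCases with
      | last => exact Or.inr rfl
      | cast i => exact Or.inl ⟨i, rfl⟩

end Comp

/-! ### Cost of the verifier's work in one round -/

section RoundChecks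

variable {E : Type*} {K : E → Type u} {ι : Type} [∀ e, Field (K e)] {pc : ℕ → ℕ}
  {inp : ∀ e, ι → K e} {S : Set (∀ e, K e)} {d : ℕ}

/-- One table of the powers of `x` up to `x^d` serves every exponent, as `⌊j/2⌋ % N ≤ d`; only `x^N`
must be supplied, and `x^(N-1)` is `x^N x⁻¹`. The quadratic term comes from evaluating the `d + 1`
polynomials `q_j`, each with at most `d` coefficients. -/
theorem comp_roundChecks (hd : 1 ≤ d) (N : ℕ) {x xinv xN H : ∀ e, K e}
    {rev inv sq sh red : Fin (d + 1) → ∀ e, K e}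
    {el : ∀ j : Fin (d + 1), Fin ((j : ℕ) / 2 % N) → ∀ e, K e}
    (hx : x ∈ S) (hxinv : xinv ∈ S) (hxN : xN ∈ S) (hH : H ∈ S) (hrev : ∀ j, rev j ∈ S)
    (hinv : ∀ j, inv j ∈ S) (hsq : ∀ j, sq j ∈ S) (hsh : ∀ j, sh j ∈ S) (hred : ∀ j, red j ∈ S)
    (hel : ∀ j l, el j l ∈ S) :
    Comp pc inp (40 * d ^ 2) S
      ((Set.range fun j => rev j - (xN * xinv) * inv j) ∪
        ({H - ∑ j : Fin (d + 1), x ^ ((j : ℕ) % 2) * sq j} ∪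
          Set.range fun j : Fin (d + 1) => x ^ ((j : ℕ) / 2 % N) * red j -
            (sh j + (∑ l, el j l * x ^ (l : ℕ)) * (xN - 1)))) := by
  have hpow := Comp.powers (pc := pc) (inp := inp) hx (d + 1)
  set P : Set (∀ e, K e) := Set.range fun i : Fin (d + 1) => x ^ (i : ℕ) with hP
  have hxP : ∀ i ≤ d, x ^ i ∈ P := fun i hi => ⟨⟨i, by omega⟩, rfl⟩
  have h1 : Comp pc inp (3 * (d + 1)) (S ∪ P) (Set.range fun j => rev j - (xN * xinv) * inv j) := by
    refine Comp.range (c := 3) (fun j => ?_) (by simp; omega)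
    refine Comp.bind (c₂ := 2) (Comp.mul (v := xN) (w := xinv) (by simp [*]) (by simp [*])) ?_
      le_rfl
    exact Comp.bind (Comp.mul (v := xN * xinv) (w := inv j) (by simp) (by simp [*]))
      (Comp.sub (by simp [*]) (by simp)) le_rfl
  have h2 : Comp pc inp (2 * (d + 1) + 3) (S ∪ P)
      {H - ∑ j : Fin (d + 1), x ^ ((j : ℕ) % 2) * sq j} := by
    refine Comp.bind (Comp.dot (b := 2 * (d + 1) + 2)
      (v := fun j : Fin (d + 1) => x ^ ((j : ℕ) % 2))
      (w := sq) (fun j => Or.inr (hxP _ (by omega))) (fun j => Or.inl (hsq j)) (by simp; omega))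
      (Comp.sub (by simp [*]) (by simp)) (by omega)
  have h3 : Comp pc inp ((d + 1) * (2 * d + 8)) (S ∪ P)
      (Set.range fun j : Fin (d + 1) => x ^ ((j : ℕ) / 2 % N) * red j -
            (sh j + (∑ l, el j l * x ^ (l : ℕ)) * (xN - 1))) := by
    refine Comp.range (c := 2 * d + 8) (fun j => ?_) (by simp)
    have hj : (j : ℕ) / 2 % N ≤ d := (Nat.mod_le _ _).trans (by omega)
    have hpj : x ^ ((j : ℕ) / 2 % N) ∈ P := hxP _ hj
    refine Comp.bind (c₁ := 2 * d + 2) (c₂ := 6) (Comp.dot (v := el j) (w := fun l => x ^ (l : ℕ))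
      (fun l => Or.inl (hel j l)) (fun l => Or.inr (hxP _ (by omega))) (by simp; omega)) ?_
      (by omega)
    generalize ∑ l, el j l * x ^ (l : ℕ) = s
    refine Comp.bind (c₂ := 5) Comp.one ?_ le_rfl
    refine Comp.bind (c₂ := 4) (Comp.sub (v := xN) (w := 1) (by simp [*]) (by simp)) ?_ le_rfl
    refine Comp.bind (c₂ := 3) (Comp.mul (v := s) (w := xN - 1) (by simp) (by simp)) ?_ le_rfl
    refine Comp.bind (c₂ := 2) (Comp.add (v := sh j) (w := s * (xN - 1)) (by simp [*]) (by simp)) ?_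
      le_rfl
    exact Comp.bind (c₂ := 1) (Comp.mul (v := x ^ ((j : ℕ) / 2 % N)) (w := red j)
      (by simp [hpj]) (by simp [*])) (Comp.sub (by simp) (by simp)) le_rfl
  refine (hpow.then (h1.then ((h2.then (h3.mono le_rfl Set.subset_union_left le_rfl)).mono
    le_rfl Set.subset_union_left le_rfl))).mono ?_ le_rfl Set.subset_union_right
  nlinarith

theorem comp_fold (hd : 1 ≤ d) {r : ∀ e, K e} {a : Fin (d + 1) → ∀ e, K e} (hr : r ∈ S)
    (ha : ∀ j, a j ∈ S) : Comp pc inp (8 * d) S {∑ j : Fin (d + 1), r ^ (j : ℕ) * a j} := by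
  refine ((Comp.powers hr (d + 1)).then (Comp.dot (b := 2 * (d + 1) + 2)
    (fun j => Or.inr ⟨j, rfl⟩) (fun j => Or.inl (ha j)) (by simp; omega))).mono
    (by omega) le_rfl Set.subset_union_right

end RoundChecks

/-! ### Programs for the verifier -/

section VerifierPrograms

/-- What the verifier sees in an execution; `xc` and `rc` are the labels of the query points and of
the challenges among its random coins. -/
structure VerifierEnv (q m d : ℕ) (κ : Type) (xc : Fin m → κ) : Type (u + 1) where
  F : Type u
  [field : Field F]
  coins : κ → F
  coins_ne_zero : ∀ k, coins (xc k) ≠ 0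
  elem : ∀ k, (dgmFormat q m d).Elem k → F
  ans : Option (Fin m × Fin (d + 1) × QueryKind) → F

attribute [instance] VerifierEnv.field

variable {q m d : ℕ} {κ : Type} {xc : Fin m → κ}

/-- The input of the verifier's main program. -/
def VerifierEnv.input (env : VerifierEnv.{u} q m d κ xc) :
    κ ⊕ (Σ k, (dgmFormat q m d).Elem k) ⊕ (dgmFormat q m d).Query → env.F :=
  Sum.elim env.coins (Sum.elim (fun a => env.elem a.1 a.2) env.ans)

/-- The value of the verifier's checks in round `k`: for every `j` the first one and the third one,
and the second one. -/
def roundCheck {F : Type u} [Field F] (x r : Fin m → F) (elem : ∀ k, (dgmFormat q m d).Elem k → F)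
    (ans : Option (Fin m × Fin (d + 1) × QueryKind) → F) (k : Fin m) :
    Fin (d + 1) ⊕ Unit ⊕ Fin (d + 1) → F
  | .inl j => ans (some (k, j, .reversedAt)) -
      (x k ^ half m k * (x k)⁻¹) * ans (some (k, j, .shiftedInv))
  | .inr (.inl _) => claimValue (m := m) (d := d) r ans k -
      ∑ j : Fin (d + 1), x k ^ ((j : ℕ) % 2) * ans (some (k, j, .shiftedSq))
  | .inr (.inr j) => x k ^ (((j : ℕ) / 2) % half m k) * ans (some (k, j, .reducedAt)) -
      (ans (some (k, j, .shiftedAt)) +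
        (∑ l : Fin (((j : ℕ) / 2) % half m k), elem k ⟨j, l⟩ * x k ^ (l : ℕ)) *
          (x k ^ half m k - 1))

/-- Nonzero points are what allows the program to use `x^N x⁻¹` for `x^(N-1)`. -/
theorem accept_iff_roundCheck {F : Type u} [Field F] (x r : Fin m → F) (hx : ∀ k, x k ≠ 0)
    (elem : ∀ k, (dgmFormat q m d).Elem k → F)
    (ans : Option (Fin m × Fin (d + 1) × QueryKind) → F) :
    (dgmVerifier F q m d).accept x r elem ans ↔ ∀ k i, roundCheck x r elem ans k i = 0 := by
  refine forall_congr' fun k => ?_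
  have hpow : x k ^ half m k * (x k)⁻¹ = x k ^ (half m k - 1) := by
    rw [← pow_sub_one_mul (half_pos m k).ne' (x k), mul_assoc, mul_inv_cancel₀ (hx k), mul_one]
  simp only [Sum.forall, roundCheck, sub_eq_zero, hpow, forall_const]

/-- From a computation of the powers `x_k^N` one gets a program for the verifier. -/
theorem exists_verifierProgram (hm : 1 ≤ m) (hd : 1 ≤ d) (pc : ℕ → ℕ) (rc : Fin m → κ) {b : ℕ}
    (hprep : Comp (E := VerifierEnv.{u} q m d κ xc) (K := fun env => env.F) pc
      (fun env => env.coins) b (Set.range fun i env => env.coins i)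
      (Set.range fun (k : Fin m) env => env.coins (xc k) ^ half m k)) :
    ∃ A : VerifierProgram κ (dgmFormat q m d), A.time pc ≤ b + 60 * (d ^ 2 * m) ∧
      ∀ (F : Type u) [Field F] (coins : κ → F), (∀ k, coins (xc k) ≠ 0) →
        A.Implements (dgmVerifier F q m d) coins (fun k => coins (xc k))
          (fun k => coins (rc k)) := by
  let E := VerifierEnv.{u} q m d κ xc
  let K : E → Type u := fun env => env.F
  let x : Fin m → ∀ e : E, K e := fun k env => env.coins (xc k)
  let r : Fin m → ∀ e : E, K e := fun k env => env.coins (rc k)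
  let xN : Fin m → ∀ e : E, K e := fun k env => env.coins (xc k) ^ half m k
  let I : Set (∀ e : E, K e) := Set.range fun i env => env.coins i
  have hxI : ∀ k, x k ∈ I := fun k => ⟨xc k, rfl⟩
  have hrI : ∀ k, r k ∈ I := fun k => ⟨rc k, rfl⟩
  -- the query points
  have hpts : Comp (E := E) (K := K) pc (fun env => env.coins) (2 * m + 1) I
      (Set.range (fun k => (x k)⁻¹) ∪ (Set.range (fun k => x k ^ 2) ∪ {1})) := by
    refine ((Comp.range (c := 1) (b := m) (v := fun k => (x k)⁻¹) (fun k => Comp.inv (hxI k))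
      (by simp)).then ((Comp.range (c := 1) (b := m) (v := fun k => x k ^ 2) (fun k => ?_)
      (by simp)).then Comp.one)).mono (by omega) le_rfl le_rfl
    rw [sq]
    exact Comp.mul (Or.inl (hxI k)) (Or.inl (hxI k))
  obtain ⟨prep, n, -, hprep_time, -, hprep_avail⟩ := (hprep.then
    (hpts.mono le_rfl Set.subset_union_left le_rfl)) (fun _ => 0) 0 (by
      rintro _ ⟨i, rfl⟩
      exact Avail.input _ _ _ i)
  let mem₀ : ∀ e : E, ℕ → K e := fun env => exec env.coins prep 0
  have hav₀ : ∀ v ∈ I ∪ (Set.range xN ∪ (Set.range (fun k => (x k)⁻¹) ∪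
      (Set.range (fun k => x k ^ 2) ∪ {1}))),
      Avail (fun env : E => env.coins) mem₀ n v := by
    rintro v (hv | hv)
    · obtain ⟨i, rfl⟩ := hv
      exact Avail.input _ _ _ i
    · exact hprep_avail v hv
  have hpoint : ∀ Q : (dgmFormat q m d).Query, ∃ o : κ ⊕ ℕ, ∀ env : E,
      readOperand env.coins (mem₀ env) o =
        (dgmVerifier env.F q m d).point (fun k => x k env) Q := by
    have hpA : ∀ k : ℕ, Avail (fun env : E => env.coins) mem₀ n
        (fun env => pointAt (m := m) (fun k => x k env) k) := by
      intro k
      by_cases hk : k < m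
      · simp only [pointAt, dif_pos hk]
        exact hav₀ (x ⟨k, hk⟩) (Or.inl (hxI _))
      · simp only [pointAt, dif_neg hk]
        exact hav₀ 1 (by simp)
    intro Q
    have : Avail (fun env : E => env.coins) mem₀ n
        (fun env => (dgmVerifier env.F q m d).point (fun k => x k env) Q) := by
      match Q with
      | none => exact hpA 0
      | some (k, j, .reversedAt) => exact hav₀ (x k) (Or.inl (hxI _))
      | some (k, j, .shiftedInv) => exact hav₀ (x k)⁻¹ (Or.inr (Or.inr (Or.inl ⟨k, rfl⟩)))
      | some (k, j, .shiftedSq) => exact hav₀ (x k ^ 2) (Or.inr (Or.inr (Or.inr (Or.inl ⟨k, rfl⟩))))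
      | some (k, j, .shiftedAt) => exact hav₀ (x k) (Or.inl (hxI _))
      | some (k, j, .reducedAt) => exact hav₀ (x k) (Or.inl (hxI _))
      | some (k, j, .reducedNext) => exact hpA _
    obtain ⟨o, -, ho⟩ := this
    exact ⟨o, ho⟩
  choose pointOut hpointOut using hpoint
  -- the main program
  let ans : Option (Fin m × Fin (d + 1) × QueryKind) → ∀ e : E, K e := fun Q env => env.ans Q
  let el : ∀ (k : Fin m), (Σ j : Fin (d + 1), Fin (((j : ℕ) / 2) % half m k)) → ∀ e : E, K e :=
    fun k a env => env.elem k a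
  -- Taking for `S` everything available when `main` starts makes the availability hypothesis of
  -- `Comp` trivial, and includes the values left behind by `prep`.
  let S : Set (∀ e : E, K e) := {v | Avail (fun env : E => env.input) mem₀ n v}
  have hS₀ : ∀ v ∈ I ∪ (Set.range xN ∪ (Set.range (fun k => (x k)⁻¹) ∪
      (Set.range (fun k => x k ^ 2) ∪ {1}))), v ∈ S := fun v hv =>
    (hav₀ v hv).changeInput Sum.inl fun _ _ => rfl
  have hSans : ∀ Q, ans Q ∈ S := fun Q =>
    Avail.input (fun env : E => env.input) _ _ (Sum.inr (Sum.inr Q))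
  have hSel : ∀ k a, el k a ∈ S := fun k a =>
    Avail.input (fun env : E => env.input) _ _ (Sum.inr (Sum.inl ⟨k, a⟩))
  let claim : ℕ → ∀ e : E, K e := fun k env =>
    claimValue (m := m) (d := d) (fun k => r k env) env.ans k
  let claims : Set (∀ e : E, K e) := Set.range fun k : Fin m => claim (k + 1)
  have hclaims : Comp pc (fun env : E => env.input) (m * (8 * d)) S claims := by
    refine Comp.range (c := 8 * d) (fun k => ?_) (by simp)
    have : claim (k + 1) = ∑ j : Fin (d + 1), r k ^ (j : ℕ) * ans (some (k, j, .reducedNext)) := by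
      funext env
      simp only [claim, claimValue, dif_pos k.2, Finset.sum_apply, Pi.mul_apply, Pi.pow_apply]
      rfl
    rw [this]
    exact comp_fold hd (hS₀ _ (Or.inl (hrI k))) fun j => hSans _
  have hclaim : ∀ k ≤ m, claim k ∈ S ∪ claims := by
    intro k hk
    cases k with
    | zero => exact Or.inl (hSans none)
    | succ k => exact Or.inr ⟨⟨k, hk⟩, rfl⟩
  let chk : Fin m × (Fin (d + 1) ⊕ Unit ⊕ Fin (d + 1)) → ∀ e : E, K e := fun i env =>
    roundCheck (fun k => x k env) (fun k => r k env) env.elem env.ans i.1 i.2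
  have hchecks : Comp pc (fun env : E => env.input) (m * (40 * d ^ 2)) (S ∪ claims)
      (Set.range chk) := by
    refine (Comp.iUnion (b := m * (40 * d ^ 2)) (fun k : Fin m => comp_roundChecks hd (half m k)
      (x := x k) (xinv := (x k)⁻¹) (xN := xN k) (H := claim k)
      (rev := fun j => ans (some (k, j, .reversedAt)))
      (inv := fun j => ans (some (k, j, .shiftedInv)))
      (sq := fun j => ans (some (k, j, .shiftedSq)))
      (sh := fun j => ans (some (k, j, .shiftedAt)))
      (red := fun j => ans (some (k, j, .reducedAt)))
      (el := fun j l => el k ⟨j, l⟩)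
      (Or.inl (hS₀ _ (Or.inl (hxI k)))) (Or.inl (hS₀ _ (Or.inr (Or.inr (Or.inl ⟨k, rfl⟩)))))
      (Or.inl (hS₀ _ (Or.inr (Or.inl ⟨k, rfl⟩)))) (hclaim k k.2.le)
      (fun j => Or.inl (hSans _)) (fun j => Or.inl (hSans _)) (fun j => Or.inl (hSans _))
      (fun j => Or.inl (hSans _)) (fun j => Or.inl (hSans _)) (fun j l => Or.inl (hSel _ _)))
      (by simp)).mono le_rfl le_rfl ?_
    rintro _ ⟨⟨k, i⟩, rfl⟩
    refine Set.mem_iUnion.2 ⟨k, ?_⟩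
    rcases i with j | _ | j
    · exact Or.inl ⟨j, rfl⟩
    · refine Or.inr (Or.inl ?_)
      funext env
      simp [chk, roundCheck, ans, claim]
    · refine Or.inr (Or.inr ⟨j, ?_⟩)
      funext env
      simp [chk, roundCheck, ans, el, xN, x]
  obtain ⟨main, n', -, hmain_time, -, hmain_avail⟩ := (hclaims.then hchecks) mem₀ n fun v hv => hv
  have hout : claim m ∈ claims ∪ Set.range chk :=
    Or.inl ⟨⟨m - 1, by omega⟩, by simp [Nat.sub_add_cancel hm]⟩
  obtain ⟨out, -, hout⟩ := hmain_avail _ hout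
  choose chkOut _ hchkOut using fun i => hmain_avail (chk i) (Or.inr ⟨i, rfl⟩)
  refine ⟨⟨prep, pointOut, main, Finset.univ.toList.map chkOut, out⟩, ?_, ?_⟩
  · simp only [VerifierProgram.time, List.length_map, Finset.length_toList, Finset.card_univ,
      Fintype.card_prod, Fintype.card_fin, Fintype.card_sum, Fintype.card_unit]
    have h1 : d ≤ d ^ 2 := by nlinarith
    have h2 : m * d ≤ m * d ^ 2 := Nat.mul_le_mul_left _ h1
    have h3 : m ≤ m * d := Nat.le_mul_of_pos_right _ hd
    nlinarith
  · intro F _ coins hcoins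
    refine ⟨fun Q => ?_, fun e a => ⟨?_, ?_⟩⟩
    -- The query points are computed from the coins alone, so the remaining parts of the environment
    -- may be filled with zeros.
    · exact hpointOut Q ⟨F, coins, hcoins, fun _ _ => 0, fun _ => 0⟩
    · refine Iff.trans ?_ (accept_iff_roundCheck _ _ hcoins e a).symm
      simp only [List.forall_mem_map, Finset.mem_toList, Finset.mem_univ, forall_const]
      exact (forall_congr' fun i => Eq.congr_left (hchkOut i ⟨F, coins, hcoins, e, a⟩)).trans
        Prod.forall
    · exact hout ⟨F, coins, hcoins, e, a⟩

theorem exists_verifierProgram_shared (hm : 1 ≤ m) (hd : 1 ≤ d) :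
    ∃ A : VerifierProgram (Unit ⊕ Fin m) (dgmFormat q m d),
      A.time binaryCost ≤ 61 * (d ^ 2 * m) ∧
      ∀ (F : Type u) [Field F] [Finite F] (x : Fˣ) (r : Fin m → F),
        A.Implements (dgmVerifier F q m d) (Sum.elim (fun _ => (x : F)) r)
          (fun _ => (x : F)) r := by
  obtain ⟨A, hA, h⟩ := exists_verifierProgram.{u} (q := q) (xc := fun _ => Sum.inl ()) hm hd
    binaryCost (fun k : Fin m => Sum.inr k) (b := m) (by
      refine (Comp.squares (v := fun env => env.coins (Sum.inl ()))
        (S := Set.range fun i (env : VerifierEnv.{u} q m d (Unit ⊕ Fin m) (fun _ => Sum.inl ())) =>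
          env.coins i)
        ⟨_, rfl⟩ (m - 1)).mono
        (by omega) le_rfl ?_
      rintro _ ⟨k, rfl⟩
      exact ⟨⟨m - 1 - k, by omega⟩, rfl⟩)
  exact ⟨A, hA.trans (by nlinarith [Nat.pow_pos (n := 2) hd]),
    fun F _ _ x r => h F _ fun _ => x.ne_zero⟩

/-- Each round has its own point and needs its own power `x_k^N`, one exponentiation per round; with
unit cost for `pow` these contribute only `m`. -/
theorem exists_verifierProgram_fresh (hm : 1 ≤ m) (hd : 1 ≤ d) :
    ∃ A : VerifierProgram (Fin m ⊕ Fin m) (dgmFormat q m d),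
      A.time unitCost ≤ 61 * (d ^ 2 * m) ∧
      ∀ (F : Type u) [Field F] [Finite F] (x : Fin m → Fˣ) (r : Fin m → F),
        A.Implements (dgmVerifier F q m d) (Sum.elim (fun k => (x k : F)) r)
          (fun k => (x k : F)) r := by
  obtain ⟨A, hA, h⟩ := exists_verifierProgram.{u} (q := q) (xc := fun k => Sum.inl k) hm hd
    unitCost (fun k : Fin m => Sum.inr k) (b := m)
    (Comp.range (c := 1) (fun k => Comp.pow (v := fun env => env.coins (Sum.inl k))
        (S := Set.range fun i (env : VerifierEnv.{u} q m d (Fin m ⊕ Fin m) (fun k => Sum.inl k)) =>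
          env.coins i)
        ⟨_, rfl⟩ _)
      (by simp))
  exact ⟨A, hA.trans (by nlinarith [Nat.pow_pos (n := 2) hd]),
    fun F _ _ x r => h F _ fun k => (x k).ne_zero⟩

end VerifierPrograms

/-! ### Multivariate Horner evaluation -/

section Horner

variable {α R : Type*} [CommSemiring R]

/-- Horner's rule in several variables: the sum of `c (s + u) L ^ u` over all exponents `u` of
degree at most `n` which are supported on `l`. -/
noncomputable def horner (L : α → R) (c : (α →₀ ℕ) → R) : List α → ℕ → (α →₀ ℕ) → R
  | [], _, s => c s
  | _ :: _, 0, s => c s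
  | i :: l, n + 1, s => horner L c l (n + 1) s + L i * horner L c (i :: l) n (s + .single i 1)
termination_by l n => l.length + n

open Classical in
/-- The exponents of degree at most `n` supported on `l`. -/
noncomputable def expSet : List α → ℕ → Finset (α →₀ ℕ)
  | [], _ => {0}
  | _ :: _, 0 => {0}
  | i :: l, n + 1 => expSet l (n + 1) ∪ (expSet (i :: l) n).map (addRightEmbedding (.single i 1))
termination_by l n => l.length + n

theorem mem_expSet (l : List α) (n : ℕ) (u : α →₀ ℕ) :
    u ∈ expSet l n ↔ (∀ i, i ∉ l → u i = 0) ∧ u.degree ≤ n := by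
  classical
  induction l, n using expSet.induct generalizing u with
  | case1 n =>
    rw [expSet, Finset.mem_singleton]
    constructor
    · rintro rfl; simp
    · rintro ⟨h, -⟩; ext i; simpa using h i
  | case2 i l =>
    rw [expSet, Finset.mem_singleton]
    constructor
    · rintro rfl; simp
    · rintro ⟨-, h⟩; exact (Finsupp.degree_eq_zero_iff u).1 (Nat.le_zero.1 h)
  | case3 i l n ih₁ ih₂ =>
    rw [expSet, Finset.mem_union, ih₁, Finset.mem_map]
    constructor
    · rintro (⟨h, hd⟩ | ⟨v, hv, rfl⟩)
      · exact ⟨fun j hj => h j fun hjl => hj (List.mem_cons_of_mem _ hjl), hd⟩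
      · obtain ⟨h, hd⟩ := (ih₂ v).1 hv
        refine ⟨fun j hj => ?_, ?_⟩
        · have hji : i ≠ j := fun hij => hj (by simp [hij])
          simp [h j hj, hji]
        · simpa using hd
    · rintro ⟨h, hd⟩
      by_cases hi : u i = 0
      · refine Or.inl ⟨fun j hj => ?_, hd⟩
        by_cases hji : j = i
        · rw [hji, hi]
        · exact h j (by simp [hj, hji])
      · have hle : Finsupp.single i 1 ≤ u := by
          rw [Finsupp.single_le_iff]; omega
        have hu : u - .single i 1 + .single i 1 = u := tsub_add_cancel_of_le hle
        refine Or.inr ⟨u - .single i 1, (ih₂ _).2 ⟨fun j hj => ?_, ?_⟩, ?_⟩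
        · rw [Finsupp.tsub_apply, h j hj, Nat.zero_sub]
        · have := congrArg Finsupp.degree hu
          simp only [map_add, Finsupp.degree_single] at this
          omega
        · rw [addRightEmbedding_apply, hu]

/-- `expSet` follows the recursion of `horner`: an exponent either avoids the head variable or
contains it once more. As the list has no repetitions, the two cases are disjoint and no monomial is
counted twice. -/
theorem horner_eq_sum (L : α → R) (c : (α →₀ ℕ) → R) (l : List α) (n : ℕ) (hl : l.Nodup)
    (s : α →₀ ℕ) :
    horner L c l n s = ∑ u ∈ expSet l n, c (s + u) * u.prod fun i k => L i ^ k := by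
  classical
  induction l, n using expSet.induct generalizing s with
  | case1 n => simp [horner, expSet]
  | case2 i l => simp [horner, expSet]
  | case3 i l n ih₁ ih₂ =>
    have hil : i ∉ l := (List.nodup_cons.1 hl).1
    rw [horner, expSet, Finset.sum_union, ih₁ (List.nodup_cons.1 hl).2, ih₂ hl, Finset.sum_map,
      Finset.mul_sum]
    · congr 1
      refine Finset.sum_congr rfl fun u _ => ?_
      rw [addRightEmbedding_apply, Finsupp.prod_add_index' (by simp) (by simp [pow_add]),
        Finsupp.prod_single_index (by simp), pow_one, add_assoc s, add_comm (.single i 1) u]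
      ring
    · rw [Finset.disjoint_left]
      intro u hu hu'
      have h1 := ((mem_expSet _ _ _).1 hu).1 i hil
      obtain ⟨v, -, rfl⟩ := Finset.mem_map.1 hu'
      simp at h1

theorem horner_eq_aeval {A : Type*} [CommRing A] {q d : ℕ} {F : Type u} [Field F] [Algebra F A]
    {g : MvPolynomial (Fin q) F} (hg : g.totalDegree ≤ d) (L : Fin q → A) :
    horner L (fun s => algebraMap F A (g.coeff s)) (List.finRange q) d 0 =
      MvPolynomial.aeval L g := by
  rw [horner_eq_sum _ _ _ _ (List.nodup_finRange q), MvPolynomial.aeval_def,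
    MvPolynomial.eval₂_eq]
  symm
  refine (Finset.sum_subset (s₂ := expSet (List.finRange q) d) (fun s hs => ?_)
    fun s _ hs => ?_).trans ?_
  · refine (mem_expSet _ _ _).2 ⟨by simp, ?_⟩
    exact (MvPolynomial.le_totalDegree hs).trans hg
  · rw [MvPolynomial.notMem_support_iff.1 hs]
    simp
  · refine Finset.sum_congr rfl fun s _ => ?_
    rw [zero_add, Finsupp.prod]

theorem map_horner {R' : Type*} [CommSemiring R'] (φ : R →+* R') (L : α → R)
    (c : (α →₀ ℕ) → R) (l : List α) (n : ℕ) (s : α →₀ ℕ) :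
    φ (horner L c l n s) = horner (fun i => φ (L i)) (fun s => φ (c s)) l n s := by
  induction l, n using expSet.induct generalizing s with
  | case1 n => simp [horner]
  | case2 i l => simp [horner]
  | case3 i l n ih₁ ih₂ => rw [horner, horner, map_add, map_mul, ih₁, ih₂]

end Horner

/-! ### Cost of multivariate Horner evaluation on a line -/

section CompHorner

variable {E : Type*} {K : E → Type u} {ι : Type} [∀ e, Field (K e)] {pc : ℕ → ℕ}
  {inp : ∀ e, ι → K e} {S : Set (∀ e, K e)}

/-- By Pascal's rule the recursion tree has `(l.length + n).choose n` leaves, hence one inner node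
fewer; this is why `4 * (d + 1)` is added on the left of the bound. An inner node multiplies by a
linear polynomial in `t` and adds, at most four operations per coefficient. Coefficients beyond `d`
can be dropped, since lower ones never depend on them. -/
theorem comp_horner {α : Type*} {a b : α → ∀ e, K e} {c : (α →₀ ℕ) → ∀ e, K e} (h0 : 0 ∈ S)
    (ha : ∀ i, a i ∈ S) (hb : ∀ i, b i ∈ S) (hc : ∀ s, c s ∈ S) (d : ℕ) (l : List α) (n : ℕ)
    (s : α →₀ ℕ) :
    ∃ t, t + 4 * (d + 1) ≤ 4 * (d + 1) * (l.length + n).choose n ∧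
      Comp pc inp t S (Set.range fun j : Fin (d + 1) =>
        (horner (fun i => C (a i) + X * C (b i)) (fun s => C (c s)) l n s).coeff j) := by
  have hleaf : ∀ s, Comp pc inp 0 S (Set.range fun j : Fin (d + 1) =>
      (C (c s) : (∀ e, K e)[X]).coeff j) := by
    intro s
    refine Comp.of_subset ?_
    rintro _ ⟨j, rfl⟩
    simp only [coeff_C]
    split_ifs
    exacts [hc s, h0]
  induction l, n using expSet.induct generalizing s with
  | case1 n => exact ⟨0, by simp, by simpa only [horner] using hleaf s⟩
  | case2 i l => exact ⟨0, by simp, by simpa only [horner] using hleaf s⟩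
  | case3 i l n ih₁ ih₂ =>
    obtain ⟨t₁, ht₁, h₁⟩ := ih₁ s
    obtain ⟨t₂, ht₂, h₂⟩ := ih₂ (s + .single i 1)
    refine ⟨t₁ + (t₂ + 4 * (d + 1)), ?_, ?_⟩
    · have : ((i :: l).length + (n + 1)).choose (n + 1) =
          ((i :: l).length + n).choose n + (l.length + (n + 1)).choose (n + 1) := by
        rw [← add_assoc, Nat.choose_succ_succ]
        congr 2
        simp only [List.length_cons]
        omega
      rw [this, Nat.mul_add (4 * (d + 1))]
      omega
    · rw [horner]
      set A := horner (fun i => C (a i) + X * C (b i)) (fun s => C (c s)) l (n + 1) s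
      set B := horner (fun i => C (a i) + X * C (b i)) (fun s => C (c s)) (i :: l) n
        (s + .single i 1)
      refine (h₁.then ((h₂.mono le_rfl Set.subset_union_left le_rfl).then
        (Comp.range (c := 4) (fun j => ?_) (by simp; omega)))).mono le_rfl le_rfl
        (fun v hv => Or.inr (Or.inr hv))
      set S' := (S ∪ Set.range fun j : Fin (d + 1) => A.coeff j) ∪
        Set.range fun j : Fin (d + 1) => B.coeff j
      have haS : a i ∈ S' := Or.inl (Or.inl (ha i))
      have hbS : b i ∈ S' := Or.inl (Or.inl (hb i))
      have hA : ∀ j ≤ d, A.coeff j ∈ S' := fun j hj => Or.inl (Or.inr ⟨⟨j, by omega⟩, rfl⟩)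
      have hB : ∀ j ≤ d, B.coeff j ∈ S' := fun j hj => Or.inr ⟨⟨j, by omega⟩, rfl⟩
      have hcoeff : (A + (C (a i) + X * C (b i)) * B).coeff j =
          (A.coeff j + a i * B.coeff j) + (X * (C (b i) * B)).coeff j := by
        rw [add_mul, coeff_add, coeff_add, coeff_C_mul, mul_assoc, add_assoc]
      rw [hcoeff]
      have hAj := hA j (by omega)
      have hBj := hB j (by omega)
      rcases j with ⟨j | j, hj⟩
      · simp only [coeff_X_mul_zero, add_zero]
        exact Comp.bind (Comp.mul haS hBj) (Comp.add (Or.inr hAj) (Or.inl rfl)) (by omega)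
      · simp only [coeff_X_mul, coeff_C_mul]
        have hBj' := hB j (by omega)
        refine Comp.bind (c₂ := 3) (Comp.mul haS hBj) ?_ le_rfl
        refine Comp.bind (c₂ := 2) (Comp.add (Or.inr hAj) (Or.inl rfl)) ?_ le_rfl
        refine Comp.bind (c₂ := 1) (Comp.mul (Or.inr (Or.inr hbS)) (Or.inr (Or.inr hBj'))) ?_ le_rfl
        exact Comp.add (Or.inr (Or.inl rfl)) (Or.inl rfl)

end CompHorner

/-! ### Values at roots of unity -/

section Roots

variable {F : Type u} [Field F]

theorem eval_component {q : ℕ} (g : MvPolynomial (Fin q) F) (j : ℕ) (f : Fin q → F[X]) (y : F) :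
    (component g j f).eval y = (MvPolynomial.aeval (fun i =>
      (C ((evenPart (f i)).eval y) + X * C ((oddPart (f i)).eval y) : F[X])) g).coeff j := by
  rw [component_eq]
  have : (MvPolynomial.aeval (fun i =>
      (C ((evenPart (f i)).eval y) + X * C ((oddPart (f i)).eval y) : F[X])) g) =
      Polynomial.mapAlgHom (aeval y : F[X] →ₐ[F] F) (MvPolynomial.aeval
      (fun i => (C (evenPart (f i)) + X * C (oddPart (f i)) : F[X][X])) g) := by
    rw [← AlgHom.comp_apply, MvPolynomial.comp_aeval]
    congr 2
    funext i
    simp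
  rw [this, Polynomial.coe_mapAlgHom, coeff_map]
  rfl

/-- In characteristic two, `w^(2^m) = 1` would make `(w^(2^(m-1)) - 1)^2` zero, contradicting
primitivity. The prover needs to divide by `2` and by `N`. -/
theorem two_ne_zero_of_isPrimitiveRoot {w : F} {m : ℕ} (hm : 1 ≤ m)
    (hw : IsPrimitiveRoot w (2 ^ m)) : (2 : F) ≠ 0 := by
  intro h2
  have h1 : (w ^ 2 ^ (m - 1) - 1) ^ 2 = 0 := by
    have : (w ^ 2 ^ (m - 1)) ^ 2 = 1 := by
      rw [← pow_mul, ← pow_succ, Nat.sub_add_cancel hm, hw.pow_eq_one]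
    linear_combination this + (1 - w ^ 2 ^ (m - 1)) * h2
  refine hw.pow_ne_one_of_pos_of_lt (pow_pos two_pos (m - 1)).ne'
    (Nat.pow_lt_pow_right one_lt_two (by omega)) (sub_eq_zero.1 (by simpa using h1))

/-- Inverse discrete Fourier transform, by orthogonality of the characters; `l (N - t)` represents
the exponent `-l t` modulo `N` without subtraction below zero. -/
theorem coeff_eq_sum_eval {p : F[X]} {N : ℕ} (hN : 0 < N) (hp : p.degree < (N : WithBot ℕ))
    {ρ : F} (hρ : IsPrimitiveRoot ρ N) (hN0 : (N : F) ≠ 0) {l : ℕ} (hl : l < N) :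
    p.coeff l = (N : F)⁻¹ * ∑ t : Fin N, p.eval (ρ ^ (t : ℕ)) * ρ ^ (l * (N - t)) := by
  have hsum : ∑ t : Fin N, p.eval (ρ ^ (t : ℕ)) * ρ ^ (l * (N - t)) = N * p.coeff l := by
    have hd : p.natDegree < N := by
      have := natDegree_le_of_degree_lt hN hp
      omega
    have hterm : ∀ t : Fin N, p.eval (ρ ^ (t : ℕ)) * ρ ^ (l * (N - t)) =
        ∑ n ∈ Finset.range N, p.coeff n * (ρ ^ (n + (N - l))) ^ (t : ℕ) := by
      intro t
      rw [eval_eq_sum_range' hd, Finset.sum_mul]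
      refine Finset.sum_congr rfl fun n _ => ?_
      have h1 : ρ ^ (l * (N - t)) = ρ ^ ((N - l) * (t : ℕ)) := by
        have e : l * (N - t) + N * t = (N - l) * t + N * l := by
          zify [t.2.le, hl.le]; ring
        have := congrArg (fun x => ρ ^ x) e
        simpa only [pow_add, pow_mul ρ N, hρ.pow_eq_one, one_pow, mul_one] using this
      rw [h1, mul_assoc, ← pow_mul, ← pow_add, ← pow_mul]
      congr 2
      ring
    simp_rw [hterm]
    rw [Finset.sum_comm, Finset.sum_eq_single l]
    · rw [Nat.add_sub_cancel' hl.le, hρ.pow_eq_one]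
      simp
    · intro n hn hnl
      rw [← Finset.mul_sum, Fin.sum_univ_eq_sum_range (fun t => (ρ ^ (n + (N - l))) ^ t)]
      have hne : ρ ^ (n + (N - l)) ≠ 1 := by
        intro h1
        have hdvd := (hρ.pow_eq_one_iff_dvd _).1 h1
        have hn' := Finset.mem_range.1 hn
        obtain ⟨c, hc⟩ := hdvd
        -- The exponent `n + (N - l)` lies strictly between `0` and `2N`, so `N` divides it only if
        -- `n = l`.
        rcases c with _ | _ | c
        · omega
        · omega
        · have : N * (c + 1 + 1) = N * c + 2 * N := by ring
          omega
      rw [geom_sum_eq hne, ← pow_mul, mul_comm _ N, pow_mul, hρ.pow_eq_one]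
      simp
    · intro h1
      exact absurd (Finset.mem_range.2 hl) h1
  rw [hsum, inv_mul_cancel_left₀ hN0]

end Roots

/-! ### The prover's program -/

section ProverRounds

/-- The inputs for which the prover's program is run. -/
structure ProverEnv (q m d : ℕ) : Type (u + 1) where
  F : Type u
  [field : Field F]
  w : F
  g : MvPolynomial (Fin q) F
  f : Fin q → F[X]
  r : Fin m → F
  isPrimitiveRoot : IsPrimitiveRoot w (2 ^ m)
  totalDegree_le : g.totalDegree ≤ d
  degree_lt : ∀ i, (f i).degree < (2 ^ m : ℕ)

attribute [instance] ProverEnv.field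

variable {q m d : ℕ}

namespace ProverEnv

/-- The polynomials `f_i` after `k` rounds. -/
noncomputable def poly (env : ProverEnv.{u} q m d) (k : ℕ) (i : Fin q) : env.F[X] :=
  prefixFold env.r k (env.f i)

/-- The input of the program of round `k`. -/
noncomputable def input (k : ℕ) (env : ProverEnv.{u} q m d) : ProverInput q m ⊕ Fin k → env.F :=
  Sum.elim (proverInput m env.w env.g env.f)
    (fun i : Fin k => if h : (i : ℕ) < m then env.r ⟨i, h⟩ else 0)

/-- A generator of the domain before round `k`. -/
def root (k : ℕ) (env : ProverEnv.{u} q m d) : env.F := env.w ^ 2 ^ k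

/-- Values of `f_i` on the domain before round `k`. -/
noncomputable def val (k : ℕ) (i : Fin q) (t : ℕ) (env : ProverEnv.{u} q m d) : env.F :=
  (env.poly k i).eval (root k env ^ t)

/-- Values of the even part of `f_i` on the domain after round `k`. -/
noncomputable def even (k : ℕ) (i : Fin q) (t : ℕ) (env : ProverEnv.{u} q m d) : env.F :=
  (evenPart (env.poly k i)).eval (root (k + 1) env ^ t)

/-- Values of the odd part of `f_i` on the domain after round `k`. -/
noncomputable def odd (k : ℕ) (i : Fin q) (t : ℕ) (env : ProverEnv.{u} q m d) : env.F :=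
  (oddPart (env.poly k i)).eval (root (k + 1) env ^ t)

/-- Values of `g_j(f_ev, f_od)` on the domain after round `k`. -/
noncomputable def comp (k j t : ℕ) (env : ProverEnv.{u} q m d) : env.F :=
  (component env.g j (env.poly k)).eval (root (k + 1) env ^ t)

/-- Values of `h_j` on the domain after round `k`. -/
noncomputable def shifted (k j t : ℕ) (env : ProverEnv.{u} q m d) : env.F :=
  ((X ^ (j / 2) * component env.g j (env.poly k)) % (X ^ half m k - 1)).eval
    (root (k + 1) env ^ t)

/-- Values of `c_j` on the domain after round `k`. -/
noncomputable def reversed (k j t : ℕ) (env : ProverEnv.{u} q m d) : env.F :=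
  (reflect (half m k - 1)
    ((X ^ (j / 2) * component env.g j (env.poly k)) % (X ^ half m k - 1))).eval
    (root (k + 1) env ^ t)

/-- Coefficients of `h_j`. -/
noncomputable def coeff (k j l : ℕ) (env : ProverEnv.{u} q m d) : env.F :=
  ((X ^ (j / 2) * component env.g j (env.poly k)) % (X ^ half m k - 1)).coeff l

variable (env : ProverEnv.{u} q m d)

theorem root_succ (k : ℕ) : root (k + 1) env = root k env ^ 2 := by
  rw [root, root, pow_succ, pow_mul]

theorem root_isPrimitiveRoot {k : ℕ} (hk : k ≤ m) :
    IsPrimitiveRoot (root k env) (2 ^ (m - k)) :=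
  env.isPrimitiveRoot.pow (pow_pos two_pos m) (by rw [← pow_add, Nat.add_sub_cancel' hk])

theorem root_succ_isPrimitiveRoot {k : ℕ} (hk : k < m) :
    IsPrimitiveRoot (root (k + 1) env) (half m k) := by
  have := env.root_isPrimitiveRoot (k := k + 1) hk
  rwa [half, Nat.sub_sub, add_comm 1 k]

theorem root_pow_two_mul_half {k : ℕ} (hk : k < m) : root k env ^ (2 * half m k) = 1 := by
  rw [two_mul_half hk]
  exact (env.root_isPrimitiveRoot hk.le).pow_eq_one

theorem root_pow_half {k : ℕ} (hk : k < m) : root k env ^ half m k = -1 := by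
  have h1 := env.root_pow_two_mul_half hk
  have h2 : root k env ^ half m k ≠ 1 := by
    refine (env.root_isPrimitiveRoot hk.le).pow_ne_one_of_pos_of_lt (half_pos m k).ne' ?_
    have := half_pos m k
    rw [← two_mul_half hk]
    omega
  rw [mul_comm, pow_mul] at h1
  exact (mul_self_eq_one_iff.1 (by rwa [← sq])).resolve_left h2

theorem root_ne_zero (k : ℕ) : root k env ≠ 0 :=
  pow_ne_zero _ (env.isPrimitiveRoot.ne_zero (pow_pos two_pos m).ne')

theorem two_ne_zero (hm : 1 ≤ m) : (2 : env.F) ≠ 0 :=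
  two_ne_zero_of_isPrimitiveRoot hm env.isPrimitiveRoot

theorem val_add_half {k : ℕ} (hk : k < m) (i : Fin q) (t : ℕ) :
    val k i (t + half m k) env = (env.poly k i).eval (-(root k env ^ t)) := by
  rw [val, pow_add, root_pow_half env hk, mul_neg_one]

/-- A butterfly: since `root k ^ N = -1`, positions `t` and `t + N` hold the values at `y` and `-y`,
whose half-sum is the even part at `y²`. The odd part uses the half-difference, divided by `y`. -/
theorem even_eq {k : ℕ} (hk : k < m) (i : Fin q) (t : ℕ) :
    even k i t env = (val k i t env + val k i (t + half m k) env) * (1 + 1)⁻¹ := by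
  have h2 : (2 : env.F) ≠ 0 := env.two_ne_zero (by omega)
  rw [val_add_half env hk, val, ← eval_even_add_odd _ (root k env ^ t),
    ← eval_even_add_odd _ (-(root k env ^ t)), even, root_succ,
    neg_sq, ← pow_mul, ← pow_mul, mul_comm 2 t, one_add_one_eq_two]
  field_simp
  ring

theorem odd_eq {k : ℕ} (hk : k < m) (i : Fin q) {t : ℕ} (ht : t ≤ 2 * half m k) :
    odd k i t env = (val k i t env - val k i (t + half m k) env) * (1 + 1)⁻¹ *
      root k env ^ (2 * half m k - t) := by
  have h2 : (2 : env.F) ≠ 0 := env.two_ne_zero (by omega)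
  have h3 : root k env ^ t * root k env ^ (2 * half m k - t) = 1 := by
    rw [← pow_add, Nat.add_sub_cancel' ht, root_pow_two_mul_half env hk]
  rw [val_add_half env hk, val, ← eval_even_add_odd _ (root k env ^ t),
    ← eval_even_add_odd _ (-(root k env ^ t)), odd, root_succ,
    neg_sq, ← pow_mul, ← pow_mul, mul_comm 2 t, one_add_one_eq_two]
  generalize (oddPart (env.poly k i)).eval _ = o
  field_simp
  linear_combination (-2 * o) * h3

theorem val_succ {k : ℕ} (hk : k < m) (i : Fin q) (t : ℕ) :
    val (k + 1) i t env = even k i t env + env.r ⟨k, hk⟩ * odd k i t env := by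
  rw [val, poly, prefixFold_succ _ hk, foldBy, eval_add, eval_mul, eval_C]
  rfl

theorem comp_eq (k j t : ℕ) : comp k j t env =
    (horner (fun i => (C (even k i t env) + X * C (odd k i t env) : env.F[X]))
      (fun s => C (env.g.coeff s)) (List.finRange q) d 0).coeff j := by
  rw [comp, eval_component]
  have := horner_eq_aeval env.totalDegree_le
    (fun i => (C (even k i t env) + X * C (odd k i t env) : env.F[X]))
  rw [Polynomial.algebraMap_eq] at this
  exact congrArg (fun p => Polynomial.coeff p j) this.symm

theorem reduced_eq {k : ℕ} (hk : k < m) (j t : ℕ) :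
    (component env.g j (env.poly k) % (X ^ half m k - 1)).eval (root (k + 1) env ^ t) =
      comp k j t env := by
  refine eval_mod_X (half_pos m k) _ ?_
  rw [← pow_mul, mul_comm, pow_mul, (env.root_succ_isPrimitiveRoot hk).pow_eq_one, one_pow]

theorem shifted_eq {k : ℕ} (hk : k < m) (j t : ℕ) :
    shifted k j t env = root k env ^ (2 * (t * (j / 2)) % (2 * half m k)) * comp k j t env := by
  have h1 := env.root_pow_two_mul_half hk
  rw [shifted, eval_mod_X (half_pos m k), eval_mul, eval_pow, eval_X, comp,
    ← pow_eq_pow_mod _ h1, root_succ, ← pow_mul, ← pow_mul]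
  rw [← pow_mul, mul_comm, pow_mul, (env.root_succ_isPrimitiveRoot hk).pow_eq_one, one_pow]

/-- On `N`-th roots of unity `y^(N-1) = y⁻¹`, so reversal of the coefficients reverses the order of
the values, up to this factor. The index is reduced modulo `N` because of `t = 0`. -/
theorem reversed_eq {k : ℕ} (hk : k < m) (j : ℕ) {t : ℕ} (ht : t < half m k) :
    reversed k j t env = root k env ^ (2 * (half m k - t)) *
      shifted k j ((half m k - t) % half m k) env := by
  have hN := half_pos m k
  have hρ := (env.root_succ_isPrimitiveRoot hk).pow_eq_one
  have h1 : root (k + 1) env ^ t * root (k + 1) env ^ (half m k - t) = 1 := by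
    rw [← pow_add, Nat.add_sub_cancel' ht.le, hρ]
  have h2 : (root (k + 1) env ^ t)⁻¹ = root (k + 1) env ^ (half m k - t) :=
    inv_eq_of_mul_eq_one_right h1
  have h3 : (root (k + 1) env ^ t) ^ (half m k - 1) = root (k + 1) env ^ (half m k - t) := by
    rw [← h2]
    refine eq_inv_of_mul_eq_one_left ?_
    rw [← pow_succ, Nat.sub_add_cancel hN, ← pow_mul, mul_comm, pow_mul, hρ, one_pow]
  rw [reversed, eval_reflect _ (pow_ne_zero _ (env.root_ne_zero _))
    (natDegree_le_of_degree_lt hN (degree_mod_X_lt hN _)), h2, h3, shifted,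
    ← pow_eq_pow_mod _ hρ, pow_mul (root k env), ← root_succ]

theorem coeff_eq {k : ℕ} (hk : k < m) (j : ℕ) {l : ℕ} (hl : l < half m k) :
    coeff k j l env = (half m k : env.F)⁻¹ * ∑ t : Fin (half m k),
      shifted k j t env * root k env ^ (2 * (l * (half m k - t)) % (2 * half m k)) := by
  have hN0 : ((half m k : ℕ) : env.F) ≠ 0 := by
    rw [half, Nat.cast_pow]
    exact pow_ne_zero _ (by exact_mod_cast env.two_ne_zero (by omega))
  rw [coeff, coeff_eq_sum_eval (half_pos m k) (degree_mod_X_lt (half_pos m k) _)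
    (env.root_succ_isPrimitiveRoot hk) hN0 hl]
  congr 1
  refine Finset.sum_congr rfl fun t _ => ?_
  rw [← pow_eq_pow_mod _ (env.root_pow_two_mul_half hk), pow_mul (root k env), ← root_succ]
  rfl

end ProverEnv

open ProverEnv

/-- What is kept in memory before round `k`. -/
def stored (q m d : ℕ) : ℕ → Set (∀ env : ProverEnv.{u} q m d, env.F)
  | 0 => {root 0} ∪ Set.range fun a : Fin q × Fin (2 ^ m) => val 0 a.1 a.2
  | k + 1 => {root (k + 1)} ∪
      ((Set.range fun a : Fin q × Fin (half m k) => even k a.1 a.2) ∪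
        Set.range fun a : Fin q × Fin (half m k) => odd k a.1 a.2)

/-- The messages of round `k`, oracles being given by their values. -/
def outputs (q m d k : ℕ) : Set (∀ env : ProverEnv.{u} q m d, env.F) :=
  (Set.range fun a : Fin (d + 1) × Fin (half m k) => comp k a.1 a.2) ∪
    ((Set.range fun a : Fin (d + 1) × Fin (half m k) => shifted k a.1 a.2) ∪
      ((Set.range fun a : Fin (d + 1) × Fin (half m k) => reversed k a.1 a.2) ∪
        Set.range fun a : Σ j : Fin (d + 1), Fin ((j : ℕ) / 2 % half m k) =>
          coeff k a.1 a.2))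

/-- The inputs of round `k`. -/
def inputs (q m d k : ℕ) : Set (∀ env : ProverEnv.{u} q m d, env.F) :=
  Set.range fun i env => ProverEnv.input k env i

variable (q m d)

/-- The challenge of a round becomes known only after its message. The even and odd parts are
therefore kept and folded at the start of the next round, while round `0` finds its values in the
input. -/
theorem comp_val {k : ℕ} (hk : k < m) :
    Comp binaryCost (ProverEnv.input k) (4 * q * half m k) (stored.{u} q m d k ∪ inputs q m d k)
      (Set.range fun a : Fin q × Fin (2 * half m k) => val k a.1 a.2) := by
  cases k with
  | zero =>
    refine (Comp.of_subset ?_).mono (Nat.zero_le _) le_rfl le_rfl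
    rintro _ ⟨⟨i, t⟩, rfl⟩
    exact Or.inl (Or.inr ⟨(i, ⟨t, t.2.trans_eq (two_mul_half hk)⟩), rfl⟩)
  | succ k =>
    have hk' : k < m := by omega
    have hN : 2 * half m (k + 1) = half m k := by
      rw [two_mul_half hk, half, Nat.sub_sub, add_comm 1 k]
    refine Comp.range (c := 2) ?_ (by simp; nlinarith)
    rintro ⟨i, t⟩
    have hval : val (k + 1) i t = even k i t +
        (fun env : ProverEnv.{u} q m d => env.r ⟨k, hk'⟩) * odd k i t :=
      funext fun env => val_succ env hk' i t
    have ht : (t : ℕ) < half m k := by have := t.2; omega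
    simp only
    rw [hval]
    refine Comp.bind (Comp.mul (Or.inr ⟨Sum.inr (Fin.last k), ?_⟩)
      (Or.inl (Or.inr (Or.inr ⟨(i, ⟨t, ht⟩), rfl⟩))))
      (Comp.add (Or.inr (Or.inl (Or.inr (Or.inl ⟨(i, ⟨t, ht⟩), rfl⟩)))) (Or.inl rfl)) le_rfl
    funext env
    simp [ProverEnv.input, hk']

/-! ### Cost of the separate tasks in a prover round -/

section Step

variable {ι : Type} {inp : ∀ env : ProverEnv.{u} q m d, ι → env.F}
  {S : Set (∀ env : ProverEnv.{u} q m d, env.F)} {k : ℕ}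

theorem comp_even_odd (hk : k < m)
    (hval : ∀ i, ∀ t < 2 * half m k, val k i t ∈ S) (hinv : (1 + 1)⁻¹ ∈ S)
    (hroot : ∀ t ≤ 2 * half m k, root k ^ t ∈ S) :
    Comp binaryCost inp (5 * q * half m k) S
      ((Set.range fun a : Fin q × Fin (half m k) => even k a.1 a.2) ∪
        Set.range fun a : Fin q × Fin (half m k) => odd k a.1 a.2) := by
  have h1 : Comp binaryCost inp (2 * q * half m k) S
      (Set.range fun a : Fin q × Fin (half m k) => even k a.1 a.2) := by
    refine Comp.range (c := 2) ?_ (by simp; nlinarith)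
    rintro ⟨i, t⟩
    have h : even k i t = (val k i t + val k i (t + half m k)) * (1 + 1)⁻¹ :=
      funext fun env : ProverEnv.{u} q m d => even_eq env hk i t
    simp only
    rw [h]
    exact Comp.bind (Comp.add (hval i t (by omega)) (hval i _ (by omega)))
      (Comp.mul (Or.inl rfl) (Or.inr hinv)) le_rfl
  have h2 : Comp binaryCost inp (3 * q * half m k) S
      (Set.range fun a : Fin q × Fin (half m k) => odd k a.1 a.2) := by
    refine Comp.range (c := 3) ?_ (by simp; nlinarith)
    rintro ⟨i, t⟩
    have h : odd k i t = (val k i t - val k i (t + half m k)) * (1 + 1)⁻¹ *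
        root k ^ (2 * half m k - t) :=
      funext fun env : ProverEnv.{u} q m d => odd_eq env hk i (t := (t : ℕ)) (by omega)
    simp only
    rw [h]
    refine Comp.bind (c₂ := 2) (Comp.sub (hval i t (by omega)) (hval i (t + half m k) (by omega))) ?_
      le_rfl
    exact Comp.bind (Comp.mul (Or.inl rfl) (Or.inr hinv))
      (Comp.mul (Or.inl rfl) (Or.inr (Or.inr (hroot _ (Nat.sub_le _ _))))) le_rfl
  exact (h1.then (h2.mono le_rfl Set.subset_union_left le_rfl)).mono (by nlinarith) le_rfl le_rfl

theorem comp_comp (h0 : 0 ∈ S)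
    (heven : ∀ i, ∀ t < half m k, even k i t ∈ S) (hodd : ∀ i, ∀ t < half m k, odd k i t ∈ S)
    (hc : ∀ s, (fun env : ProverEnv.{u} q m d => env.g.coeff s) ∈ S) :
    Comp binaryCost inp (4 * (d + 1) * (d + q).choose q * half m k) S
      (Set.range fun a : Fin (d + 1) × Fin (half m k) => comp k a.1 a.2) := by
  have h : ∀ t : Fin (half m k), Comp binaryCost inp (4 * (d + 1) * (d + q).choose q) S
      (Set.range fun j : Fin (d + 1) => comp k j t) := by
    intro t
    obtain ⟨T, hT, hcomp⟩ := comp_horner (pc := binaryCost) (inp := inp) h0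
      (a := fun i => even k i t) (b := fun i => odd k i t)
      (c := fun s (env : ProverEnv.{u} q m d) => env.g.coeff s)
      (fun i => heven i t t.2) (fun i => hodd i t t.2) hc d (List.finRange q) d 0
    rw [List.length_finRange, add_comm q d, Nat.choose_symm_add] at hT
    refine hcomp.mono (by omega) le_rfl ?_
    rintro _ ⟨j, rfl⟩
    refine ⟨j, funext fun env => ?_⟩
    -- `comp_horner` works in the product ring of all environments; projection to one environment is
    -- a ring homomorphism, with which Horner's rule commutes.
    have := map_horner (Polynomial.mapRingHom
      (Pi.evalRingHom (fun env : ProverEnv.{u} q m d => env.F) env))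
      (fun i => C (even k i t) + X * C (odd k i t))
      (fun s => C (fun env : ProverEnv.{u} q m d => env.g.coeff s)) (List.finRange q) d 0
    have h2 := congrArg (fun p => Polynomial.coeff p j) this
    simp only [coe_mapRingHom, coeff_map, Pi.evalRingHom_apply, Polynomial.map_add,
      Polynomial.map_mul, map_C, map_X] at h2
    exact h2.trans (comp_eq env k j t).symm
  refine (Comp.iUnion h (b := 4 * (d + 1) * (d + q).choose q * half m k)
    (by simp; nlinarith)).mono le_rfl le_rfl ?_
  rintro _ ⟨⟨j, t⟩, rfl⟩
  exact Set.mem_iUnion.2 ⟨t, j, rfl⟩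

theorem comp_shifted (hk : k < m) (hroot : ∀ t ≤ 2 * half m k, root k ^ t ∈ S)
    (hcomp : ∀ j ≤ d, ∀ t < half m k, comp k j t ∈ S) :
    Comp binaryCost inp ((d + 1) * half m k) S
      (Set.range fun a : Fin (d + 1) × Fin (half m k) => shifted k a.1 a.2) := by
  refine Comp.range (c := 1) ?_ (by simp)
  rintro ⟨j, t⟩
  have h : shifted k j t = root k ^ (2 * ((t : ℕ) * ((j : ℕ) / 2)) % (2 * half m k)) * comp k j t :=
    funext fun env : ProverEnv.{u} q m d => shifted_eq env hk j t
  have hN := half_pos m k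
  simp only
  rw [h]
  exact Comp.mul (hroot _ (Nat.mod_lt _ (by omega)).le) (hcomp _ (by omega) _ t.2)

theorem comp_reversed (hk : k < m) (hroot : ∀ t ≤ 2 * half m k, root k ^ t ∈ S)
    (hshifted : ∀ j ≤ d, ∀ t < half m k, shifted k j t ∈ S) :
    Comp binaryCost inp ((d + 1) * half m k) S
      (Set.range fun a : Fin (d + 1) × Fin (half m k) => reversed k a.1 a.2) := by
  refine Comp.range (c := 1) ?_ (by simp)
  rintro ⟨j, t⟩
  have h : reversed k j t = root k ^ (2 * (half m k - t)) *
      shifted k j ((half m k - t) % half m k) :=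
    funext fun env : ProverEnv.{u} q m d => reversed_eq env hk j t.2
  have hN := half_pos m k
  simp only
  rw [h]
  exact Comp.mul (hroot _ (by omega)) (hshifted _ (by omega) _ (Nat.mod_lt _ hN))

/-- No fast transform is needed: at most `d` coefficients are wanted for each `j`, so the direct
inverse transform costs `O(d² N)` in total. -/
theorem comp_coeff (hk : k < m) (hroot : ∀ t ≤ 2 * half m k, root k ^ t ∈ S)
    (hN : ((half m k : ℕ) : ∀ env : ProverEnv.{u} q m d, env.F)⁻¹ ∈ S)
    (hshifted : ∀ j ≤ d, ∀ t < half m k, shifted k j t ∈ S) :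
    Comp binaryCost inp ((d + 1) * d * (2 * half m k + 3)) S
      (Set.range fun a : Σ j : Fin (d + 1), Fin ((j : ℕ) / 2 % half m k) =>
          coeff k a.1 a.2) := by
  have hpos := half_pos m k
  refine Comp.range (c := 2 * half m k + 3) ?_ ?_
  · rintro ⟨j, l⟩
    have hl : (l : ℕ) < half m k := l.2.trans (Nat.mod_lt _ hpos)
    have h : coeff k j l = ((half m k : ℕ) : ∀ env : ProverEnv.{u} q m d, env.F)⁻¹ *
        ∑ t : Fin (half m k), shifted k j t *
          root k ^ (2 * (l * (half m k - t)) % (2 * half m k)) := by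
      funext env
      rw [coeff_eq env hk j hl]
      simp
    simp only
    rw [h]
    refine Comp.bind (Comp.dot (b := 2 * half m k + 2) (fun t => hshifted _ (by omega) _ t.2)
      (fun t => hroot _ (Nat.mod_lt _ (by omega)).le) (by simp; omega))
      (Comp.mul (Or.inr hN) (Or.inl rfl)) le_rfl
  · refine Nat.mul_le_mul_right _ ?_
    rw [Fintype.card_sigma]
    refine (Finset.sum_le_card_nsmul _ _ d fun j _ => ?_).trans (by simp)
    rw [Fintype.card_fin]
    exact (Nat.mod_le _ _).trans (by omega)

end Step

theorem comp_round {k : ℕ} (hk : k < m) :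
    Comp binaryCost (ProverEnv.input k)
      (9 * q * half m k + 4 * (d + 1) * (d + q).choose q * half m k + 2 * (d + 1) * half m k +
        (d + 1) * d * (2 * half m k + 3) + 4 * half m k + 9)
      (stored.{u} q m d k ∪ inputs q m d k) (outputs q m d k ∪ stored q m d (k + 1)) := by
  have hN := half_pos m k
  set B := stored.{u} q m d k ∪ inputs q m d k with hB
  have hr : root k ∈ B := by
    cases k with
    | zero => exact Or.inl (Or.inl rfl)
    | succ k => exact Or.inl (Or.inl rfl)
  let V : Set (∀ env : ProverEnv.{u} q m d, env.F) :=
    Set.range fun a : Fin q × Fin (2 * half m k) => val k a.1 a.2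
  let R : Set (∀ env : ProverEnv.{u} q m d, env.F) :=
    Set.range fun t : Fin (2 * half m k + 1) => root k ^ (t : ℕ)
  have hR : ∀ t ≤ 2 * half m k, root k ^ t ∈ R := fun t ht => ⟨⟨t, by omega⟩, rfl⟩
  have hconst : Comp binaryCost (ProverEnv.input k) (2 * half m k + 8) B
      (({0} : Set (∀ env : ProverEnv.{u} q m d, env.F)) ∪ ({(1 + 1)⁻¹} ∪
        {((half m k : ℕ) : ∀ env : ProverEnv.{u} q m d, env.F)⁻¹})) := by
    refine ((Comp.zero).then (Comp.then (c₁ := 3) (c₂ := 2 * half m k + 3) ?_ ?_)).mono (by omega)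
      le_rfl le_rfl
    · refine Comp.bind (c₂ := 2) Comp.one ?_ le_rfl
      exact Comp.bind (Comp.add (Or.inl rfl) (Or.inl rfl)) (Comp.inv (Or.inl rfl)) le_rfl
    -- Programs contain no constant but `1`, so `N` is added up from `N` ones; a cost linear in `N`
    -- is affordable.
    · have h := Comp.sum (pc := binaryCost) (inp := ProverEnv.input k)
        (S := (B ∪ ({0} : Set (∀ env : ProverEnv.{u} q m d, env.F))) ∪ {(1 + 1)⁻¹})
        (Finset.range (half m k)) (fun _ => 1) (fun _ _ => Comp.one)
      simp only [Finset.sum_const, Finset.card_range, nsmul_one] at h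
      exact Comp.bind h (Comp.inv (Or.inl rfl)) (by omega)
  let Z : Set (∀ env : ProverEnv.{u} q m d, env.F) := {0} ∪ ({(1 + 1)⁻¹} ∪
        {((half m k : ℕ) : ∀ env : ProverEnv.{u} q m d, env.F)⁻¹})
  let EO : Set (∀ env : ProverEnv.{u} q m d, env.F) :=
    (Set.range fun a : Fin q × Fin (half m k) => even k a.1 a.2) ∪
        Set.range fun a : Fin q × Fin (half m k) => odd k a.1 a.2
  let G : Set (∀ env : ProverEnv.{u} q m d, env.F) :=
    Set.range fun a : Fin (d + 1) × Fin (half m k) => comp k a.1 a.2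
  let H : Set (∀ env : ProverEnv.{u} q m d, env.F) :=
    Set.range fun a : Fin (d + 1) × Fin (half m k) => shifted k a.1 a.2
  have h1 : Comp binaryCost (ProverEnv.input k) (4 * q * half m k) B V := comp_val q m d hk
  have h2 : Comp binaryCost (ProverEnv.input k) (2 * half m k + 1) (B ∪ V) R :=
    Comp.powers (Or.inl hr) _
  have h3 : Comp binaryCost (ProverEnv.input k) (2 * half m k + 8) (B ∪ V ∪ R) Z :=
    hconst.mono le_rfl (fun v hv => Or.inl (Or.inl hv)) le_rfl
  have h4 : Comp binaryCost (ProverEnv.input k) (5 * q * half m k) (B ∪ V ∪ R ∪ Z) EO :=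
    comp_even_odd q m d hk (fun i t ht => Or.inl (Or.inl (Or.inr ⟨(i, ⟨t, ht⟩), rfl⟩)))
      (Or.inr (Or.inr (Or.inl rfl))) (fun t ht => Or.inl (Or.inr (hR t ht)))
  have h5 : Comp binaryCost (ProverEnv.input k) (4 * (d + 1) * (d + q).choose q * half m k)
      (B ∪ V ∪ R ∪ Z ∪ EO) G := by
    refine comp_comp q m d (Or.inl (Or.inr (Or.inl rfl)))
      (fun i t ht => Or.inr (Or.inl ⟨(i, ⟨t, ht⟩), rfl⟩))
      (fun i t ht => Or.inr (Or.inr ⟨(i, ⟨t, ht⟩), rfl⟩)) (fun s => ?_)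
    exact Or.inl (Or.inl (Or.inl (Or.inl (Or.inr ⟨Sum.inl (.coeff s), rfl⟩))))
  have h6 : Comp binaryCost (ProverEnv.input k) ((d + 1) * half m k)
      (B ∪ V ∪ R ∪ Z ∪ EO ∪ G) H :=
    comp_shifted q m d hk (fun t ht => Or.inl (Or.inl (Or.inl (Or.inr (hR t ht)))))
      (fun j hj t ht => Or.inr ⟨(⟨j, by omega⟩, ⟨t, ht⟩), rfl⟩)
  have hH : ∀ j ≤ d, ∀ t < half m k, shifted k j t ∈ B ∪ V ∪ R ∪ Z ∪ EO ∪ G ∪ H :=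
    fun j hj t ht => Or.inr ⟨(⟨j, by omega⟩, ⟨t, ht⟩), rfl⟩
  have hR' : ∀ t ≤ 2 * half m k, root k ^ t ∈ B ∪ V ∪ R ∪ Z ∪ EO ∪ G ∪ H :=
    fun t ht => Or.inl (Or.inl (Or.inl (Or.inl (Or.inr (hR t ht)))))
  have h7 : Comp binaryCost (ProverEnv.input k) ((d + 1) * half m k)
      (B ∪ V ∪ R ∪ Z ∪ EO ∪ G ∪ H)
      (Set.range fun a : Fin (d + 1) × Fin (half m k) => reversed k a.1 a.2) :=
    comp_reversed q m d hk hR' hH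
  have h8 := (comp_coeff q m d (inp := ProverEnv.input k) hk hR'
    (Or.inl (Or.inl (Or.inl (Or.inr (Or.inr (Or.inr rfl)))))) hH)
  refine (h1.then (h2.then (h3.then (h4.then (h5.then (h6.then (h7.then
    (h8.mono le_rfl Set.subset_union_left le_rfl)))))))).mono ?_ le_rfl ?_
  · generalize half m k = N
    generalize (d + q).choose q = c
    apply le_of_eq
    ring
  · have hroot : root (k + 1) = (root k : ∀ env : ProverEnv.{u} q m d, env.F) ^ 2 :=
      funext fun env => root_succ env k
    rintro v ((hv | hv | hv | hv) | hv | hv)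
    · exact Or.inr (Or.inr (Or.inr (Or.inr (Or.inl hv))))
    · exact Or.inr (Or.inr (Or.inr (Or.inr (Or.inr (Or.inl hv)))))
    · exact Or.inr (Or.inr (Or.inr (Or.inr (Or.inr (Or.inr (Or.inl hv))))))
    · exact Or.inr (Or.inr (Or.inr (Or.inr (Or.inr (Or.inr (Or.inr hv))))))
    · rw [Set.mem_singleton_iff.1 hv, hroot]
      -- The next generator is the square of the present one and already stands in the table of
      -- powers, since `2 ≤ 2N`.
      exact Or.inr (Or.inl (hR 2 (by omega)))
    · exact Or.inr (Or.inr (Or.inr (Or.inl hv)))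

end ProverRounds

/-! ### Assembling the prover's program over all rounds -/

section ProverProgram

open ProverEnv

variable {q m d : ℕ}

/-- The binomial coefficient dominates `q`, `d + 1` and the smaller `(d + q).choose q` actually
incurred by Horner's rule. The terms then add up to at most `37` multiples, rounded up to `40`. -/
theorem round_cost_le (hq : 1 ≤ q) (hd : 1 ≤ d) {N : ℕ} (hN : 0 < N) :
    9 * q * N + 4 * (d + 1) * (d + q).choose q * N + 2 * (d + 1) * N +
      (d + 1) * d * (2 * N + 3) + 4 * N + 9 ≤ 40 * ((d + 2 * q).choose (2 * q) * d * N) := by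
  set B := (d + 2 * q).choose (2 * q) with hB
  have hBd : B = (d + 2 * q).choose d := by rw [hB, Nat.choose_symm_add]
  have h1 : q ≤ B := by
    have : (1 + 2 * q).choose (2 * q) ≤ B := Nat.choose_le_choose _ (by omega)
    rw [add_comm 1, Nat.choose_succ_self_right] at this
    omega
  have h2 : d + 1 ≤ B := by
    have : (d + 1).choose d ≤ B := hBd ▸ Nat.choose_le_choose _ (by omega)
    rwa [Nat.choose_succ_self_right] at this
  have h3 : (d + q).choose q ≤ B := by
    rw [← Nat.choose_symm_add, hBd]
    exact Nat.choose_le_choose _ (by omega)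
  have hdN : N ≤ d * N := Nat.le_mul_of_pos_left _ hd
  have e1 : q * N ≤ B * d * N := by
    rw [mul_assoc]
    exact Nat.mul_le_mul h1 hdN
  have e2 : (d + 1) * (d + q).choose q * N ≤ 2 * (B * d * N) := by
    calc (d + 1) * (d + q).choose q * N ≤ (2 * d) * B * N :=
          Nat.mul_le_mul_right _ (Nat.mul_le_mul (by omega) h3)
      _ = _ := by ring
  have e3 : (d + 1) * N ≤ B * d * N := by
    rw [mul_assoc]
    exact Nat.mul_le_mul h2 hdN
  have e4 : (d + 1) * d * (2 * N + 3) ≤ 5 * (B * d * N) := by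
    calc (d + 1) * d * (2 * N + 3) ≤ B * d * (5 * N) :=
          Nat.mul_le_mul (Nat.mul_le_mul_right _ h2) (by omega)
      _ = _ := by ring
  have e5 : N ≤ B * d * N := le_trans (by nlinarith) e3
  nlinarith

theorem sum_half_le (m : ℕ) : ∑ k : Fin m, half m k ≤ 2 ^ m := by
  rw [Fin.sum_univ_eq_sum_range (fun k => half m k) m]
  simp only [half]
  rw [Finset.sum_range_reflect (fun i => 2 ^ i) m, Nat.geomSum_eq le_rfl]
  simp

/-- A round of the prover, with the passage to the inputs of the next round. -/
theorem exists_round (hq : 1 ≤ q) (hd : 1 ≤ d) {k : ℕ} (hk : k < m)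
    (mem : ∀ env : ProverEnv.{u} q m d, ℕ → env.F) (n : ℕ)
    (hmem : ∀ v ∈ stored q m d k, Avail (ProverEnv.input k) mem n v) :
    ∃ (p : List (Instr (ProverInput q m ⊕ Fin k))) (n' : ℕ),
      time binaryCost p ≤ 40 * ((d + 2 * q).choose (2 * q) * d * half m k) ∧
      (∀ v ∈ outputs q m d k, Avail (ProverEnv.input k)
        (fun env => exec (ProverEnv.input k env) p (mem env)) n' v) ∧
      ∀ v ∈ stored q m d (k + 1), Avail (ProverEnv.input (k + 1))
        (fun env => exec (ProverEnv.input k env) p (mem env)) n' v := by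
  obtain ⟨p, n', -, hp, -, hv⟩ := comp_round q m d hk mem n (by
    rintro v (hv | ⟨i, rfl⟩)
    · exact hmem v hv
    · exact Avail.input _ _ _ i)
  -- The next round has one more challenge among its inputs; the operands for stored values are
  -- relabelled along `Fin.castSucc`.
  refine ⟨p, n', hp.trans (round_cost_le hq hd (half_pos m k)), fun v h => hv v (Or.inl h),
    fun v h => (hv v (Or.inr h)).changeInput (Sum.map id Fin.castSucc) ?_⟩
  rintro env (i | i) <;> rfl

theorem input_eq (env : ProverEnv.{u} q m d) (k : Fin m) :
    ProverEnv.input (k : ℕ) env =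
      Sum.elim (proverInput m env.w env.g env.f) (before env.r k) := by
  rw [ProverEnv.input]
  congr 1
  funext i
  rw [dif_pos (i.2.trans k.2)]
  rfl

theorem exists_proverProgram (hq : 1 ≤ q) (hd : 1 ≤ d) :
    ∃ P : ProverProgram q m d,
      P.time ≤ 40 * ((d + 2 * q).choose (2 * q) * d * 2 ^ m) ∧
      ∀ (F : Type u) [Field F] [Finite F] (w : F) (g : MvPolynomial (Fin q) F)
        (f : Fin q → F[X]) (r : Fin m → F),
        IsPrimitiveRoot w (2 ^ m) → g.totalDegree ≤ d → (∀ i, (f i).natDegree ≤ 2 ^ m - 1) →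
        P.Computes w g f r := by
  let State := (∀ env : ProverEnv.{u} q m d, ℕ → env.F) × ℕ
  -- The condition `k ≤ m` makes the invariant vacuous beyond the last round, so the recursion can
  -- run over all natural numbers with empty code as a dummy.
  let Inv : ℕ → State → Prop := fun k s =>
    k ≤ m → ∀ v ∈ stored q m d k, Avail (ProverEnv.input k) s.1 s.2 v
  have hstep : ∀ (k : ℕ) (s : {s : State // Inv k s}),
      ∃ (p : List (Instr (ProverInput q m ⊕ Fin k))) (s' : {s : State // Inv (k + 1) s}),
        k < m → time binaryCost p ≤ 40 * ((d + 2 * q).choose (2 * q) * d * half m k) ∧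
          s'.1.1 = (fun env => exec (ProverEnv.input k env) p (s.1.1 env)) ∧
          ∀ v ∈ outputs q m d k, Avail (ProverEnv.input k) s'.1.1 s'.1.2 v := by
    rintro k ⟨s, hs⟩
    by_cases hk : k < m
    · obtain ⟨p, n', hp, hout, hsto⟩ := exists_round hq hd hk s.1 s.2 (hs hk.le)
      exact ⟨p, ⟨(_, n'), fun _ => hsto⟩, fun _ => ⟨hp, rfl, hout⟩⟩
    · exact ⟨[], ⟨s, fun h => absurd h hk⟩, fun h => absurd h hk⟩
  choose prog next hnext using hstep
  have hinit : Inv 0 (fun _ => 0, 0) := by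
    rintro - v (hv | ⟨⟨i, t⟩, rfl⟩)
    · refine ⟨Sum.inl (Sum.inl .root), by simp, fun env => ?_⟩
      rw [Set.mem_singleton_iff.1 hv]
      simp [readOperand, ProverEnv.input, proverInput, ProverEnv.root]
    · refine ⟨Sum.inl (Sum.inl (.value i t)), by simp, fun env => ?_⟩
      simp [readOperand, ProverEnv.input, proverInput, ProverEnv.val, ProverEnv.root,
        ProverEnv.poly, prefixFold_zero]
  let st : (k : ℕ) → {s : State // Inv k s} := fun k =>
    Nat.rec ⟨_, hinit⟩ (fun k s => next k s) k
  let code : (k : ℕ) → List (Instr (ProverInput q m ⊕ Fin k)) := fun k => prog k (st k)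
  have hmem : ∀ k < m, (st (k + 1)).1.1 =
      fun env => exec (ProverEnv.input k env) (code k) ((st k).1.1 env) := fun k hk =>
    (hnext k (st k) hk).2.1
  have hout : ∀ k < m, ∀ v ∈ outputs q m d k,
      ∃ o, ∀ env, readOperand (ProverEnv.input k env) ((st (k + 1)).1.1 env) o = v env := by
    intro k hk v hv
    obtain ⟨o, -, ho⟩ := (hnext k (st k) hk).2.2 v hv
    exact ⟨o, ho⟩
  have horacle : ∀ (k : Fin m) (o : OracleKind × Fin (d + 1)) (t : Fin (half m k)), ∃ a,
      ∀ env : ProverEnv.{u} q m d,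
        readOperand (ProverEnv.input k env) ((st (k + 1)).1.1 env) a =
          (((honest m d env.g env.f).play env.r k).oracle o).eval
            ((env.w ^ 2 ^ ((k : ℕ) + 1)) ^ (t : ℕ)) := by
    rintro k ⟨o, j⟩ t
    have hh := fun env : ProverEnv.{u} q m d =>
      congrFun (roundMsgs_honest (d := d) env.g env.f env.r) k
    cases o with
    | reduced =>
      obtain ⟨a, ha⟩ := hout k k.2 (ProverEnv.comp k j t) (Or.inl ⟨(j, t), rfl⟩)
      refine ⟨a, fun env => (ha env).trans ((env.reduced_eq k.2 j t).symm.trans ?_)⟩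
      exact congrArg (fun M => (RoundMsg.reduced M j).eval _) (hh env).symm
    | shifted =>
      obtain ⟨a, ha⟩ := hout k k.2 (ProverEnv.shifted k j t) (Or.inr (Or.inl ⟨(j, t), rfl⟩))
      refine ⟨a, fun env => (ha env).trans ?_⟩
      exact congrArg (fun M => (RoundMsg.shifted M j).eval _) (hh env).symm
    | reversed =>
      obtain ⟨a, ha⟩ := hout k k.2 (ProverEnv.reversed k j t)
        (Or.inr (Or.inr (Or.inl ⟨(j, t), rfl⟩)))
      refine ⟨a, fun env => (ha env).trans ?_⟩
      exact congrArg (fun M => (RoundMsg.reversed M j).eval _) (hh env).symm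
  have helem : ∀ (k : Fin m) (e : Σ j : Fin (d + 1), Fin (((j : ℕ) / 2) % half m k)), ∃ a,
      ∀ env : ProverEnv.{u} q m d,
        readOperand (ProverEnv.input k env) ((st (k + 1)).1.1 env) a =
          ((honest m d env.g env.f).play env.r k).elem e := by
    rintro k ⟨j, l⟩
    obtain ⟨a, ha⟩ := hout k k.2 (ProverEnv.coeff k j l)
      (Or.inr (Or.inr (Or.inr ⟨⟨j, l⟩, rfl⟩)))
    refine ⟨a, fun env => (ha env).trans ?_⟩
    exact congrArg (fun M => (RoundMsg.shifted M j).coeff l)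
      (congrFun (roundMsgs_honest (d := d) env.g env.f env.r) k).symm
  choose oracleOut horacleOut using horacle
  choose elemOut helemOut using helem
  let P : ProverProgram q m d := ⟨fun k => code k, oracleOut, elemOut⟩
  refine ⟨P, ?_, ?_⟩
  · calc P.time ≤ ∑ k : Fin m, 40 * ((d + 2 * q).choose (2 * q) * d * half m k) :=
          Finset.sum_le_sum fun k _ => (hnext k (st k) k.2).1
      _ = 40 * ((d + 2 * q).choose (2 * q) * d * ∑ k : Fin m, half m k) := by
          simp only [Finset.mul_sum]
      _ ≤ _ := by gcongr; exact sum_half_le m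
  · intro F _ _ w g f r hw hg hf
    let env : ProverEnv.{u} q m d :=
      ⟨F, w, g, f, r, hw, hg, fun i => degree_lt_of_natDegree_le (pow_pos two_pos m) (hf i)⟩
    have hmemory : ∀ k ≤ m, P.memory (proverInput m w g f) r k = (st k).1.1 env := by
      intro k
      induction k with
      | zero => exact fun _ => rfl
      | succ k ih =>
        intro hk
        rw [ProverProgram.memory, dif_pos (Nat.lt_of_succ_le hk),
          ih (Nat.le_of_succ_le hk), hmem k hk]
        exact congrArg (fun i => exec i (code k) ((st k).1.1 env)) (input_eq env ⟨k, hk⟩).symm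
    intro k
    have hk := hmemory ((k : ℕ) + 1) k.2
    have hi := input_eq env k
    refine ⟨fun o t => ?_, fun e => ?_⟩
    · refine Eq.trans ?_ (horacleOut k o t env)
      rw [hk, hi]
    · refine Eq.trans ?_ (helemOut k e env)
      rw [hk, hi]

end ProverProgram

/-! ### Communication -/

section Communication

variable (q m d : ℕ)

theorem numElems_le (hd : 1 ≤ d) : (dgmFormat q m d).numElems ≤ 2 * (d ^ 2 * m) := by
  have h : ∀ k : Fin m, Fintype.card (Σ j : Fin (d + 1), Fin (((j : ℕ) / 2) % half m k)) ≤
      2 * d ^ 2 := by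
    intro k
    rw [Fintype.card_sigma]
    refine (Finset.sum_le_card_nsmul _ _ d fun j _ => ?_).trans ?_
    · rw [Fintype.card_fin]
      exact (Nat.mod_le _ _).trans (by omega)
    · simp
      nlinarith
  calc (dgmFormat q m d).numElems
      = ∑ k : Fin m, Fintype.card (Σ j : Fin (d + 1), Fin (((j : ℕ) / 2) % half m k)) := by
        unfold Format.numElems
        refine Finset.sum_congr rfl fun k _ => ?_
        exact Fintype.card_congr (Equiv.refl _)
    _ ≤ ∑ _k : Fin m, 2 * d ^ 2 := Finset.sum_le_sum fun k _ => h k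
    _ = _ := by simp; ring

theorem card_oracleKind : Fintype.card OracleKind = 3 := rfl

theorem card_queryKind : Fintype.card QueryKind = 6 := rfl

theorem numOracles_le (hd : 1 ≤ d) : (dgmFormat q m d).numOracles ≤ 6 * (d * m) := by
  calc (dgmFormat q m d).numOracles
      = ∑ _k : Fin m, Fintype.card (OracleKind × Fin (d + 1)) := by
        unfold Format.numOracles
        refine Finset.sum_congr rfl fun k _ => ?_
        exact Fintype.card_congr (Equiv.refl _)
    _ = m * (3 * (d + 1)) := by simp [card_oracleKind]
    _ ≤ _ := by nlinarith

theorem numQueries_le (hm : 1 ≤ m) (hd : 1 ≤ d) :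
    (dgmFormat q m d).numQueries ≤ 13 * (d * m) := by
  calc (dgmFormat q m d).numQueries
      = Fintype.card (Option (Fin m × Fin (d + 1) × QueryKind)) :=
        Fintype.card_congr (Equiv.refl _)
    _ = m * ((d + 1) * 6) + 1 := by simp [card_queryKind]
    _ ≤ _ := by nlinarith

end Communication

end DGM

open DGM
theorem proposition2 :
    ∃ K : ℕ, ∀ q m d : ℕ, 1 ≤ q → 1 ≤ m → 1 ≤ d →
      -- communication
      (dgmFormat q m d).rounds = m ∧
      (dgmFormat q m d).numElems ≤ K * (d ^ 2 * m) ∧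
      (dgmFormat q m d).numOracles ≤ K * (d * m) ∧
      (dgmFormat q m d).numQueries ≤ K * (d * m) ∧
      -- prover time
      (∃ P : ProverProgram q m d,
        P.time ≤ K * ((d + 2 * q).choose (2 * q) * d * 2 ^ m) ∧
        ∀ (F : Type u) [Field F] [Finite F] (w : F) (g : MvPolynomial (Fin q) F)
          (f : Fin q → F[X]) (r : Fin m → F),
          IsPrimitiveRoot w (2 ^ m) → g.totalDegree ≤ d → (∀ i, (f i).natDegree ≤ 2 ^ m - 1) →
          P.Computes w g f r) ∧
      -- verifier time with one query point for all rounds, every field operation counted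
      (∃ A : VerifierProgram (Unit ⊕ Fin m) (dgmFormat q m d),
        A.time binaryCost ≤ K * (d ^ 2 * m) ∧
        ∀ (F : Type u) [Field F] [Finite F] (x : Fˣ) (r : Fin m → F),
          A.Implements (dgmVerifier F q m d) (Sum.elim (fun _ => (x : F)) r) (fun _ => (x : F)) r) ∧
      -- verifier time with fresh query points, an exponentiation counted as one operation
      (∃ A : VerifierProgram (Fin m ⊕ Fin m) (dgmFormat q m d),
        A.time unitCost ≤ K * (d ^ 2 * m) ∧
        ∀ (F : Type u) [Field F] [Finite F] (x : Fin m → Fˣ) (r : Fin m → F),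
          A.Implements (dgmVerifier F q m d) (Sum.elim (fun k => (x k : F)) r)
            (fun k => (x k : F)) r) ∧
      ∀ (F : Type u) [Field F] [Finite F] (w : F) (g : MvPolynomial (Fin q) F) (D : ℕ),
        IsPrimitiveRoot w (2 ^ m) → g.totalDegree ≤ d → 2 ^ m - 1 ≤ D →
        ∀ (f : Fin q → F[X]) (h : F[X]), (∀ i, (f i).natDegree ≤ 2 ^ m - 1) → h.natDegree ≤ D →
          -- perfect completeness, for any query points
          (DomainIdentity g m f h → ∀ (x : Fin m → Fˣ) (r : Fin m → F),
            ((honest m d g f).play r).DegreeLE D ∧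
            (dgmVerifier F q m d).Accepts (inputOracles m d f h) ((honest m d g f).play r)
              (fun k => (x k : F)) r ∧
            MlinClaim g m f r ((dgmVerifier F q m d).result (inputOracles m d f h)
              ((honest m d g f).play r) (fun k => (x k : F)) r)) ∧
          -- soundness, for either way of sampling the query points
          (¬ DomainIdentity g m f h →
            (dgmVerifier F q m d).SoundFresh D (inputOracles m d f h) (MlinClaim g m f)
              (K * (d * m * D) / Nat.card F) ∧
            (dgmVerifier F q m d).SoundShared D (inputOracles m d f h) (MlinClaim g m f)
              (K * (d * m * D) / Nat.card F)) := by
  -- The largest of the constants obtained, from the verifier's time; the others are `2`, `6`, `13`,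
  -- `40` and, for soundness, `7`.
  refine ⟨61, fun q m d hq hm hd => ⟨rfl, ?_, ?_, ?_, ?_, ?_, ?_, ?_⟩⟩
  · exact (numElems_le q m d hd).trans (by omega)
  · exact (numOracles_le q m d hd).trans (by omega)
  · exact (numQueries_le q m d hm hd).trans (by omega)
  · obtain ⟨P, hP, h⟩ := exists_proverProgram.{u} (m := m) hq hd
    exact ⟨P, hP.trans (by omega), h⟩
  · exact exists_verifierProgram_shared hm hd
  · exact exists_verifierProgram_fresh hm hd
  · intro F _ _ w g D _ hg hD f h hf hh
    have hf' : ∀ i, (f i).degree < (2 ^ m : ℕ) := fun i =>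
      degree_lt_of_natDegree_le (pow_pos two_pos m) (hf i)
    refine ⟨fun hc x r => honest_complete g f h hm hD hg hf' hc x r, fun hc => ?_⟩
    have hle : (7 * (d * m * D) / Nat.card F : ℝ) ≤ (61 : ℕ) * (d * m * D) / Nat.card F := by
      gcongr
      norm_num
    exact ⟨fun Ω _ _ P hP => (soundFresh hm hd hD hg hf' hh hc Ω P hP).trans hle,
      fun Ω _ _ P hP => (soundShared hm hd hD hg hf' hh hc Ω P hP).trans hle⟩
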